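/- **Model.** A cellular uplink and an ad hoc network share $K$ sub-channels, and $M\ge 1$ of these sub-channels are assigned to mobile users; put $\alpha=M/K$. Base stations form a homogeneous Poisson point process (PPP) in $\mathbb{R}^2$ of density $\lambda_u/M$. On each of the $M$ sub-channels every base station serves one mobile user at distance $r$, so mobile users have density $\lambda_u$; the displacements from the base stations to their users on a given sub-channel are i.i.d. Independently, ad hoc transmitters form a homogeneous PPP of density $\lambda_a$, each with a receiver at distance $d$ (with i.i.d. displacements), and each selects a sub-channel independently and uniformly, either among all $K$ sub-channels (*blind transmission*) or among the $K-M$ sub-channels not used by mobile users (*frequency mutual exclusion*; here $M<K$). Let $\eta>2$ be the path-loss exponent and $\delta=2/\eta\in(0,1)$. The received signal power is $r^{-\eta}Q$ at a base station and $d^{-\eta}W$ at an ad hoc receiver, and an interferer at distance $D$ on the same sub-channel contributes $D^{-\eta}G$. All fading gains are independent (i.i.d. Rayleigh fading, one-sided beamforming): $W$ and $Q$ are chi-squared with $L_1\ge1$ and $L_2\ge1$ complex degrees of freedom, i.e. have densities $x^{L_1-1}e^{-x}/\Gamma(L_1)$ and $x^{L_2-1}e^{-x}/\Gamma(L_2)$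 on $(0,\infty)$, and the interference gains $G$ are exponential with mean $1$. A link is in outage if its signal-to-interference ratio is below a threshold $\theta>0$. For $0<\varepsilon<1$, a pair $(\lambda_u,\lambda_a)$ of positive densities is *admissible* if the outage probabilities of the typical cellular link, on each sub-channel assigned to mobile users, and of the typical ad hoc link, on each sub-channel that ad hoc transmitters may select, are at most $\varepsilon$. A *capacity pair* is an admissible pair that is maximal for the componentwise order. **Lemma.** Let $r=d>0$, $L_{\min}=\min(L_1,L_2)$ and $\tilde C=\tilde C(\varepsilon)=\dfrac{K\varepsilon\theta^{-\delta}}{\pi d^2\,\Gamma(1+\delta)}$, and write $f(\varepsilon)\cong g(\varepsilon)$ for $\lim_{\varepsilon\to0^+} f(\varepsilon)/g(\varepsilon)=1$. 1. *Blind transmission.* There is a function $c_1(\varepsilon)$ with $$c_1(\varepsilon)\cong\frac{\tilde C\,\Gamma(L_{\min})}{\Gamma(L_{\min}-\delta)}$$ such that, for every $\varepsilon\in(0,1)$, the capacity pairs are exactly the pairs $\lambda_u,\lambda_a>0$ with $\dfrac{\lambda_u}{\alpha}+\lambda_a=c_1(\varepsilon)$. 2. *Frequency mutual exclusion* ($M<K$).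 For every $\varepsilon\in(0,1)$ capacity pairs exist, and all of them satisfy $\dfrac{\lambda_u}{\alpha}+\dfrac{\lambda_a}{1-\alpha}=c_2(\varepsilon)$ for a function $c_2$ with $$c_2(\varepsilon)\cong\tilde C\left[\frac{\Gamma(L_1)}{\Gamma(L_1-\delta)}+\frac{\Gamma(L_2)}{\Gamma(L_2-\delta)}\right].$$ -/

import Mathlib

open MeasureTheory ProbabilityTheory Filter Topology
open scoped ENNReal NNReal

noncomputable section

/-! ### Poisson point processes and typical points -/

/-- The Euclidean plane. -/
abbrev Plane : Type := EuclideanSpace ℝ (Fin 2)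

/-- The number of points of the enumerated configuration `x` lying in `A`. -/
def pointCount {E : Type*} (A : Set E) (x : ℕ → E) : ℕ∞ := {n | x n ∈ A}.encard

/-- `Φ` is the law of an enumeration `x₀, x₁, …` of a Poisson point process with intensity
measure `Λ`: the number of points in a set of finite intensity is Poisson distributed with mean
the intensity of the set, and the numbers of points in disjoint sets are independent. -/
structure IsPoissonPointProcess {E : Type*} [MeasurableSpace E] (Λ : Measure E)
    (Φ : Measure (ℕ → E)) : Prop where
  isProbabilityMeasure : IsProbabilityMeasure Φ
  map_pointCount : ∀ A : Set E, MeasurableSet A → Λ A ≠ ∞ →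
    Φ.map (pointCount A) = (poissonMeasure (Λ A).toNNReal).map (Nat.cast : ℕ → ℕ∞)
  indep : ∀ (m : ℕ) (A : Fin m → Set E), (∀ i, MeasurableSet (A i)) → (∀ i, Λ (A i) ≠ ∞) →
    Pairwise (Function.onFun Disjoint A) → iIndepFun (fun i => pointCount (A i)) Φ

/-- `Φ` is the law of an enumeration of a homogeneous Poisson point process of density `l`. -/
def IsHomogeneousPPP (l : ℝ) (Φ : Measure (ℕ → Plane)) : Prop :=
  IsPoissonPointProcess (ENNReal.ofReal l • (volume : Measure Plane)) Φ

/-- The unit square of the plane. -/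
def unitSquare : Set Plane := {x | ∀ i, 0 ≤ x i ∧ x i < 1}

/-- The Palm probability that a typical point of a stationary marked point process `(X i)`, among
the points `i` with property `C i`, has property `D i`: the expected number of points in the unit
square with properties `C` and `D`, divided by the expected number of points in the unit square
with property `C`. -/
def typicalProb {Ω : Type*} [MeasurableSpace Ω] (P : Measure Ω) (X : ℕ → Ω → Plane)
    (C D : ℕ → Set Ω) : ℝ≥0∞ :=
  (∑' i, P ({ω | X i ω ∈ unitSquare} ∩ C i ∩ D i)) / (∑' i, P ({ω | X i ω ∈ unitSquare} ∩ C i))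

/-! ### The overlaid cellular and ad hoc networks -/

/-- The two overlay methods. -/
inductive OverlayMethod : Type
  | blindTransmission
  | frequencyMutualExclusion

/-- The fading coefficients; `K` is the number of sub-channels. -/
inductive FadingLink (K : ℕ) : Type
  /-- from the mobile user of base station `i` on sub-channel `k` to base station `i` -/
  | cellularData (i : ℕ) (k : Fin K)
  /-- from ad hoc transmitter `i` to its receiver -/
  | adHocData (i : ℕ)
  /-- from the mobile user of base station `j` on sub-channel `k` to base station `i` -/
  | userToBase (j i : ℕ) (k : Fin K)
  /-- from ad hoc transmitter `j` to base station `i` -/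
  | nodeToBase (j i : ℕ)
  /-- from the mobile user of base station `j` on sub-channel `k` to ad hoc receiver `i` -/
  | userToNode (j i : ℕ) (k : Fin K)
  /-- from ad hoc transmitter `j` to ad hoc receiver `i` -/
  | nodeToNode (j i : ℕ)

/-- The parameters of the overlaid networks with `K` sub-channels. -/
structure OverlaidNetworks (K : ℕ) where
  /-- path-loss exponent -/
  pathLossExp : ℝ
  /-- SIR threshold -/
  θ : ℝ
  /-- distance between a mobile user and its base station -/
  r : ℝ
  /-- distance between an ad hoc transmitter and its receiver -/
  d : ℝ
  /-- diversity order of the data links of the ad hoc network -/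
  L₁ : ℕ
  /-- diversity order of the data links of the cellular network -/
  L₂ : ℕ
  /-- the sub-channels assigned to mobile users -/
  occupied : Finset (Fin K)
  /-- law of the displacement from a base station to its mobile user on each sub-channel -/
  userShiftLaw : Fin K → Measure Plane
  /-- law of the displacement from an ad hoc transmitter to its receiver -/
  receiverShiftLaw : Measure Plane
  /-- law of the (enumerated) base stations, as a function of their density -/
  basePPP : ℝ → Measure (ℕ → Plane)
  /-- law of the (enumerated) ad hoc transmitters, as a function of their density -/
  nodePPP : ℝ → Measure (ℕ → Plane)

/-- A realization of the networks: base stations, ad hoc transmitters, displacements of the mobile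
users, displacements of the ad hoc receivers, sub-channels of the ad hoc transmitters, fading. -/
abbrev NetworkSample (K : ℕ) : Type :=
  (ℕ → Plane) × (ℕ → Plane) × (ℕ × Fin K → Plane) × (ℕ → Plane) × (ℕ → Fin K) ×
    (FadingLink K → ℝ)

namespace NetworkSample

variable {K : ℕ}

/-- Position of base station `i`. -/
def base (ω : NetworkSample K) (i : ℕ) : Plane := ω.1 i

/-- Position of ad hoc transmitter `i`. -/
def node (ω : NetworkSample K) (i : ℕ) : Plane := ω.2.1 i

/-- Position of the mobile user of base station `i` on sub-channel `k`. -/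
def user (ω : NetworkSample K) (i : ℕ) (k : Fin K) : Plane := ω.base i + ω.2.2.1 (i, k)

/-- Position of the receiver of ad hoc transmitter `i`. -/
def receiver (ω : NetworkSample K) (i : ℕ) : Plane := ω.node i + ω.2.2.2.1 i

/-- Sub-channel selected by ad hoc transmitter `i`. -/
def channel (ω : NetworkSample K) (i : ℕ) : Fin K := ω.2.2.2.2.1 i

/-- Power gains due to fading. -/
def fading (ω : NetworkSample K) (l : FadingLink K) : ℝ := ω.2.2.2.2.2 l

end NetworkSample

namespace OverlaidNetworks

variable {K : ℕ} (N : OverlaidNetworks K)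

/-- The number `M` of sub-channels assigned to mobile users. -/
def numOccupied : ℕ := N.occupied.card

/-- The fraction `α = M / K` of sub-channels assigned to mobile users. -/
def fraction : ℝ := (N.numOccupied : ℝ) / (K : ℝ)

/-- The sub-channels from which ad hoc transmitters select: all of them for blind transmission,
those not used by mobile users for frequency mutual exclusion. -/
def accessible : OverlayMethod → Finset (Fin K)
  | .blindTransmission => Finset.univ
  | .frequencyMutualExclusion => N.occupiedᶜ

/-- Laws of the power gains. Data links: chi-squared with `L₂` resp. `L₁` complex degrees of
freedom, with density `x ^ (L - 1) * exp (-x) / Γ(L)`. Interference links: the same with one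
complex degree of freedom, i.e. unit-mean exponential. -/
def fadingLaw : FadingLink K → Measure ℝ
  | .cellularData _ _ => gammaMeasure N.L₂ 1
  | .adHocData _ => gammaMeasure N.L₁ 1
  | _ => expMeasure 1

/-- Law of the networks when the density of mobile users is `lu` (so that the density of base
stations is `lu / M`) and the density of ad hoc transmitters is `la`. All ingredients are
independent; each transmitter selects its sub-channel uniformly. -/
def law (o : OverlayMethod) (lu la : ℝ) : Measure (NetworkSample K) :=
  (N.basePPP (lu / N.numOccupied)).prod <|
  (N.nodePPP la).prod <|
  (Measure.infinitePi fun nk : ℕ × Fin K => N.userShiftLaw nk.2).prod <|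
  (Measure.infinitePi fun _ : ℕ => N.receiverShiftLaw).prod <|
  (Measure.infinitePi fun _ : ℕ => uniformOn (N.accessible o : Set (Fin K))).prod <|
  Measure.infinitePi N.fadingLaw

/-- Power received at `y` from an interferer at `x` when the fading gain is `g`. -/
def interferencePower (x y : Plane) (g : ℝ) : ℝ≥0∞ :=
  edist x y ^ (-N.pathLossExp) * ENNReal.ofReal g

/-- Interference at base station `i` on sub-channel `k`: mobile users of the other base stations
and ad hoc transmitters that use this sub-channel. -/
def baseInterference (ω : NetworkSample K) (i : ℕ) (k : Fin K) : ℝ≥0∞ :=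
  (∑' j, if j = i then 0
    else N.interferencePower (ω.user j k) (ω.base i) (ω.fading (.userToBase j i k))) +
  ∑' j, if ω.channel j = k
    then N.interferencePower (ω.node j) (ω.base i) (ω.fading (.nodeToBase j i)) else 0

/-- Interference at ad hoc receiver `i` on the sub-channel selected by its transmitter: mobile
users, if the sub-channel is assigned to them, and the other ad hoc transmitters that use it. -/
def nodeInterference (ω : NetworkSample K) (i : ℕ) : ℝ≥0∞ :=
  (if ω.channel i ∈ N.occupied
    then ∑' j, N.interferencePower (ω.user j (ω.channel i)) (ω.receiver i)
      (ω.fading (.userToNode j i (ω.channel i)))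
    else 0) +
  ∑' j, if j ≠ i ∧ ω.channel j = ω.channel i
    then N.interferencePower (ω.node j) (ω.receiver i) (ω.fading (.nodeToNode j i)) else 0

/-- Signal-to-interference ratio at base station `i` on sub-channel `k`. -/
def baseSIR (ω : NetworkSample K) (i : ℕ) (k : Fin K) : ℝ≥0∞ :=
  ENNReal.ofReal (N.r ^ (-N.pathLossExp) * ω.fading (.cellularData i k)) /
    N.baseInterference ω i k

/-- Signal-to-interference ratio at ad hoc receiver `i`. -/
def nodeSIR (ω : NetworkSample K) (i : ℕ) : ℝ≥0∞ :=
  ENNReal.ofReal (N.d ^ (-N.pathLossExp) * ω.fading (.adHocData i)) / N.nodeInterference ω i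

/-- Outage probability `P_b` of the typical base station on sub-channel `k`. -/
def baseOutageProb (o : OverlayMethod) (lu la : ℝ) (k : Fin K) : ℝ≥0∞ :=
  typicalProb (N.law o lu la) (fun i ω => ω.base i) (fun _ => Set.univ)
    (fun i => {ω | N.baseSIR ω i k < ENNReal.ofReal N.θ})

/-- Outage probability `P_a(k)` of the typical ad hoc link, given that it uses sub-channel `k`. -/
def nodeOutageProb (o : OverlayMethod) (lu la : ℝ) (k : Fin K) : ℝ≥0∞ :=
  typicalProb (N.law o lu la) (fun i ω => ω.node i) (fun i => {ω | ω.channel i = k})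
    (fun i => {ω | N.nodeSIR ω i < ENNReal.ofReal N.θ})

/-- The pairs `(lu, la)` of positive densities of mobile users and ad hoc transmitters for which
all links satisfy the outage constraint. -/
def capacityRegion (o : OverlayMethod) (ε : ℝ) : Set (ℝ × ℝ) :=
  {p | 0 < p.1 ∧ 0 < p.2 ∧
    (∀ k ∈ N.occupied, N.baseOutageProb o p.1 p.2 k ≤ ENNReal.ofReal ε) ∧
    ∀ k ∈ N.accessible o, N.nodeOutageProb o p.1 p.2 k ≤ ENNReal.ofReal ε}

/-- The capacity pairs (points of the tradeoff curve): pairs of densities satisfying the outage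
constraint that are maximal, i.e. neither density can be increased without violating the
constraint or decreasing the other one. -/
def IsCapacityPair (o : OverlayMethod) (ε : ℝ) (p : ℝ × ℝ) : Prop :=
  Maximal (fun q => q ∈ N.capacityRegion o ε) p

/-- The constant `K ε θ ^ (-δ) / (π d² Γ(1 + δ))`, where `δ = 2 / pathLossExp`. -/
def capacityConst (ε : ℝ) : ℝ :=
  K * ε * N.θ ^ (-(2 / N.pathLossExp)) /
    (Real.pi * N.d ^ 2 * Real.Gamma (1 + 2 / N.pathLossExp))

end OverlaidNetworks

end

/-! Everything rests on the interference at a typical receiver being a positive stable variable.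
Under Rayleigh fading, an interferer at displacement `v` contributes the factor `(1 + u‖v‖^(-η))⁻¹`
to the Laplace transform at `u`, and one minus this factor integrates over the plane to
`interferenceConst δ * u ^ δ` (`lintegral_one_sub_rayleighFactor`). By the Slivnyak-Mecke formula
(`IsHomogeneousPPP.tsum_lintegral_mul_tprod_ite`) a typical point sees the other points as an
undisturbed Poisson process. Random displacements of the users do not change the integral, by
translation invariance, and random channel selection multiplies the density by the selection
probability. So the Palm Laplace transform is `exp (-(c * u ^ δ))`, where `c` is `interferenceConst
δ` times the density of co-channel interferers (`Standing.tsum_lintegral_base`,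
`Standing.tsum_lintegral_node`).

A signal gain with `L` complex degrees of freedom exceeds `x` with probability `exp (-x)` times the
sum of `x ^ k / k!` over `k < L`. The success probability is therefore a combination of derivatives
of order below `L` of the Laplace transform at `t = θ d ^ η`. In the stable case these are
polynomials in `s = c * t ^ δ` times `exp (-s)`, so the outage probability is `outageFn δ L s`
(`typicalProb_eq_outageFn`). This function increases strictly from `0` to `1` in `s`, decreases in
`L`, and has slope `Γ(L-δ) / (Γ(1-δ) Γ(L))` at `0`. Hence an outage constraint reads `s ≤ S ε` with
`S ε` asymptotic to `ε Γ(1-δ) Γ(L) / Γ(L-δ)` (`exists_outageFn_le_iff`).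

In blind transmission both kinds of links on an occupied sub-channel face the interferer density
`λ_u / M + λ_a / K`, and the smaller diversity order binds: the region is a triangle and its maximal
points form the slanted edge. Under mutual exclusion the constraints decouple: the region is a box
whose only maximal point is the corner, and the two thresholds add up in the weighted sum of its
coordinates.

A Poisson process is given here only through its counts, with an arbitrary enumeration. Its Laplace
functional is built from simple functions, Campbell's formula follows by differentiating it, and
Mecke's formula by freezing the reference point on small cells; Palm averages appear as sums over
all indices. -/

noncomputable section

/-! ### Infinite products of factors in `[0, 1]` -/

/-- The function `exp (-a)` on `[0, ∞]`. -/
def expNeg (a : ℝ≥0∞) : ℝ≥0∞ := EReal.exp (-(a : EReal))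

/-- The function `-log a` on `[0, 1]`. -/
def negLog (a : ℝ≥0∞) : ℝ≥0∞ := (-ENNReal.log a).toENNReal

@[simp] lemma expNeg_zero : expNeg 0 = 1 := by simp [expNeg]

@[simp] lemma expNeg_top : expNeg ∞ = 0 := by simp [expNeg]

lemma expNeg_add (a b : ℝ≥0∞) : expNeg (a + b) = expNeg a * expNeg b := by
  rw [expNeg, expNeg, expNeg, ← EReal.exp_add, EReal.coe_ennreal_add,
    EReal.neg_add (by simp) (by simp), sub_eq_add_neg]

lemma continuous_expNeg : Continuous expNeg :=
  ENNReal.continuous_exp.comp (continuous_neg.comp continuous_coe_ennreal_ereal)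

@[fun_prop]
lemma measurable_expNeg : Measurable expNeg := continuous_expNeg.measurable

lemma antitone_expNeg : Antitone expNeg := fun _ _ h =>
  EReal.exp_monotone (EReal.neg_le_neg_iff.2 (EReal.coe_ennreal_le_coe_ennreal_iff.2 h))

lemma expNeg_le_one (a : ℝ≥0∞) : expNeg a ≤ 1 := by
  simpa using antitone_expNeg (zero_le (a := a))

lemma expNeg_ne_top (a : ℝ≥0∞) : expNeg a ≠ ∞ :=
  ((expNeg_le_one a).trans_lt ENNReal.one_lt_top).ne

lemma expNeg_ofReal {x : ℝ} (hx : 0 ≤ x) :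
    expNeg (ENNReal.ofReal x) = ENNReal.ofReal (Real.exp (-x)) := by
  rw [expNeg, EReal.coe_ennreal_ofReal, max_eq_left hx, ← EReal.coe_neg, EReal.exp_coe]

lemma expNeg_negLog {a : ℝ≥0∞} (ha : a ≤ 1) : expNeg (negLog a) = a := by
  have h : 0 ≤ -ENNReal.log a := by
    rw [EReal.le_neg, neg_zero]
    simpa using ENNReal.log_monotone ha
  rw [expNeg, negLog, EReal.coe_toENNReal h, neg_neg, ENNReal.exp_log]

@[fun_prop]
lemma measurable_negLog : Measurable negLog :=
  measurable_ereal_toENNReal.comp (measurable_neg.comp ENNReal.measurable_log)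

lemma expNeg_sum {β : Type*} (s : Finset β) (a : β → ℝ≥0∞) :
    expNeg (∑ b ∈ s, a b) = ∏ b ∈ s, expNeg (a b) := by
  classical
  induction s using Finset.induction_on with
  | empty => simp
  | insert i s hi ih => rw [Finset.sum_insert hi, Finset.prod_insert hi, expNeg_add, ih]

lemma expNeg_tsum {β : Type*} (a : β → ℝ≥0∞) : expNeg (∑' b, a b) = ∏' b, expNeg (a b) := by
  have h : HasProd (fun b => expNeg (a b)) (expNeg (∑' b, a b)) := by
    have := (continuous_expNeg.tendsto (∑' b, a b)).comp ENNReal.summable.hasSum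
    refine this.congr fun s => ?_
    simp [expNeg_sum]
  exact h.tprod_eq.symm

/-- Sums in `[0, ∞]` always converge, so passing to logarithms removes every convergence question; a
zero factor corresponds to the summand `∞`. -/
lemma ENNReal.tprod_eq_expNeg_tsum {β : Type*} {f : β → ℝ≥0∞} (hf : ∀ b, f b ≤ 1) :
    ∏' b, f b = expNeg (∑' b, negLog (f b)) := by
  rw [expNeg_tsum]
  exact tprod_congr fun b => (expNeg_negLog (hf b)).symm

lemma ENNReal.tprod_mul_of_le_one {β : Type*} {f g : β → ℝ≥0∞} (hf : ∀ b, f b ≤ 1)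
    (hg : ∀ b, g b ≤ 1) : ∏' b, f b * g b = (∏' b, f b) * ∏' b, g b := by
  rw [ENNReal.tprod_eq_expNeg_tsum hf, ENNReal.tprod_eq_expNeg_tsum hg, ← expNeg_add,
    ← ENNReal.tsum_add, expNeg_tsum]
  refine tprod_congr fun b => ?_
  rw [expNeg_add, expNeg_negLog (hf b), expNeg_negLog (hg b)]

lemma ENNReal.tprod_sum_of_le_one {β γ : Type*} {f : β ⊕ γ → ℝ≥0∞} (hf : ∀ b, f b ≤ 1) :
    ∏' b, f b = (∏' b, f (.inl b)) * ∏' c, f (.inr c) := by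
  rw [ENNReal.tprod_eq_expNeg_tsum hf, ENNReal.tprod_eq_expNeg_tsum (fun b => hf _),
    ENNReal.tprod_eq_expNeg_tsum (fun b => hf _), ← expNeg_add,
    ENNReal.summable.tsum_sum ENNReal.summable]

lemma ENNReal.tprod_eq_mul_tprod_ite {β : Type*} [DecidableEq β] {f : β → ℝ≥0∞}
    (hf : ∀ b, f b ≤ 1) (i : β) :
    ∏' b, f b = f i * ∏' b, if b = i then 1 else f b := by
  rw [ENNReal.tprod_eq_expNeg_tsum hf, ENNReal.tsum_eq_add_tsum_ite i, expNeg_add,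
    expNeg_negLog (hf i), expNeg_tsum]
  congr 1
  refine tprod_congr fun b => ?_
  split_ifs with h
  · simp
  · exact expNeg_negLog (hf b)

lemma Measurable.ennreal_tprod {α β : Type*} [MeasurableSpace α] [Countable β]
    {f : β → α → ℝ≥0∞} (hm : ∀ b, Measurable (f b)) (hf : ∀ b x, f b x ≤ 1) :
    Measurable fun x => ∏' b, f b x := by
  simp_rw [fun x => ENNReal.tprod_eq_expNeg_tsum (hf · x)]
  fun_prop

lemma ENNReal.tprod_le_one' {β : Type*} {f : β → ℝ≥0∞} (hf : ∀ b, f b ≤ 1) : ∏' b, f b ≤ 1 := by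
  rw [ENNReal.tprod_eq_expNeg_tsum hf]
  exact expNeg_le_one _

/-- The expectation of an infinite product of independent factors with values in `[0, 1]` is the
product of the expectations. -/
lemma lintegral_tprod_of_iIndepFun {Ω β : Type*} [MeasurableSpace Ω] [Countable β]
    {μ : Measure Ω} {f : β → Ω → ℝ≥0∞} (hm : ∀ b, Measurable (f b)) (hf : ∀ b x, f b x ≤ 1)
    (hi : iIndepFun f μ) :
    ∫⁻ x, ∏' b, f b x ∂μ = ∏' b, ∫⁻ x, f b x ∂μ := by
  have := hi.isProbabilityMeasure
  have h1 (b : β) : ∫⁻ x, f b x ∂μ ≤ 1 := by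
    simpa using lintegral_mono (μ := μ) (hf b)
  have h2 (s : Finset β) (x : Ω) : ∏ b ∈ s, f b x ≤ 1 := Finset.prod_le_one' fun b _ => hf b x
  -- The infinite product is the infimum of its finite partial products, a directed family, so
  -- monotone convergence reduces the claim to finitely many independent factors.
  simp_rw [fun x => ENNReal.tprod_eq_iInf_prod (hf · x)]
  rw [ENNReal.tprod_eq_iInf_prod h1, lintegral_iInf_directed_of_measurable
    (IsProbabilityMeasure.ne_zero μ)]
  · simp_rw [lintegral_prod_eq_prod_lintegral_of_indepFun _ _ hi hm]
  · exact fun s => Finset.measurable_prod _ fun b _ => hm b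
  · intro s
    refine ((lintegral_mono (h2 s)).trans_lt ?_).ne
    simp
  · classical
    intro s t
    refine ⟨s ∪ t, fun x => ?_, fun x => ?_⟩
    · exact Finset.prod_anti_set_of_le_one' (hf · x) Finset.subset_union_left
    · exact Finset.prod_anti_set_of_le_one' (hf · x) Finset.subset_union_right

/-- Injectivity of `l` makes the factors depend on distinct coordinates, hence independent. -/
lemma lintegral_tprod_infinitePi {ι β : Type*} [Countable β] {X : ι → Type*}
    [∀ i, MeasurableSpace (X i)] (μ : ∀ i, Measure (X i)) [∀ i, IsProbabilityMeasure (μ i)]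
    {l : β → ι} (hl : Function.Injective l) {f : ∀ b, X (l b) → ℝ≥0∞}
    (hm : ∀ b, Measurable (f b)) (hf : ∀ b x, f b x ≤ 1) :
    ∫⁻ F, ∏' b, f b (F (l b)) ∂(Measure.infinitePi μ) = ∏' b, ∫⁻ x, f b x ∂(μ (l b)) := by
  have hi : iIndepFun (fun b (F : ∀ i, X i) => f b (F (l b))) (Measure.infinitePi μ) :=
    ((iIndepFun_infinitePi (P := μ) (X := fun _ x => x) (fun _ => measurable_id)).precomp hl).comp
      f hm
  refine (lintegral_tprod_of_iIndepFun (f := fun b (F : ∀ i, X i) => f b (F (l b)))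
    (fun b => (hm b).comp (measurable_pi_apply _)) (fun b _ => hf b _) hi).trans ?_
  refine tprod_congr fun b => ?_
  rw [← Measure.infinitePi_map_eval μ (l b), lintegral_map (hm b) (measurable_pi_apply _)]

/-- Dominated convergence for infinite products of factors in `[0, 1]`. -/
lemma ENNReal.tendsto_tprod_of_dominated {α β : Type*} {𝓕 : Filter α} {f : α → β → ℝ≥0∞}
    {g h : β → ℝ≥0∞} (hf : ∀ n b, f n b ≤ 1) (hg : ∀ b, g b ≤ 1) (hh : ∑' b, h b ≠ ∞)
    (hlim : ∀ b, Tendsto (f · b) 𝓕 (𝓝 (g b))) (hb : ∀ n b, 1 - f n b ≤ h b) :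
    Tendsto (fun n => ∏' b, f n b) 𝓕 (𝓝 (∏' b, g b)) := by
  -- Passing to real products of the form `∏ (1 + a b)` makes dominated convergence for such
  -- products available.
  have key {k : β → ℝ≥0∞} (hk : ∀ b, k b ≤ 1) :
      ∏' b, k b = ENNReal.ofReal (∏' b, (1 + ((k b).toReal - 1))) := by
    have h1 : HasProd k (∏' b, k b) := (ENNReal.multipliable_of_le_one hk).hasProd
    have h2 : ∏' b, k b ≠ ∞ := ((ENNReal.tprod_le_one' hk).trans_lt ENNReal.one_lt_top).ne
    have h3 : HasProd (fun b => (1 + ((k b).toReal - 1))) (∏' b, k b).toReal := by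
      refine ((ENNReal.tendsto_toReal h2).comp h1).congr fun s => ?_
      simp
    rw [h3.tprod_eq, ENNReal.ofReal_toReal h2]
  have ht {x : ℝ≥0∞} (hx : x ≤ 1) : x ≠ ∞ := (hx.trans_lt ENNReal.one_lt_top).ne
  simp_rw [fun n => key (hf n)]
  rw [key hg]
  refine (ENNReal.continuous_ofReal.tendsto _).comp ?_
  refine tendsto_tprod_one_add_of_dominated_convergence (bound := fun b => (h b).toReal)
    (ENNReal.summable_toReal hh) (fun b => ?_) (Eventually.of_forall fun n b => ?_)
  · exact ((ENNReal.tendsto_toReal (ht (hg b))).comp (hlim b)).sub_const 1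
  · have h1 : (1 - f n b).toReal = 1 - (f n b).toReal := by
      rw [ENNReal.toReal_sub_of_le (hf n b) (by simp)]; simp
    have h2 := ENNReal.toReal_mono (ENNReal.ne_top_of_tsum_ne_top hh b) (hb n b)
    have h3 : (f n b).toReal ≤ 1 := by simpa using ENNReal.toReal_mono (by simp) (hf n b)
    rw [Real.norm_eq_abs, abs_sub_comm, abs_of_nonneg (by linarith)]
    linarith

/-! ### The Laplace functional of a Poisson process -/

section PoissonProcess

variable {E : Type*} [MeasurableSpace E]

/-- The counting measure of an enumerated configuration. -/
def pointMeasure (x : ℕ → E) : Measure E := Measure.sum fun j => Measure.dirac (x j)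

lemma lintegral_pointMeasure (x : ℕ → E) {f : E → ℝ≥0∞} (hf : Measurable f) :
    ∫⁻ v, f v ∂(pointMeasure x) = ∑' j, f (x j) := by
  rw [pointMeasure, lintegral_sum_measure]
  simp_rw [lintegral_dirac' _ hf]

lemma toENNReal_pointCount (x : ℕ → E) {A : Set E} (hA : MeasurableSet A) :
    (pointCount A x : ℝ≥0∞) = pointMeasure x A := by
  rw [← lintegral_indicator_one hA, lintegral_pointMeasure _ (measurable_one.indicator hA),
    pointCount, ← ENNReal.tsum_set_one, tsum_subtype {n | x n ∈ A} (fun _ => (1 : ℝ≥0∞))]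
  rfl

lemma measurable_pointCount {A : Set E} (hA : MeasurableSet A) :
    Measurable (pointCount A : (ℕ → E) → ℕ∞) := by
  have h : Measurable fun x : ℕ → E => (pointCount A x : ℝ≥0∞) := by
    simp_rw [toENNReal_pointCount _ hA, ← lintegral_indicator_one hA,
      lintegral_pointMeasure _ (measurable_one.indicator hA)]
    exact Measurable.tsum fun j =>
      (measurable_one.indicator hA).comp (measurable_pi_apply j)
  refine measurable_to_countable' fun n => ?_
  have : pointCount A ⁻¹' {n} = (fun x : ℕ → E => (pointCount A x : ℝ≥0∞)) ⁻¹' {(n : ℝ≥0∞)} := by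
    ext x
    simp
  rw [this]
  exact h (measurableSet_singleton _)

/-- Probability generating function of the Poisson distribution. -/
lemma lintegral_expNeg_mul_poissonMeasure (r : ℝ≥0) (v : ℝ≥0∞) :
    ∫⁻ n : ℕ, expNeg (v * n) ∂(poissonMeasure r) = expNeg ((1 - expNeg v) * r) := by
  set y : ℝ := (expNeg v).toReal with hy
  have hy0 : 0 ≤ y := ENNReal.toReal_nonneg
  have hy1 : y ≤ 1 := by simpa using ENNReal.toReal_mono (by simp) (expNeg_le_one v)
  have hv : expNeg v = ENNReal.ofReal y := (ENNReal.ofReal_toReal (expNeg_ne_top v)).symm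
  have hpow (n : ℕ) : expNeg (v * n) = ENNReal.ofReal (y ^ n) := by
    rw [ENNReal.ofReal_pow hy0, ← hv]
    induction n with
    | zero => simp
    | succ n ih => rw [Nat.cast_succ, mul_add, expNeg_add, ih, mul_one, pow_succ]
  have hr : (1 - expNeg v) * r = ENNReal.ofReal ((1 - y) * r) := by
    rw [ENNReal.ofReal_mul (by linarith), ENNReal.ofReal_sub _ hy0, hv]
    simp
  rw [hr, expNeg_ofReal (mul_nonneg (by linarith) r.coe_nonneg), poissonMeasure, lintegral_sum_measure]
  simp_rw [lintegral_smul_measure, lintegral_dirac, hpow, smul_eq_mul]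
  -- This is the exponential series at `r * y`, multiplied by `exp (-r)`.
  have hs : HasSum (fun n : ℕ => Real.exp (-r) * r ^ n / n.factorial * y ^ n)
      (Real.exp (-((1 - y) * r))) := by
    have := (NormedSpace.expSeries_div_hasSum_exp (r * y : ℝ)).mul_left (Real.exp (-r))
    rw [← Real.exp_eq_exp_ℝ, ← Real.exp_add] at this
    convert! this using 1
    · ext n; rw [mul_pow]; ring
    · ring_nf
  have hnn (n : ℕ) : 0 ≤ Real.exp (-r) * r ^ n / n.factorial := by positivity
  rw [← hs.tsum_eq, ENNReal.ofReal_tsum_of_nonneg (fun n => by have := hnn n; positivity)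
    hs.summable]
  exact tsum_congr fun n => (ENNReal.ofReal_mul (hnn n)).symm

/-- The Laplace functional of a Poisson point process at a simple function. -/
lemma IsPoissonPointProcess.lintegral_expNeg_simpleFunc {Λ : Measure E} {Φ : Measure (ℕ → E)}
    (h : IsPoissonPointProcess Λ Φ) (f : SimpleFunc E ℝ≥0∞) (hf : Λ (Function.support f) ≠ ∞) :
    ∫⁻ x, expNeg (∑' j, f (x j)) ∂Φ = expNeg (∫⁻ v, 1 - expNeg (f v) ∂Λ) := by
  classical
  have hfin (v : ℝ≥0∞) (hv : v ≠ 0) : Λ (f ⁻¹' {v}) ≠ ∞ := by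
    refine (lt_of_le_of_lt (measure_mono fun z hz => ?_) hf.lt_top).ne
    simp only [Set.mem_preimage, Set.mem_singleton_iff] at hz
    simpa [hz] using hv
  -- Only the fibres over nonzero values have finite intensity. They are finitely many and disjoint,
  -- so their counts are independent Poisson variables.
  set S := f.range.filter (· ≠ 0) with hS
  set e := S.equivFin
  have hne (i : Fin S.card) : (e.symm i : ℝ≥0∞) ≠ 0 := (Finset.mem_filter.1 (e.symm i).2).2
  have hsplit (μ : Measure E) (k : ℝ≥0∞ → ℝ≥0∞) (hk : k 0 = 0) :
      ∫⁻ v, k (f v) ∂μ = ∑ i, k (e.symm i : ℝ≥0∞) * μ (f ⁻¹' {(e.symm i : ℝ≥0∞)}) := by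
    have h1 := SimpleFunc.map_lintegral (μ := μ) k f
    rw [← SimpleFunc.lintegral_eq_lintegral, SimpleFunc.coe_map] at h1
    refine h1.trans ?_
    rw [e.symm.sum_comp (fun s : S => k s * μ (f ⁻¹' {(s : ℝ≥0∞)})),
      Finset.sum_coe_sort S (fun s => k s * μ (f ⁻¹' {s})), hS, Finset.sum_filter]
    refine Finset.sum_congr rfl fun v _ => ?_
    by_cases hv : v = 0 <;> simp [hv, hk]
  have hsum (x : ℕ → E) : expNeg (∑' j, f (x j)) = ∏ i, expNeg ((e.symm i : ℝ≥0∞) *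
      pointCount (f ⁻¹' {(e.symm i : ℝ≥0∞)}) x) := by
    have := hsplit (pointMeasure x) id rfl
    simp only [id] at this
    rw [← lintegral_pointMeasure x f.measurable, this, expNeg_sum]
    simp_rw [toENNReal_pointCount _ (f.measurableSet_fiber _)]
  have hind := h.indep _ (fun i => f ⁻¹' {(e.symm i : ℝ≥0∞)}) (fun i => f.measurableSet_fiber _)
    (fun i => hfin _ (hne i)) (fun i j hij => Disjoint.preimage _ (by
      simpa [Set.disjoint_singleton, Subtype.ext_iff] using
        fun hc => hij (e.symm.injective (Subtype.ext hc))))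
  have hind' := hind.comp (fun i (n : ℕ∞) => expNeg ((e.symm i : ℝ≥0∞) * n))
    (fun i => .of_discrete)
  simp_rw [hsum]
  refine (lintegral_prod_eq_prod_lintegral_of_indepFun Finset.univ _ hind'
    fun i => Measurable.of_discrete.comp (measurable_pointCount (f.measurableSet_fiber _))).trans ?_
  rw [hsplit Λ (fun v => 1 - expNeg v) (by simp), expNeg_sum]
  refine Finset.prod_congr rfl fun i _ => ?_
  have hA := hfin _ (hne i)
  simp only [Function.comp_apply]
  rw [← lintegral_map (f := fun n : ℕ∞ => expNeg ((e.symm i : ℝ≥0∞) * n)) .of_discrete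
    (measurable_pointCount (f.measurableSet_fiber _)),
    h.map_pointCount _ (f.measurableSet_fiber _) hA, lintegral_map .of_discrete .of_discrete]
  simp only [ENat.toENNReal_coe]
  rw [lintegral_expNeg_mul_poissonMeasure, ENNReal.coe_toNNReal hA]

/-- The Laplace functional of a Poisson point process. -/
lemma IsPoissonPointProcess.lintegral_expNeg {Λ : Measure E} [SigmaFinite Λ]
    {Φ : Measure (ℕ → E)} (h : IsPoissonPointProcess Λ Φ) {f : E → ℝ≥0∞} (hf : Measurable f) :
    ∫⁻ x, expNeg (∑' j, f (x j)) ∂Φ = expNeg (∫⁻ v, 1 - expNeg (f v) ∂Λ) := by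
  have := h.isProbabilityMeasure
  -- Cutting the simple approximations down to spanning sets gives supports of finite intensity
  -- while preserving monotone convergence to `f`.
  set g : ℕ → SimpleFunc E ℝ≥0∞ := fun n =>
    (SimpleFunc.eapprox f n).restrict (spanningSets Λ n) with hg
  have hgv (n : ℕ) (v : E) :
      g n v = (spanningSets Λ n).indicator (SimpleFunc.eapprox f n) v :=
    SimpleFunc.restrict_apply _ (measurableSet_spanningSets Λ n) v
  have hsupp (n : ℕ) : Λ (Function.support (g n)) ≠ ∞ := by
    refine (lt_of_le_of_lt (measure_mono fun z hz => ?_) (measure_spanningSets_lt_top Λ n)).ne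
    by_contra hc
    exact hz (by rw [hgv, Set.indicator_of_notMem hc])
  have hmono : Monotone fun n v => g n v := by
    intro m n hmn v
    simp only [hgv]
    refine (Set.indicator_le_indicator (SimpleFunc.monotone_eapprox f hmn v)).trans ?_
    exact Set.indicator_le_indicator_of_subset (monotone_spanningSets Λ hmn)
      (fun _ => zero_le) v
  have hlim (v : E) : Tendsto (fun n => g n v) atTop (𝓝 (f v)) := by
    refine (SimpleFunc.tendsto_eapprox hf v).congr' ?_
    obtain ⟨N, hN⟩ := Set.mem_iUnion.1 ((iUnion_spanningSets Λ).symm ▸ Set.mem_univ v)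
    filter_upwards [eventually_ge_atTop N] with n hn
    rw [hgv, Set.indicator_of_mem (monotone_spanningSets Λ hn hN)]
  have h1 : Tendsto (fun n => ∫⁻ x, expNeg (∑' j, g n (x j)) ∂Φ) atTop
      (𝓝 (∫⁻ x, expNeg (∑' j, f (x j)) ∂Φ)) := by
    refine tendsto_lintegral_of_dominated_convergence 1 (fun n => ?_)
      (fun n => Eventually.of_forall fun x => expNeg_le_one _) (by simp)
      (Eventually.of_forall fun x => (continuous_expNeg.tendsto _).comp ?_)
    · exact measurable_expNeg.comp
        (Measurable.tsum fun j => (g n).measurable.comp (measurable_pi_apply j))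
    · simp_rw [← lintegral_pointMeasure x hf, ← lintegral_pointMeasure x (g _).measurable]
      exact lintegral_tendsto_of_tendsto_of_monotone (fun n => (g n).measurable.aemeasurable)
        (Eventually.of_forall fun v m n hmn => hmono hmn v) (Eventually.of_forall hlim)
  have h2 : Tendsto (fun n => ∫⁻ x, expNeg (∑' j, g n (x j)) ∂Φ) atTop
      (𝓝 (expNeg (∫⁻ v, 1 - expNeg (f v) ∂Λ))) := by
    simp_rw [fun n => h.lintegral_expNeg_simpleFunc (g n) (hsupp n)]
    refine (continuous_expNeg.tendsto _).comp (lintegral_tendsto_of_tendsto_of_monotone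
      (fun n => (measurable_const.sub (measurable_expNeg.comp (g n).measurable)).aemeasurable)
      (Eventually.of_forall fun v m n hmn => tsub_le_tsub_left (antitone_expNeg (hmono hmn v)) 1)
      (Eventually.of_forall fun v => ?_))
    exact ENNReal.Tendsto.sub tendsto_const_nhds ((continuous_expNeg.tendsto _).comp (hlim v))
      (.inl ENNReal.one_ne_top)
  exact tendsto_nhds_unique h1 h2

/-- The probability generating functional of a Poisson point process. -/
lemma IsPoissonPointProcess.lintegral_tprod {Λ : Measure E} [SigmaFinite Λ]
    {Φ : Measure (ℕ → E)} (h : IsPoissonPointProcess Λ Φ) {g : E → ℝ≥0∞} (hg : Measurable g)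
    (hg1 : ∀ v, g v ≤ 1) :
    ∫⁻ x, ∏' j, g (x j) ∂Φ = expNeg (∫⁻ v, 1 - g v ∂Λ) := by
  have := h.lintegral_expNeg (measurable_negLog.comp hg)
  simpa [expNeg_tsum, expNeg_negLog (hg1 _)] using this

/-! ### Campbell's formula by differentiation of the Laplace functional -/

/-- A monotone approximation of the identity on `[0, ∞]` by bounded functions. -/
def expApprox (n : ℕ) (x : ℝ≥0∞) : ℝ≥0∞ := 2 ^ n * (1 - expNeg ((2 ^ n)⁻¹ * x))

@[fun_prop]
lemma measurable_expApprox (n : ℕ) : Measurable (expApprox n) := by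
  unfold expApprox
  fun_prop

/-- With `y = exp (-x / 2 ^ (n + 1))` the claim is `1 - y ^ 2 ≤ 2 * (1 - y)`, that is, `0 ≤ (1 - y)
^ 2`. -/
lemma expApprox_mono (x : ℝ≥0∞) : Monotone fun n => expApprox n x := by
  refine monotone_nat_of_le_succ fun n => ?_
  set y := expNeg ((2 ^ (n + 1))⁻¹ * x) with hy
  have hy1 : y ≤ 1 := expNeg_le_one _
  have h2 : expNeg ((2 ^ n)⁻¹ * x) = y * y := by
    rw [hy, ← expNeg_add, ← add_mul, pow_succ, ENNReal.mul_inv (by simp) (by simp), ← mul_two,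
      mul_assoc _ _ (2 : ℝ≥0∞), ENNReal.inv_mul_cancel (by simp) (by simp), mul_one]
  rw [expApprox, expApprox, h2, ← hy, pow_succ, mul_assoc]
  gcongr
  clear_value y
  clear hy
  lift y to ℝ≥0 using (hy1.trans_lt ENNReal.one_lt_top).ne
  have hy2 : y ≤ 1 := by exact_mod_cast hy1
  rw [show (2 : ℝ≥0∞) * (1 - y) = ((2 * (1 - y) : ℝ≥0) : ℝ≥0∞) by push_cast; rfl,
    show 1 - (y : ℝ≥0∞) * y = ((1 - y * y : ℝ≥0) : ℝ≥0∞) by push_cast; rfl, ENNReal.coe_le_coe,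
    ← NNReal.coe_le_coe, NNReal.coe_mul, NNReal.coe_sub hy2,
    NNReal.coe_sub (mul_le_one' hy2 hy2)]
  push_cast
  nlinarith [sq_nonneg (1 - (y : ℝ))]

lemma one_sub_expNeg_le (x : ℝ≥0∞) : 1 - expNeg x ≤ x := by
  rcases eq_or_ne x ∞ with rfl | hx
  · simp
  · lift x to ℝ≥0 using hx
    rw [← ENNReal.ofReal_coe_nnreal, expNeg_ofReal x.coe_nonneg, ← ENNReal.ofReal_one,
      ← ENNReal.ofReal_sub _ (Real.exp_pos _).le]
    exact ENNReal.ofReal_le_ofReal (by linarith [Real.add_one_le_exp (-(x : ℝ))])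

/-- This is `x + 1 ≤ exp x` multiplied by `exp (-x)`. Together with `one_sub_expNeg_le` it squeezes
the difference quotients below. -/
lemma mul_expNeg_le_one_sub_expNeg {x : ℝ≥0∞} (hx : x ≠ ∞) : x * expNeg x ≤ 1 - expNeg x := by
  lift x to ℝ≥0 using hx
  rw [← ENNReal.ofReal_coe_nnreal, expNeg_ofReal x.coe_nonneg, ← ENNReal.ofReal_one,
    ← ENNReal.ofReal_sub _ (Real.exp_pos _).le, ← ENNReal.ofReal_mul x.coe_nonneg]
  refine ENNReal.ofReal_le_ofReal ?_
  have h1 := Real.add_one_le_exp (x : ℝ)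
  have h2 : Real.exp (-(x : ℝ)) * Real.exp x = 1 := by rw [← Real.exp_add]; simp
  nlinarith [Real.exp_pos (-(x : ℝ))]

lemma tendsto_inv_two_pow_mul {x : ℝ≥0∞} (hx : x ≠ ∞) :
    Tendsto (fun n : ℕ => ((2 : ℝ≥0∞) ^ n)⁻¹ * x) atTop (𝓝 0) := by
  have : Tendsto (fun n : ℕ => ((2 : ℝ≥0∞) ^ n)⁻¹) atTop (𝓝 0) := by
    simp_rw [ENNReal.inv_pow]
    exact ENNReal.tendsto_pow_atTop_nhds_zero_of_lt_one ENNReal.one_half_lt_one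
  simpa using ENNReal.Tendsto.mul_const this (.inr hx)

/-- If `2 ^ n * b n` tends to a finite limit, so does `2 ^ n * (1 - exp (-b n))`. -/
lemma tendsto_two_pow_mul_one_sub_expNeg {b : ℕ → ℝ≥0∞} {c : ℝ≥0∞} (hc : c ≠ ∞)
    (hb : Tendsto (fun n => 2 ^ n * b n) atTop (𝓝 c)) (hle : ∀ n, 2 ^ n * b n ≤ c) :
    Tendsto (fun n => 2 ^ n * (1 - expNeg (b n))) atTop (𝓝 c) := by
  have hbn (n : ℕ) : b n ≤ (2 ^ n)⁻¹ * c := by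
    rw [mul_comm, ← div_eq_mul_inv, ENNReal.le_div_iff_mul_le (by simp) (by simp), mul_comm]
    exact hle n
  have h1 : Tendsto (fun n : ℕ => 2 ^ n * b n * expNeg ((2 ^ n)⁻¹ * c)) atTop (𝓝 (c * 1)) := by
    refine ENNReal.Tendsto.mul hb (.inr ENNReal.one_ne_top) ?_ (.inr hc)
    have := (continuous_expNeg.tendsto 0).comp (tendsto_inv_two_pow_mul hc)
    rwa [expNeg_zero] at this
  rw [mul_one] at h1
  refine tendsto_of_tendsto_of_tendsto_of_le_of_le h1 hb (fun n => ?_) fun n => ?_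
  · rw [mul_assoc]
    refine mul_le_mul_right ?_ _
    refine (mul_le_mul_right (antitone_expNeg (hbn n)) _).trans (mul_expNeg_le_one_sub_expNeg ?_)
    exact ((hbn n).trans_lt (ENNReal.mul_lt_top (by simp [pos_iff_ne_zero]) hc.lt_top)).ne
  · exact mul_le_mul_right (one_sub_expNeg_le _) _

lemma expApprox_le (n : ℕ) (x : ℝ≥0∞) : expApprox n x ≤ x := by
  refine (mul_le_mul_right (one_sub_expNeg_le _) _).trans ?_
  rw [← mul_assoc, ENNReal.mul_inv_cancel (by simp) (by simp), one_mul]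

lemma tendsto_expApprox (x : ℝ≥0∞) : Tendsto (fun n => expApprox n x) atTop (𝓝 x) := by
  rcases eq_or_ne x ∞ with rfl | hx
  · have (n : ℕ) : expApprox n ∞ = 2 ^ n := by
      rw [expApprox, ENNReal.mul_top (by simp)]
      simp
    simp_rw [this]
    exact ENNReal.tendsto_pow_atTop_nhds_top_iff.2 (by norm_num)
  · have (n : ℕ) : 2 ^ n * ((2 ^ n)⁻¹ * x) = x := by
      rw [← mul_assoc, ENNReal.mul_inv_cancel (by simp) (by simp), one_mul]
    refine tendsto_two_pow_mul_one_sub_expNeg hx ?_ fun n => (this n).le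
    simp [this]

/-- The Campbell formula for a Poisson point process, weighted by an infinite product. -/
lemma IsPoissonPointProcess.lintegral_tsum_mul_tprod {Λ : Measure E} [SigmaFinite Λ]
    {Φ : Measure (ℕ → E)} (h : IsPoissonPointProcess Λ Φ) {k g : E → ℝ≥0∞} (hk : Measurable k)
    (hkΛ : ∫⁻ v, k v ∂Λ ≠ ∞) (hg : Measurable g) (hg1 : ∀ v, g v ≤ 1) :
    ∫⁻ x, (∑' i, k (x i)) * ∏' j, g (x j) ∂Φ =
      (∫⁻ v, k v * g v ∂Λ) * expNeg (∫⁻ v, 1 - g v ∂Λ) := by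
  have := h.isProbabilityMeasure
  set A := ∫⁻ v, 1 - g v ∂Λ
  set W : (ℕ → E) → ℝ≥0∞ := fun x => ∏' j, g (x j) with hW
  set T : (ℕ → E) → ℝ≥0∞ := fun x => ∑' i, k (x i) with hT
  have hWm : Measurable W := Measurable.ennreal_tprod
    (fun j => hg.comp (measurable_pi_apply j)) fun j x => hg1 _
  have hTm : Measurable T := Measurable.tsum fun j => hk.comp (measurable_pi_apply j)
  have hW1 (x) : W x ≤ 1 := ENNReal.tprod_le_one' fun j => hg1 _
  have hβ : ∫⁻ v, k v * g v ∂Λ ≠ ∞ :=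
    ((lintegral_mono fun v => mul_le_of_le_one_right' (hg1 v)).trans_lt hkΛ.lt_top).ne
  -- Replacing `g` by `g * exp (-k / 2 ^ n)` in the generating functional raises its exponent from
  -- `A` to `A + b n`. Multiplying the resulting difference by `2 ^ n` gives difference quotients of
  -- the functional at `0`, whose limit brings down the factor `T`.
  set b : ℕ → ℝ≥0∞ := fun n => ∫⁻ v, g v * (1 - expNeg ((2 ^ n)⁻¹ * k v)) ∂Λ with hb
  have hbexp (n : ℕ) : 2 ^ n * b n = ∫⁻ v, expApprox n (k v) * g v ∂Λ := by
    rw [hb, ← lintegral_const_mul _ (by fun_prop)]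
    refine lintegral_congr fun v => ?_
    rw [expApprox]; ring
  have hstep (n : ℕ) : ∫⁻ x, expApprox n (T x) * W x ∂Φ =
      expNeg A * (2 ^ n * (1 - expNeg (b n))) := by
    have h1 : ∫⁻ x, expNeg ((2 ^ n)⁻¹ * T x) * W x ∂Φ = expNeg (A + b n) := by
      have := h.lintegral_tprod (g := fun v => expNeg ((2 ^ n)⁻¹ * k v) * g v) (by fun_prop)
        (fun v => mul_le_one' (expNeg_le_one _) (hg1 v))
      simp_rw [fun x : ℕ → E => ENNReal.tprod_mul_of_le_one
        (f := fun j => expNeg ((2 ^ n)⁻¹ * k (x j))) (g := fun j => g (x j))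
        (fun j => expNeg_le_one _) (fun j => hg1 _), ← expNeg_tsum, ENNReal.tsum_mul_left] at this
      rw [this, ← lintegral_add_left (by fun_prop)]
      congr 1
      refine lintegral_congr fun v => ?_
      have hgv := hg1 v
      have hev := expNeg_le_one ((2 ^ n)⁻¹ * k v)
      rw [ENNReal.mul_sub (fun _ _ => (hgv.trans_lt ENNReal.one_lt_top).ne), mul_one,
        tsub_add_tsub_cancel hgv (mul_le_of_le_one_right' hev), mul_comm]
    have h2 : ∫⁻ x, W x ∂Φ = expNeg A := h.lintegral_tprod hg hg1
    have h3 : ∫⁻ x, (1 - expNeg ((2 ^ n)⁻¹ * T x)) * W x ∂Φ = expNeg A - expNeg (A + b n) := by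
      rw [← h1, ← h2, ← lintegral_sub (by fun_prop)]
      · refine lintegral_congr fun x => ?_
        rw [ENNReal.sub_mul (fun _ _ => ((hW1 x).trans_lt ENNReal.one_lt_top).ne), one_mul]
      · rw [h1]; exact expNeg_ne_top _
      · exact Eventually.of_forall fun x => mul_le_of_le_one_left' (expNeg_le_one _)
    simp_rw [expApprox, mul_assoc]
    rw [lintegral_const_mul _ (by fun_prop), h3, expNeg_add, mul_left_comm,
      ENNReal.mul_sub (fun _ _ => expNeg_ne_top _), mul_one]
  have hl1 : Tendsto (fun n => ∫⁻ x, expApprox n (T x) * W x ∂Φ) atTop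
      (𝓝 (∫⁻ x, T x * W x ∂Φ)) := by
    refine lintegral_tendsto_of_tendsto_of_monotone (fun n => by fun_prop)
      (Eventually.of_forall fun x m n hmn => mul_le_mul_left (expApprox_mono _ hmn) _)
      (Eventually.of_forall fun x => ?_)
    exact ENNReal.Tendsto.mul_const (tendsto_expApprox _)
      (.inr ((hW1 x).trans_lt ENNReal.one_lt_top).ne)
  have hl2 : Tendsto (fun n => 2 ^ n * b n) atTop (𝓝 (∫⁻ v, k v * g v ∂Λ)) := by
    simp_rw [hbexp]
    refine lintegral_tendsto_of_tendsto_of_monotone (fun n => by fun_prop)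
      (Eventually.of_forall fun x m n hmn => mul_le_mul_left (expApprox_mono _ hmn) _)
      (Eventually.of_forall fun x => ?_)
    exact ENNReal.Tendsto.mul_const (tendsto_expApprox _)
      (.inr ((hg1 x).trans_lt ENNReal.one_lt_top).ne)
  have hl3 := tendsto_two_pow_mul_one_sub_expNeg hβ hl2 fun n => by
    rw [hbexp]
    exact lintegral_mono fun v => mul_le_mul_left (expApprox_le _ _) _
  have hl4 := ENNReal.Tendsto.const_mul (a := expNeg A) hl3 (.inr (expNeg_ne_top _))
  simp_rw [← hstep] at hl4
  rw [tendsto_nhds_unique hl1 hl4, mul_comm]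

/-- The Campbell formula for a Poisson point process. -/
lemma IsPoissonPointProcess.lintegral_tsum {Λ : Measure E} [SigmaFinite Λ]
    {Φ : Measure (ℕ → E)} (h : IsPoissonPointProcess Λ Φ) {k : E → ℝ≥0∞} (hk : Measurable k)
    (hkΛ : ∫⁻ v, k v ∂Λ ≠ ∞) : ∫⁻ x, ∑' i, k (x i) ∂Φ = ∫⁻ v, k v ∂Λ := by
  simpa using h.lintegral_tsum_mul_tprod hk hkΛ (g := fun _ => 1) measurable_const fun _ => le_rfl

end PoissonProcess

/-! ### The Slivnyak-Mecke formula in the plane -/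

lemma measurableSet_unitSquare : MeasurableSet unitSquare := by
  have : unitSquare = ⋂ i, (fun x : Plane => x i) ⁻¹' Set.Ico 0 1 := by
    ext x; simp [unitSquare]
  rw [this]
  exact MeasurableSet.iInter fun i => (by fun_prop : Measurable fun x : Plane => x i) measurableSet_Ico

lemma volume_unitSquare : volume unitSquare = 1 := by
  have : unitSquare = (WithLp.ofLp : Plane → Fin 2 → ℝ) ⁻¹'
      (Set.univ.pi fun _ => Set.Ico (0 : ℝ) 1) := by
    ext x; simp [unitSquare]
  rw [this, (PiLp.volume_preserving_ofLp (Fin 2)).measure_preimage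
    (MeasurableSet.univ_pi fun _ => measurableSet_Ico).nullMeasurableSet, volume_pi_pi]
  simp

lemma norm_le_of_mem_unitSquare {x : Plane} (hx : x ∈ unitSquare) : ‖x‖ ≤ 2 := by
  have h0 := hx 0
  have h1 := hx 1
  rw [EuclideanSpace.norm_eq, Real.sqrt_le_left (by norm_num), Fin.sum_univ_two]
  simp only [Real.norm_eq_abs, sq_abs]
  nlinarith [h0.1, h0.2, h1.1, h1.2]

instance (l : ℝ) : SigmaFinite (ENNReal.ofReal l • (volume : Measure Plane)) :=
  inferInstanceAs (SigmaFinite (l.toNNReal • (volume : Measure Plane)))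

lemma IsHomogeneousPPP.lintegral_tprod {l : ℝ} {Φ : Measure (ℕ → Plane)}
    (h : IsHomogeneousPPP l Φ) {g : Plane → ℝ≥0∞} (hg : Measurable g) (hg1 : ∀ v, g v ≤ 1)
    (c : Plane) :
    ∫⁻ x, ∏' j, g (x j - c) ∂Φ = expNeg (ENNReal.ofReal l * ∫⁻ v, 1 - g v) := by
  have := IsPoissonPointProcess.lintegral_tprod h (g := fun v => g (v - c)) (by fun_prop)
    fun v => hg1 _
  rw [this, lintegral_smul_measure, smul_eq_mul, lintegral_sub_right_eq_self (fun v => 1 - g v)]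

/-- The expected number of points in the unit square is the density. -/
lemma IsHomogeneousPPP.tsum_measure_unitSquare {l : ℝ} {Φ : Measure (ℕ → Plane)}
    (h : IsHomogeneousPPP l Φ) :
    ∑' i, Φ {x | x i ∈ unitSquare} = ENNReal.ofReal l := by
  have hk : ∫⁻ v, unitSquare.indicator 1 v ∂(ENNReal.ofReal l • (volume : Measure Plane)) =
      ENNReal.ofReal l := by
    rw [lintegral_indicator_one measurableSet_unitSquare]
    simp [volume_unitSquare]
  have hm : Measurable (unitSquare.indicator (1 : Plane → ℝ≥0∞)) :=
    measurable_one.indicator measurableSet_unitSquare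
  have := IsPoissonPointProcess.lintegral_tsum h hm (by rw [hk]; simp)
  rw [hk, lintegral_tsum fun i => (show Measurable fun x : ℕ → Plane => unitSquare.indicator 1 (x i)
    from hm.comp (measurable_pi_apply i)).aemeasurable] at this
  rw [← this]
  refine tsum_congr fun i => ?_
  exact (lintegral_indicator_one (measurable_pi_apply i measurableSet_unitSquare)).symm

/-- The Slivnyak-Mecke formula for a homogeneous Poisson point process and the functional
`∏' j, g (x j - x i)`. -/
lemma IsHomogeneousPPP.tsum_lintegral_mul_tprod {l : ℝ} {Φ : Measure (ℕ → Plane)}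
    (h : IsHomogeneousPPP l Φ) {g : Plane → ℝ≥0∞} (hg : Continuous g) (hg1 : ∀ v, g v ≤ 1)
    {H : Plane → ℝ≥0∞} (hH : Measurable H) (hHfin : ∫⁻ v, H v ≠ ∞)
    (hgH : ∀ v w, ‖w‖ ≤ 4 → 1 - g (v - w) ≤ H v) :
    ∑' i, ∫⁻ x, unitSquare.indicator 1 (x i) * ∏' j, g (x j - x i) ∂Φ =
      ENNReal.ofReal l * g 0 * expNeg (ENNReal.ofReal l * ∫⁻ v, 1 - g v) := by
  have hprob := h.isProbabilityMeasure
  set k : Plane → ℝ≥0∞ := unitSquare.indicator 1 with hk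
  have hkm : Measurable k := measurable_one.indicator measurableSet_unitSquare
  have hgm : Measurable g := hg.measurable
  have hk1 (v) : k v ≤ 1 := Set.indicator_le_self' (by simp) v
  have hktop : ∫⁻ v, k v ∂(ENNReal.ofReal l • (volume : Measure Plane)) ≠ ∞ := by
    rw [lintegral_indicator_one measurableSet_unitSquare]
    simp [volume_unitSquare]
  set e := expNeg (ENNReal.ofReal l * ∫⁻ v, 1 - g v) with he
  -- The random centre `x i` is replaced by `ρ n (x i)`, which takes finitely many values. On a cell
  -- where it equals `c` the product has a deterministic centre, and the weighted Campbell formula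
  -- applies.
  set ρ : ℕ → SimpleFunc Plane Plane := fun n =>
    SimpleFunc.approxOn id measurable_id Set.univ 0 (Set.mem_univ _) n with hρ
  have hρlim (v : Plane) : Tendsto (fun n => ρ n v) atTop (𝓝 v) :=
    SimpleFunc.tendsto_approxOn measurable_id _ (by simp)
  -- The approximation at most doubles the norm, and points of the unit square have norm at most
  -- `2`; hence the `4` in the hypothesis on `H`.
  have hρle (n : ℕ) {v : Plane} (hv : v ∈ unitSquare) : ‖ρ n v‖ ≤ 4 := by
    have := SimpleFunc.norm_approxOn_zero_le measurable_id (Set.mem_univ (0 : Plane)) v n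
    have h2 := norm_le_of_mem_unitSquare hv
    simp only [id] at this
    linarith
  have hprod (c : Plane) : Measurable fun x : ℕ → Plane => ∏' j, g (x j - c) :=
    Measurable.ennreal_tprod (fun j => by fun_prop) fun j x => hg1 _
  set kc : ℕ → Plane → Plane → ℝ≥0∞ := fun n c v =>
    k v * (ρ n ⁻¹' {c}).indicator 1 v with hkc
  have hcell (n : ℕ) (x : ℕ → Plane) (i : ℕ) : k (x i) * ∏' j, g (x j - ρ n (x i)) =
      ∑ c ∈ (ρ n).range, kc n c (x i) * ∏' j, g (x j - c) := by
    rw [Finset.sum_eq_single (ρ n (x i))]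
    · simp [hkc]
    · intro c _ hc
      simp [hkc, hc.symm]
    · intro hc; exact absurd (SimpleFunc.mem_range_self _ _) hc
  have hcm (n : ℕ) (c : Plane) : Measurable (kc n c) :=
    hkm.mul (measurable_one.indicator ((ρ n).measurableSet_fiber c))
  have hFm (n : ℕ) (i : ℕ) :
      Measurable fun x : ℕ → Plane => k (x i) * ∏' j, g (x j - ρ n (x i)) := by
    simp_rw [hcell]
    exact Finset.measurable_sum _ fun c _ =>
      ((hcm n c).comp (measurable_pi_apply i)).mul (hprod c)
  have hstep (n : ℕ) : ∑' i, ∫⁻ x, k (x i) * ∏' j, g (x j - ρ n (x i)) ∂Φ =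
      (ENNReal.ofReal l * ∫⁻ v, k v * g (v - ρ n v)) * e := by
    have h1 (c : Plane) : ∫⁻ x, (∑' i, kc n c (x i)) *
        ∏' j, g (x j - c) ∂Φ =
        (ENNReal.ofReal l * ∫⁻ v, kc n c v * g (v - c)) * e := by
      have := IsPoissonPointProcess.lintegral_tsum_mul_tprod h (hcm n c) ?_
        (g := fun v => g (v - c)) (by fun_prop) (fun v => hg1 _)
      · rw [this, lintegral_smul_measure, lintegral_smul_measure, smul_eq_mul, smul_eq_mul,
          lintegral_sub_right_eq_self (fun v => 1 - g v)]
      · refine ((lintegral_mono fun v => ?_).trans_lt hktop.lt_top).ne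
        exact mul_le_of_le_one_right' (Set.indicator_le_self' (by simp) v)
    rw [← lintegral_tsum fun i => (hFm n i).aemeasurable]
    simp_rw [hcell, fun x : ℕ → Plane => Summable.tsum_finsetSum
      (f := fun c i => kc n c (x i) * ∏' j, g (x j - c))
      (s := (ρ n).range) fun c _ => ENNReal.summable, ENNReal.tsum_mul_right]
    have hmm (c : Plane) : Measurable fun x : ℕ → Plane =>
        (∑' i, kc n c (x i)) * ∏' j, g (x j - c) :=
      (Measurable.tsum fun i => (hcm n c).comp (measurable_pi_apply i)).mul (hprod c)
    have hmk (c : Plane) : Measurable fun v => kc n c v * g (v - c) :=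
      (hcm n c).mul (by fun_prop)
    rw [lintegral_finsetSum _ fun c _ => hmm c]
    simp_rw [h1]
    rw [← Finset.sum_mul, ← Finset.mul_sum, ← lintegral_finsetSum _ fun c _ => hmk c]
    congr 3 with v
    rw [Finset.sum_eq_single (ρ n v)]
    · simp [hkc]
    · intro c _ hc
      simp [hkc, hc.symm]
    · intro hc; exact absurd (SimpleFunc.mem_range_self _ _) hc
  have hR : Tendsto (fun n => (ENNReal.ofReal l * ∫⁻ v, k v * g (v - ρ n v)) * e) atTop
      (𝓝 (ENNReal.ofReal l * g 0 * e)) := by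
    refine ENNReal.Tendsto.mul_const (ENNReal.Tendsto.const_mul ?_ (.inr ENNReal.ofReal_ne_top))
      (.inr (expNeg_ne_top _))
    have h0 : ∫⁻ v, k v * g 0 = g 0 := by
      rw [lintegral_mul_const _ hkm, lintegral_indicator_one measurableSet_unitSquare,
        volume_unitSquare, one_mul]
    rw [← h0]
    refine tendsto_lintegral_of_dominated_convergence k (fun n => ?_)
      (fun n => Eventually.of_forall fun v => mul_le_of_le_one_right' (hg1 _)) ?_
      (Eventually.of_forall fun v => ?_)
    · have := (ρ n).measurable
      fun_prop
    · rw [lintegral_indicator_one measurableSet_unitSquare]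
      simp [volume_unitSquare]
    · refine ENNReal.Tendsto.const_mul ?_ (.inr ((hk1 v).trans_lt ENNReal.one_lt_top).ne)
      have := (hg.tendsto (v - v)).comp ((hρlim v).const_sub v)
      rwa [sub_self] at this
  -- Almost surely the majorant is summable along the process, which permits the limit inside the
  -- infinite product.
  have hHas : ∀ᵐ x ∂Φ, ∑' j, H (x j) < ∞ := by
    have h1 : ∫⁻ v, H v ∂(ENNReal.ofReal l • (volume : Measure Plane)) ≠ ∞ := by
      rw [lintegral_smul_measure]
      exact ENNReal.mul_ne_top ENNReal.ofReal_ne_top hHfin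
    refine ae_lt_top (Measurable.tsum fun j => hH.comp (measurable_pi_apply j)) ?_
    rwa [IsPoissonPointProcess.lintegral_tsum h hH h1]
  have hLi (i : ℕ) : Tendsto (fun n => ∫⁻ x, k (x i) * ∏' j, g (x j - ρ n (x i)) ∂Φ) atTop
      (𝓝 (∫⁻ x, k (x i) * ∏' j, g (x j - x i) ∂Φ)) := by
    refine tendsto_lintegral_of_dominated_convergence 1 (fun n => hFm n i)
      (fun n => Eventually.of_forall fun x =>
        mul_le_one' (hk1 _) (ENNReal.tprod_le_one' fun j => hg1 _)) (by simp) ?_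
    filter_upwards [hHas] with x hx
    by_cases hxi : x i ∈ unitSquare
    · refine ENNReal.Tendsto.const_mul ?_ (.inr ((hk1 _).trans_lt ENNReal.one_lt_top).ne)
      refine ENNReal.tendsto_tprod_of_dominated (fun n j => hg1 _) (fun j => hg1 _) hx.ne
        (fun j => ?_) (fun n j => hgH _ _ (hρle n hxi))
      exact (hg.tendsto _).comp ((hρlim (x i)).const_sub (x j))
    · simp [hk, hxi]
  -- Termwise convergence is dominated by the probabilities that `x i` lies in the unit square,
  -- which sum to the density.
  have hL : Tendsto (fun n => ∑' i, ∫⁻ x, k (x i) * ∏' j, g (x j - ρ n (x i)) ∂Φ) atTop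
      (𝓝 (∑' i, ∫⁻ x, k (x i) * ∏' j, g (x j - x i) ∂Φ)) := by
    simp_rw [← lintegral_count]
    refine tendsto_lintegral_of_dominated_convergence (fun i => ∫⁻ x, k (x i) ∂Φ)
      (fun n => .of_discrete) (fun n => Eventually.of_forall fun i =>
        lintegral_mono fun x => mul_le_of_le_one_right' (ENNReal.tprod_le_one' fun j => hg1 _)) ?_
      (Eventually.of_forall hLi)
    rwa [lintegral_count, ← lintegral_tsum fun i => (show Measurable fun x : ℕ → Plane => k (x i)
      from hkm.comp (measurable_pi_apply i)).aemeasurable,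
      IsPoissonPointProcess.lintegral_tsum h hkm hktop]
  simp_rw [hstep] at hL
  exact tendsto_nhds_unique hL hR

/-! ### Rayleigh fading and its integral over the plane -/

lemma lintegral_gammaMeasure (a r : ℝ) {f : ℝ → ℝ≥0∞} (hf : Measurable f) :
    ∫⁻ q, f q ∂(gammaMeasure a r) = ∫⁻ q in Set.Ioi 0, gammaPDF a r q * f q := by
  have hm : Measurable (gammaPDF a r) := (measurable_gammaPDFReal a r).ennreal_ofReal
  rw [gammaMeasure, lintegral_withDensity_eq_lintegral_mul _ hm hf,
    setLIntegral_congr Ioi_ae_eq_Ici, ← lintegral_indicator measurableSet_Ici]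
  refine lintegral_congr fun q => ?_
  by_cases hq : q ∈ Set.Ici (0 : ℝ)
  · rw [Set.indicator_of_mem hq]; rfl
  · rw [Set.indicator_of_notMem hq]
    simp only [Pi.mul_apply]
    rw [show gammaPDF a r q = 0 from gammaPDF_of_neg (not_le.1 hq), zero_mul]

lemma lintegral_ofReal_exp_neg_mul_Ioi {b : ℝ} (hb : 0 < b) :
    ∫⁻ q in Set.Ioi (0 : ℝ), ENNReal.ofReal (Real.exp (-b * q)) = ENNReal.ofReal b⁻¹ := by
  rw [← ofReal_integral_eq_lintegral_ofReal (integrableOn_exp_mul_Ioi (by linarith) 0)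
    (Eventually.of_forall fun q => (Real.exp_pos _).le), integral_exp_mul_Ioi (by linarith)]
  simp [neg_div_neg_eq]

/-- Laplace transform of the unit-mean exponential distribution. -/
lemma lintegral_expNeg_expMeasure (c : ℝ≥0∞) :
    ∫⁻ q, expNeg (c * ENNReal.ofReal q) ∂(expMeasure 1) = (1 + c)⁻¹ := by
  rw [expMeasure, lintegral_gammaMeasure _ _ (by fun_prop)]
  rcases eq_or_ne c ∞ with rfl | hc
  · rw [setLIntegral_congr_fun (g := fun _ => 0) measurableSet_Ioi]
    · simp
    · intro q hq
      simp [ENNReal.top_mul (ENNReal.ofReal_pos.2 hq).ne']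
  · lift c to ℝ≥0 using hc
    have hc := c.coe_nonneg
    rw [setLIntegral_congr_fun (g := fun q => ENNReal.ofReal (Real.exp (-(1 + c : ℝ) * q)))
      measurableSet_Ioi, lintegral_ofReal_exp_neg_mul_Ioi (by linarith),
      ENNReal.ofReal_inv_of_pos (by linarith), ENNReal.ofReal_add zero_le_one hc]
    · simp
    · intro q hq
      have hq' : (0 : ℝ) ≤ q := (Set.mem_Ioi.1 hq).le
      simp only
      rw [gammaPDF_of_nonneg hq', ← ENNReal.ofReal_coe_nnreal, ← ENNReal.ofReal_mul hc,
        expNeg_ofReal (mul_nonneg hc hq'), ← ENNReal.ofReal_mul (by simp; positivity)]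
      congr 1
      simp only [Real.one_rpow, Real.Gamma_one, sub_self, Real.rpow_zero, div_one, one_mul]
      rw [← Real.exp_add]
      ring_nf

/-- Laplace transform at `u` of the interference power received through Rayleigh fading over the
displacement `v`. -/
def rayleighFactor (η u : ℝ) (v : Plane) : ℝ≥0∞ := (1 + ENNReal.ofReal u * ‖v‖ₑ ^ (-η))⁻¹

lemma continuous_rayleighFactor (η u : ℝ) : Continuous (rayleighFactor η u) := by
  unfold rayleighFactor
  have h : Continuous fun v : Plane => ENNReal.ofReal u * ‖v‖ₑ ^ (-η) :=
    (ENNReal.continuous_const_mul ENNReal.ofReal_ne_top).comp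
    (ENNReal.continuous_rpow_const.comp continuous_enorm)
  fun_prop

lemma rayleighFactor_le_one (η u : ℝ) (v : Plane) : rayleighFactor η u v ≤ 1 := by
  rw [rayleighFactor, ENNReal.inv_le_one]
  exact le_self_add

lemma rayleighFactor_ne_zero (η u : ℝ) {v : Plane} (hv : v ≠ 0) : rayleighFactor η u v ≠ 0 := by
  rw [rayleighFactor, ENNReal.inv_ne_zero]
  refine ENNReal.add_ne_top.2 ⟨ENNReal.one_ne_top, ENNReal.mul_ne_top ENNReal.ofReal_ne_top ?_⟩
  exact ENNReal.rpow_ne_top_of_ne_zero (by simpa using hv) (by simp)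

lemma one_sub_rayleighFactor {η u : ℝ} (hη : 0 < η) (hu : 0 < u) (v : Plane) :
    1 - rayleighFactor η u v = ENNReal.ofReal (u / (‖v‖ ^ η + u)) := by
  -- At the origin `0 ^ (-η) = ∞`, so the factor is `0` and both sides equal `1`.
  rcases eq_or_ne v 0 with rfl | hv
  · rw [rayleighFactor, enorm_zero, ENNReal.zero_rpow_of_neg (by linarith),
      ENNReal.mul_top (by simpa using hu), norm_zero, Real.zero_rpow hη.ne', zero_add,
      div_self hu.ne']
    simp
  · have hv0 : 0 < ‖v‖ := norm_pos_iff.2 hv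
    have hp : 0 < ‖v‖ ^ η := Real.rpow_pos_of_pos hv0 _
    have h1 : rayleighFactor η u v = ENNReal.ofReal (‖v‖ ^ η / (‖v‖ ^ η + u)) := by
      rw [rayleighFactor, ← ofReal_norm, ENNReal.ofReal_rpow_of_pos hv0,
        ← ENNReal.ofReal_mul hu.le, ← ENNReal.ofReal_one,
        ← ENNReal.ofReal_add zero_le_one (by positivity), ← ENNReal.ofReal_inv_of_pos (by positivity),
        Real.rpow_neg hv0.le]
      congr 1
      field_simp
    rw [h1, ← ENNReal.ofReal_one, ← ENNReal.ofReal_sub _ (by positivity)]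
    congr 1
    field_simp
    ring

lemma integral_plane_exp_neg_mul_rpow {p b : ℝ} (hp : 1 ≤ p) (hb : 0 < b) :
    ∫ v : Plane, Real.exp (-b * ‖v‖ ^ p) = Real.pi * b ^ (-2 / p) * Real.Gamma (2 / p + 1) := by
  rw [← Complex.integral_exp_neg_mul_rpow hp hb,
    ← (Complex.orthonormalBasisOneI.repr.measurePreserving).integral_comp
      Complex.orthonormalBasisOneI.repr.toMeasurableEquiv.measurableEmbedding]
  simp

lemma lintegral_plane_exp_neg_mul_rpow {p b : ℝ} (hp : 1 ≤ p) (hb : 0 < b) :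
    ∫⁻ v : Plane, ENNReal.ofReal (Real.exp (-b * ‖v‖ ^ p)) =
      ENNReal.ofReal (Real.pi * b ^ (-2 / p) * Real.Gamma (2 / p + 1)) := by
  have hpos : 0 < Real.pi * b ^ (-2 / p) * Real.Gamma (2 / p + 1) := by
    have := Real.Gamma_pos_of_pos (show 0 < 2 / p + 1 by positivity)
    have := Real.pi_pos
    positivity
  have h := integral_plane_exp_neg_mul_rpow hp hb
  have hi : Integrable fun v : Plane => Real.exp (-b * ‖v‖ ^ p) := by
    by_contra hc
    rw [integral_undef hc] at h
    linarith
  rw [← ofReal_integral_eq_lintegral_ofReal hi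
    (Eventually.of_forall fun q => (Real.exp_pos _).le), h]

/-- The constant in the Laplace transform of the interference of a Poisson field with Rayleigh
fading. -/
def interferenceConst (δ : ℝ) : ℝ := Real.pi * Real.Gamma (1 + δ) * Real.Gamma (1 - δ)

lemma interferenceConst_pos {δ : ℝ} (h0 : 0 < δ) (h1 : δ < 1) : 0 < interferenceConst δ := by
  have := Real.Gamma_pos_of_pos (show 0 < 1 + δ by positivity)
  have := Real.Gamma_pos_of_pos (show 0 < 1 - δ by linarith)
  have := Real.pi_pos
  unfold interferenceConst
  positivity

/-- Writing `u / (‖v‖ ^ η + u)` as an integral of exponentials in `s` and exchanging the integrals,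
the plane integral yields `π Γ(1+δ) (u / s) ^ δ`, and integrating `exp (-s) * s ^ (-δ)` yields
`Γ(1-δ)`. Convergence at `s = 0` is where `δ < 1` enters. -/
lemma lintegral_one_sub_rayleighFactor {η u : ℝ} (hη : 2 < η) (hu : 0 < u) :
    ∫⁻ v, 1 - rayleighFactor η u v =
      ENNReal.ofReal (interferenceConst (2 / η) * u ^ (2 / η)) := by
  have hδ0 : 0 < 2 / η := by positivity
  have hδ1 : 2 / η < 1 := by rw [div_lt_one] <;> linarith
  set δ := 2 / η with hδ
  have h1 (v : Plane) : 1 - rayleighFactor η u v =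
      ∫⁻ s in Set.Ioi (0 : ℝ), ENNReal.ofReal (Real.exp (-((‖v‖ ^ η + u) / u) * s)) := by
    have : 0 ≤ ‖v‖ ^ η := by positivity
    rw [lintegral_ofReal_exp_neg_mul_Ioi (by positivity), inv_div,
      one_sub_rayleighFactor (by linarith) hu]
  simp_rw [h1]
  rw [lintegral_lintegral_swap (by
    have : Measurable fun v : Plane => ‖v‖ ^ η := by fun_prop
    fun_prop)]
  have h2 (s : ℝ) (hs : s ∈ Set.Ioi (0 : ℝ)) :
      ∫⁻ v : Plane, ENNReal.ofReal (Real.exp (-((‖v‖ ^ η + u) / u) * s)) =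
      ENNReal.ofReal (Real.pi * Real.Gamma (1 + δ) * u ^ δ) *
        ENNReal.ofReal (Real.exp (-s) * s ^ ((1 - δ) - 1)) := by
    have hs' : (0 : ℝ) < s := hs
    have h3 (v : Plane) : ENNReal.ofReal (Real.exp (-((‖v‖ ^ η + u) / u) * s)) =
        ENNReal.ofReal (Real.exp (-s)) * ENNReal.ofReal (Real.exp (-(s / u) * ‖v‖ ^ η)) := by
      rw [← ENNReal.ofReal_mul (Real.exp_pos _).le, ← Real.exp_add]
      congr 2
      field_simp
      ring
    simp_rw [h3]
    have hm : Measurable fun v : Plane => ENNReal.ofReal (Real.exp (-(s / u) * ‖v‖ ^ η)) := by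
      have : Measurable fun v : Plane => ‖v‖ ^ η := by fun_prop
      fun_prop
    rw [lintegral_const_mul _ hm,
      lintegral_plane_exp_neg_mul_rpow (by linarith) (by positivity),
      ← ENNReal.ofReal_mul (Real.exp_pos _).le]
    have hG := Real.Gamma_pos_of_pos (show 0 < 1 + δ by positivity)
    have := Real.pi_pos
    rw [← ENNReal.ofReal_mul (by positivity)]
    congr 1
    rw [neg_div, ← hδ, Real.div_rpow hs'.le hu.le, Real.rpow_neg hu.le, add_comm (2 / η),
      show 1 - δ - 1 = -δ by ring]
    rw [← hδ]
    field_simp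
  rw [setLIntegral_congr_fun measurableSet_Ioi h2, lintegral_const_mul _ (by fun_prop),
    ← ofReal_integral_eq_lintegral_ofReal (Real.GammaIntegral_convergent (by linarith))
      ((ae_restrict_iff' measurableSet_Ioi).2 (Eventually.of_forall fun s hs => by
        have : (0 : ℝ) < s := hs
        simp only [Pi.zero_apply]
        positivity)), ← Real.Gamma_eq_integral (by linarith), ← ENNReal.ofReal_mul]
  · rw [interferenceConst]
    ring_nf
  · have hG := Real.Gamma_pos_of_pos (show 0 < 1 + δ by positivity)
    have := Real.pi_pos
    positivity

/-- By convexity `‖v‖ ^ η ≤ 2 ^ (η - 1) * (‖v - w‖ ^ η + R ^ η)`. The bound supplies the integrable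
majorant `H` that the Mecke formula requires, uniform over bounded shifts. -/
lemma exists_one_sub_rayleighFactor_sub_le {η u : ℝ} (hη : 1 ≤ η) (hu : 0 < u) {R : ℝ}
    (hR : 0 ≤ R) : ∃ C : ℝ≥0∞, C ≠ ∞ ∧ ∀ v w : Plane, ‖w‖ ≤ R →
      1 - rayleighFactor η u (v - w) ≤ C * (1 - rayleighFactor η u v) := by
  set B : ℝ := 2 ^ (η - 1) with hB
  have hB1 : 1 ≤ B := Real.one_le_rpow one_le_two (by linarith)
  have hRη : 0 ≤ R ^ η := by positivity
  refine ⟨ENNReal.ofReal (B * (1 + R ^ η / u)), ENNReal.ofReal_ne_top, fun v w hw => ?_⟩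
  rw [one_sub_rayleighFactor (by linarith) hu, one_sub_rayleighFactor (by linarith) hu,
    ← ENNReal.ofReal_mul (by positivity)]
  refine ENNReal.ofReal_le_ofReal ?_
  have hx : 0 ≤ ‖v - w‖ ^ η := by positivity
  have hy : 0 ≤ ‖v‖ ^ η := by positivity
  have h1 : ‖v‖ ^ η ≤ B * (‖v - w‖ ^ η + R ^ η) := by
    refine le_trans (Real.rpow_le_rpow (norm_nonneg _) (z := η) (y := ‖v - w‖ + R) ?_ (by linarith)) ?_
    · have := norm_add_le (v - w) w
      rw [sub_add_cancel] at this
      linarith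
    · exact_mod_cast NNReal.rpow_add_le_mul_rpow_add_rpow ‖v - w‖₊ ⟨R, hR⟩ hη
  rw [mul_div_assoc', div_le_div_iff₀ (by positivity) (by positivity)]
  have h2 : ‖v‖ ^ η + u ≤ B * (1 + R ^ η / u) * (‖v - w‖ ^ η + u) := by
    have h3 : 0 ≤ R ^ η / u * ‖v - w‖ ^ η := by positivity
    have h4 : R ^ η / u * u = R ^ η := by field_simp
    have : B * (1 + R ^ η / u) * (‖v - w‖ ^ η + u) =
      B * (‖v - w‖ ^ η + R ^ η) + B * u + B * (R ^ η / u * ‖v - w‖ ^ η) := by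
        linear_combination B * h4
    rw [this]
    have h5 : 0 ≤ B * (R ^ η / u * ‖v - w‖ ^ η) := by positivity
    nlinarith
  calc u * (‖v‖ ^ η + u) ≤ u * (B * (1 + R ^ η / u) * (‖v - w‖ ^ η + u)) := by gcongr
    _ = _ := by ring

/-! ### Randomly displaced interferers -/

section Mixture

variable (ρ : Measure Plane) [IsProbabilityMeasure ρ]

/-- The average of `rayleighFactor` over a random displacement. -/
def rayleighMixture (η u : ℝ) (v : Plane) : ℝ≥0∞ := ∫⁻ z, rayleighFactor η u (v + z) ∂ρ

lemma rayleighMixture_le_one (η u : ℝ) (v : Plane) : rayleighMixture ρ η u v ≤ 1 := by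
  simpa [rayleighMixture] using lintegral_mono (μ := ρ) fun z => rayleighFactor_le_one η u (v + z)

lemma continuous_rayleighMixture (η u : ℝ) : Continuous (rayleighMixture ρ η u) := by
  have hm := (continuous_rayleighFactor η u).measurable
  refine continuous_iff_continuousAt.2 fun v => ?_
  refine tendsto_lintegral_filter_of_dominated_convergence 1
    (Eventually.of_forall fun w => by fun_prop)
    (Eventually.of_forall fun w => Eventually.of_forall fun z => rayleighFactor_le_one _ _ _)
    (by simp) (Eventually.of_forall fun z => ?_)
  exact ((continuous_rayleighFactor η u).comp (continuous_id.add continuous_const)).tendsto v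

lemma one_sub_rayleighMixture (η u : ℝ) (v : Plane) :
    1 - rayleighMixture ρ η u v = ∫⁻ z, 1 - rayleighFactor η u (v + z) ∂ρ := by
  have hm := (continuous_rayleighFactor η u).measurable
  rw [lintegral_sub (by fun_prop) _ (Eventually.of_forall fun z => rayleighFactor_le_one _ _ _)]
  · simp [rayleighMixture]
  · exact ((rayleighMixture_le_one ρ η u v).trans_lt ENNReal.one_lt_top).ne

/-- By Fubini and translation invariance, independent displacements leave the exponent unchanged, so
the displacement law is irrelevant. -/
lemma lintegral_one_sub_rayleighMixture {η u : ℝ} (hη : 2 < η) (hu : 0 < u) :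
    ∫⁻ v, 1 - rayleighMixture ρ η u v =
      ENNReal.ofReal (interferenceConst (2 / η) * u ^ (2 / η)) := by
  have hm := (continuous_rayleighFactor η u).measurable
  simp_rw [one_sub_rayleighMixture]
  rw [lintegral_lintegral_swap (by fun_prop)]
  simp_rw [lintegral_add_right_eq_self (μ := (volume : Measure Plane))
    (fun v => 1 - rayleighFactor η u v), lintegral_one_sub_rayleighFactor hη hu]
  simp

/-- A displacement of positive length avoids the zero of the Rayleigh factor. This allows the factor
of the reference point itself to be cancelled in the Mecke formula. -/
lemma rayleighMixture_zero_ne_zero (η u : ℝ) {r : ℝ} (hr : 0 < r) (hρ : ∀ᵐ z ∂ρ, ‖z‖ = r) :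
    rayleighMixture ρ η u 0 ≠ 0 := by
  have hm := (continuous_rayleighFactor η u).measurable
  intro h0
  rw [rayleighMixture, lintegral_eq_zero_iff (by fun_prop)] at h0
  have : ∀ᵐ z ∂ρ, False := by
    filter_upwards [h0, hρ] with z hz hzr
    rw [zero_add] at hz
    refine rayleighFactor_ne_zero η u (fun hc => ?_) hz
    rw [hc, norm_zero] at hzr
    linarith
  simp at this
  exact IsProbabilityMeasure.ne_zero ρ this

lemma exists_one_sub_rayleighMixture_sub_le {η u : ℝ} (hη : 1 ≤ η) (hu : 0 < u) {R : ℝ}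
    (hR : 0 ≤ R) : ∃ C : ℝ≥0∞, C ≠ ∞ ∧ ∀ v w : Plane, ‖w‖ ≤ R →
      1 - rayleighMixture ρ η u (v - w) ≤ C * (1 - rayleighMixture ρ η u v) := by
  obtain ⟨C, hC, h⟩ := exists_one_sub_rayleighFactor_sub_le hη hu hR
  have hm := (continuous_rayleighFactor η u).measurable
  refine ⟨C, hC, fun v w hw => ?_⟩
  rw [one_sub_rayleighMixture, one_sub_rayleighMixture, ← lintegral_const_mul _ (by fun_prop)]
  refine lintegral_mono fun z => ?_
  have := h (v + z) w hw
  rwa [add_sub_right_comm] at this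

end Mixture

/-! ### The outage function and its asymptotics at zero -/

/-- The polynomials `p k` with `(-u) ^ k * φ⁽ᵏ⁾(u) = p k (c * u ^ δ) * exp (-(c * u ^ δ))` for
`φ u = exp (-(c * u ^ δ))`. -/
def stablePoly (δ : ℝ) : ℕ → Polynomial ℝ
  | 0 => 1
  | k + 1 => (k : ℝ) • stablePoly δ k +
      δ • (Polynomial.X * (stablePoly δ k - (stablePoly δ k).derivative))

/-- The sum of `stablePoly δ k / k!` over `k < L`. -/
def successPoly (δ : ℝ) (L : ℕ) : Polynomial ℝ :=
  ∑ k ∈ Finset.range L, (k.factorial : ℝ)⁻¹ • stablePoly δ k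

/-- The outage probability of a link of diversity order `L` when the Laplace transform of the
interference at the relevant argument equals `exp (-s)`. -/
def outageFn (δ : ℝ) (L : ℕ) (s : ℝ) : ℝ := 1 - Real.exp (-s) * (successPoly δ L).eval s

section Outage

variable {δ : ℝ}

lemma coeff_zero_stablePoly_succ (k : ℕ) : (stablePoly δ (k + 1)).coeff 0 = 0 := by
  induction k with
  | zero => simp [stablePoly]
  | succ k ih => rw [stablePoly]; simp [ih]

lemma coeff_succ_stablePoly_succ (k j : ℕ) : (stablePoly δ (k + 1)).coeff (j + 1) =
    (k - δ * (j + 1)) * (stablePoly δ k).coeff (j + 1) + δ * (stablePoly δ k).coeff j := by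
  rw [stablePoly]
  simp only [Polynomial.coeff_add, Polynomial.coeff_smul, Polynomial.coeff_X_mul,
    Polynomial.coeff_sub, Polynomial.coeff_derivative, smul_eq_mul]
  ring

lemma coeff_stablePoly_eq_zero (k j : ℕ) (h : k < j) : (stablePoly δ k).coeff j = 0 := by
  induction k generalizing j with
  | zero => simp [stablePoly, Polynomial.coeff_one, h.ne']
  | succ k ih =>
    obtain ⟨j, rfl⟩ : ∃ i, j = i + 1 := ⟨j - 1, by omega⟩
    rw [coeff_succ_stablePoly_succ, ih _ (by omega), ih _ (by omega)]
    simp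

/-- In the recursion the factor `k - δ * (j + 1)` can be negative only when `j + 1 > k`, and then it
multiplies a vanishing coefficient. -/
lemma coeff_stablePoly_nonneg (h0 : 0 < δ) (h1 : δ < 1) (k j : ℕ) :
    0 ≤ (stablePoly δ k).coeff j := by
  induction k generalizing j with
  | zero =>
    rw [stablePoly, Polynomial.coeff_one]
    split_ifs <;> norm_num
  | succ k ih =>
    cases j with
    | zero => rw [coeff_zero_stablePoly_succ]
    | succ j =>
      rw [coeff_succ_stablePoly_succ]
      refine add_nonneg ?_ (mul_nonneg h0.le (ih j))
      rcases lt_or_ge k (j + 1) with hkj | hkj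
      · rw [coeff_stablePoly_eq_zero k _ hkj, mul_zero]
      · refine mul_nonneg ?_ (ih _)
        have : ((j + 1 : ℕ) : ℝ) ≤ k := by exact_mod_cast hkj
        push_cast at this
        have : δ * (j + 1) ≤ 1 * (j + 1) := by gcongr
        linarith

/-- Since the constant coefficient vanishes, the recursion multiplies the linear coefficient by `n +
1 - δ`, which is the functional equation of `Γ`. The asymptotic constant of the theorem originates
here. -/
lemma coeff_one_stablePoly (h1 : δ < 1) (n : ℕ) :
    (stablePoly δ (n + 1)).coeff 1 = δ * (Real.Gamma (n + 1 - δ) / Real.Gamma (1 - δ)) := by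
  have hG := (Real.Gamma_pos_of_pos (show 0 < 1 - δ by linarith)).ne'
  induction n with
  | zero =>
    rw [coeff_succ_stablePoly_succ]
    simp [stablePoly, Polynomial.coeff_one, div_self hG]
  | succ n ih =>
    rw [coeff_succ_stablePoly_succ, zero_add, ih, coeff_zero_stablePoly_succ]
    push_cast
    rw [show (n : ℝ) + 1 + 1 - δ = (n + 1 - δ) + 1 by ring,
      Real.Gamma_add_one (by have : (0 : ℝ) ≤ n := n.cast_nonneg; linarith)]
    ring

lemma eval_stablePoly_nonneg (h0 : 0 < δ) (h1 : δ < 1) (k : ℕ) {s : ℝ} (hs : 0 ≤ s) :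
    0 ≤ (stablePoly δ k).eval s := by
  rw [Polynomial.eval_eq_sum_range]
  exact Finset.sum_nonneg fun i _ => mul_nonneg (coeff_stablePoly_nonneg h0 h1 _ _) (by positivity)

lemma eval_stablePoly_succ_pos (h0 : 0 < δ) (h1 : δ < 1) (n : ℕ) {s : ℝ} (hs : 0 < s) :
    0 < (stablePoly δ (n + 1)).eval s := by
  have hc : 0 < (stablePoly δ (n + 1)).coeff 1 := by
    rw [coeff_one_stablePoly h1]
    have := Real.Gamma_pos_of_pos (show 0 < 1 - δ by linarith)
    have := Real.Gamma_pos_of_pos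
      (show 0 < n + 1 - δ by have : (0 : ℝ) ≤ n := n.cast_nonneg; linarith)
    positivity
  rw [Polynomial.eval_eq_sum_range]
  refine Finset.sum_pos' (fun i _ => mul_nonneg (coeff_stablePoly_nonneg h0 h1 _ _) (by positivity))
    ⟨1, ?_, by positivity⟩
  rw [Finset.mem_range]
  have := Polynomial.le_natDegree_of_ne_zero hc.ne'
  omega

/-- The recursion of `stablePoly` makes the sum telescope. Thus `δ * s` times the derivative of the
outage function is a single term, which gives both its sign and its value at `0`. -/
lemma smul_X_mul_successPoly_sub_derivative (n : ℕ) :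
    δ • (Polynomial.X * (successPoly δ (n + 1) - (successPoly δ (n + 1)).derivative)) =
      (n.factorial : ℝ)⁻¹ • stablePoly δ (n + 1) := by
  induction n with
  | zero => simp [successPoly, stablePoly]
  | succ n ih =>
    rw [successPoly, Finset.sum_range_succ, ← successPoly, Polynomial.derivative_add,
      add_sub_add_comm, mul_add, smul_add, ih, Polynomial.derivative_smul, ← smul_sub,
      mul_smul_comm, smul_comm δ, stablePoly.eq_2 δ (n + 1), smul_add, smul_smul]
    have hf : (n.factorial : ℝ)⁻¹ = ((n + 1).factorial : ℝ)⁻¹ * ((n + 1 : ℕ) : ℝ) := by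
      rw [Nat.factorial_succ]
      push_cast
      field_simp
    rw [hf, mul_smul]

lemma outageFn_zero (n : ℕ) : outageFn δ (n + 1) 0 = 0 := by
  have (k : ℕ) : (stablePoly δ (k + 1)).eval 0 = 0 := by
    rw [← Polynomial.coeff_zero_eq_eval_zero, coeff_zero_stablePoly_succ]
  have h0 : stablePoly δ 0 = 1 := rfl
  simp [outageFn, successPoly, Finset.sum_range_succ', Polynomial.eval_finsetSum, this, h0]

lemma hasDerivAt_outageFn (L : ℕ) (s : ℝ) : HasDerivAt (outageFn δ L)
    (Real.exp (-s) * (successPoly δ L - (successPoly δ L).derivative).eval s) s := by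
  have h := (((hasDerivAt_neg s).exp.mul ((successPoly δ L).hasDerivAt s))).const_sub 1
  convert! h using 1
  rw [Polynomial.eval_sub]
  ring

lemma continuous_outageFn (L : ℕ) : Continuous (outageFn δ L) :=
  continuous_iff_continuousAt.2 fun s => (hasDerivAt_outageFn L s).continuousAt

lemma strictMonoOn_outageFn (h0 : 0 < δ) (h1 : δ < 1) (n : ℕ) :
    StrictMonoOn (outageFn δ (n + 1)) (Set.Ici 0) := by
  refine strictMonoOn_of_deriv_pos (convex_Ici 0) (continuous_outageFn _).continuousOn ?_
  intro s hs
  rw [interior_Ici, Set.mem_Ioi] at hs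
  rw [(hasDerivAt_outageFn _ s).deriv]
  refine mul_pos (Real.exp_pos _) ?_
  have h := congrArg (Polynomial.eval s) (smul_X_mul_successPoly_sub_derivative (δ := δ) n)
  simp only [Polynomial.eval_smul, Polynomial.eval_mul, Polynomial.eval_X, smul_eq_mul] at h
  have h2 := eval_stablePoly_succ_pos h0 h1 n hs
  have h3 : 0 < δ * (s * (successPoly δ (n + 1) - (successPoly δ (n + 1)).derivative).eval s) := by
    rw [h]; positivity
  exact pos_of_mul_pos_right (pos_of_mul_pos_right h3 h0.le) hs.le

lemma hasDerivAt_outageFn_zero (h0 : 0 < δ) (h1 : δ < 1) (n : ℕ) :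
    HasDerivAt (outageFn δ (n + 1))
      (Real.Gamma ((n + 1 : ℕ) - δ) / (Real.Gamma (1 - δ) * Real.Gamma (n + 1 : ℕ))) 0 := by
  convert! hasDerivAt_outageFn (δ := δ) (n + 1) 0 using 1
  -- The telescoped identity has a factor `X`, which evaluation at `0` would annihilate; comparing
  -- linear coefficients recovers the derivative there.
  have h := congrArg (Polynomial.coeff · 1) (smul_X_mul_successPoly_sub_derivative (δ := δ) n)
  simp only [Polynomial.coeff_smul, coeff_one_stablePoly h1, smul_eq_mul] at h
  rw [show (1 : ℕ) = 0 + 1 from rfl, Polynomial.coeff_X_mul,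
    Polynomial.coeff_zero_eq_eval_zero] at h
  have hG := (Real.Gamma_pos_of_pos (show 0 < 1 - δ by linarith)).ne'
  have hf : (n.factorial : ℝ) ≠ 0 := by positivity
  rw [neg_zero, Real.exp_zero, one_mul, ← mul_right_inj' h0.ne', h]
  push_cast
  rw [Real.Gamma_nat_eq_factorial]
  field_simp

lemma tendsto_outageFn_atTop (L : ℕ) : Tendsto (outageFn δ L) atTop (𝓝 1) := by
  have h := (Polynomial.tendsto_div_exp_atTop (successPoly δ L)).const_sub 1
  rw [sub_zero] at h
  refine h.congr fun s => ?_
  rw [outageFn, Real.exp_neg, div_eq_inv_mul]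

lemma outageFn_antitone (h0 : 0 < δ) (h1 : δ < 1) {s : ℝ} (hs : 0 ≤ s) :
    Antitone fun L => outageFn δ L s := by
  refine antitone_nat_of_succ_le fun L => ?_
  rw [outageFn, outageFn, successPoly, successPoly, Finset.sum_range_succ, Polynomial.eval_add,
    Polynomial.eval_smul, smul_eq_mul]
  have := eval_stablePoly_nonneg h0 h1 L hs
  have : 0 ≤ Real.exp (-s) * ((L.factorial : ℝ)⁻¹ * (stablePoly δ L).eval s) := by positivity
  linarith

/-- The outage constraint `outageFn δ L s ≤ ε` bounds `s` by a threshold that is asymptotically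
linear in `ε`. -/
lemma exists_outageFn_le_iff (h0 : 0 < δ) (h1 : δ < 1) {L : ℕ} (hL : 1 ≤ L) :
    ∃ S : ℝ → ℝ, (∀ ε, 0 < ε → ε < 1 → 0 < S ε ∧ ∀ s, 0 ≤ s → (outageFn δ L s ≤ ε ↔ s ≤ S ε)) ∧
      Tendsto (fun ε => S ε / ε) (𝓝[>] 0)
        (𝓝 (Real.Gamma (1 - δ) * Real.Gamma L / Real.Gamma (L - δ))) := by
  obtain ⟨n, rfl⟩ : ∃ n, L = n + 1 := ⟨L - 1, by omega⟩
  have hmono := strictMonoOn_outageFn h0 h1 n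
  have hex (ε : ℝ) : ∃ S : ℝ, 0 < ε → ε < 1 → 0 < S ∧ outageFn δ (n + 1) S = ε := by
    by_cases hε : 0 < ε ∧ ε < 1
    · obtain ⟨b, hb0, hb⟩ := ((eventually_gt_atTop (0 : ℝ)).and
        ((tendsto_outageFn_atTop (n + 1)).eventually (lt_mem_nhds hε.2))).exists
      obtain ⟨S, hS, hSε⟩ := intermediate_value_Icc hb0.le
        (continuous_outageFn (δ := δ) (n + 1)).continuousOn
        (show ε ∈ Set.Icc _ _ from ⟨by rw [outageFn_zero]; exact hε.1.le, hb.le⟩)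
      refine ⟨S, fun _ _ => ⟨lt_of_le_of_ne hS.1 fun hc => ?_, hSε⟩⟩
      rw [← hc, outageFn_zero] at hSε
      exact hε.1.ne hSε
    · exact ⟨0, fun a b => (hε ⟨a, b⟩).elim⟩
  choose S hS using hex
  refine ⟨S, fun ε hε0 hε1 => ⟨(hS ε hε0 hε1).1, fun s hs => ?_⟩, ?_⟩
  · obtain ⟨h2, h3⟩ := hS ε hε0 hε1
    conv_lhs => rw [← h3]
    exact hmono.le_iff_le hs h2.le
  · have hlt1 : ∀ᶠ ε in 𝓝[>] (0 : ℝ), 0 < ε ∧ ε < 1 :=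
      Ioo_mem_nhdsGT one_pos
    -- As `S ε` tends to `0` without vanishing, `ε / S ε` is a difference quotient of the outage
    -- function at `0`; its reciprocal has the asserted limit.
    have hSlim : Tendsto S (𝓝[>] 0) (𝓝[≠] 0) := by
      refine tendsto_nhdsWithin_iff.2 ⟨?_, ?_⟩
      · refine tendsto_order.2 ⟨fun a ha => ?_, fun a ha => ?_⟩
        · filter_upwards [hlt1] with ε hε using ha.trans (hS ε hε.1 hε.2).1
        · have hpos : 0 < outageFn δ (n + 1) a := by
            rw [← outageFn_zero (δ := δ) n]
            exact hmono (by simp) ha.le ha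
          filter_upwards [hlt1, Ioo_mem_nhdsGT hpos] with ε hε hε'
          obtain ⟨h2, h3⟩ := hS ε hε.1 hε.2
          rw [← hmono.lt_iff_lt h2.le ha.le, h3]
          exact hε'.2
      · filter_upwards [hlt1] with ε hε using (hS ε hε.1 hε.2).1.ne'
    have hder := (hasDerivAt_outageFn_zero h0 h1 n).tendsto_slope_zero
    simp only [zero_add, outageFn_zero, sub_zero, smul_eq_mul] at hder
    have hG1 := Real.Gamma_pos_of_pos (show 0 < 1 - δ by linarith)
    have hG2 := Real.Gamma_pos_of_pos (show 0 < ((n + 1 : ℕ) : ℝ) - δ by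
      push_cast; have : (0 : ℝ) ≤ n := n.cast_nonneg; linarith)
    have hG3 := Real.Gamma_pos_of_pos (show 0 < ((n + 1 : ℕ) : ℝ) by positivity)
    have h4 := (hder.comp hSlim).inv₀ (by positivity)
    rw [inv_div] at h4
    refine h4.congr' ?_
    filter_upwards [hlt1] with ε hε
    obtain ⟨h2, h3⟩ := hS ε hε.1 hε.2
    simp only [Function.comp_apply, h3]
    field_simp

end Outage

/-! ### Chi-squared signals against stable interference -/

/-- Cumulative distribution function of the chi-squared distribution with `L` complex degrees of
freedom. -/
lemma gammaMeasure_Iio (n : ℕ) {x : ℝ} (hx : 0 ≤ x) :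
    gammaMeasure (n + 1 : ℕ) 1 (Set.Iio x) = ENNReal.ofReal
      (1 - Real.exp (-x) * ∑ k ∈ Finset.range (n + 1), (k.factorial : ℝ)⁻¹ * x ^ k) := by
  -- Differentiation telescopes the partial exponential sum, leaving only the top term, the density.
  have hder (y : ℝ) : HasDerivAt (fun x : ℝ => 1 - Real.exp (-x) *
      ∑ k ∈ Finset.range (n + 1), (k.factorial : ℝ)⁻¹ * x ^ k)
      ((n.factorial : ℝ)⁻¹ * (Real.exp (-y) * y ^ n)) y := by
    induction n with
    | zero =>
      simpa using (hasDerivAt_neg y).exp.const_sub 1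
    | succ n ih =>
      have h1 := ((hasDerivAt_neg y).exp.mul
        ((hasDerivAt_pow (n + 1) y).const_mul ((n + 1).factorial : ℝ)⁻¹))
      have h2 := ih.sub h1
      convert! h2 using 1
      · ext z
        simp only [Pi.sub_apply, Pi.mul_apply]
        rw [Finset.sum_range_succ]
        ring
      · rw [Nat.factorial_succ, Nat.add_sub_cancel]
        push_cast
        field_simp
        ring
  have hcont : Continuous fun y : ℝ => (n.factorial : ℝ)⁻¹ * (Real.exp (-y) * y ^ n) := by
    fun_prop
  have h3 := intervalIntegral.integral_eq_sub_of_hasDerivAt (a := 0) (b := x)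
    (fun y _ => hder y) (hcont.intervalIntegrable 0 x)
  have hzero : ∑ k ∈ Finset.range (n + 1), (k.factorial : ℝ)⁻¹ * (0 : ℝ) ^ k = 1 := by
    simp [Finset.sum_range_succ']
  rw [hzero, neg_zero, Real.exp_zero, one_mul, sub_self, sub_zero,
    intervalIntegral.integral_of_le hx, integral_Ioc_eq_integral_Ioo] at h3
  rw [← h3, ← lintegral_indicator_one measurableSet_Iio,
    lintegral_gammaMeasure _ _ (measurable_one.indicator measurableSet_Iio),
    ofReal_integral_eq_lintegral_ofReal
      ((hcont.continuousOn.integrableOn_Icc).mono_set Set.Ioo_subset_Icc_self)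
      ((ae_restrict_iff' measurableSet_Ioo).2 (Eventually.of_forall fun y hy => by
        have : (0 : ℝ) < y := hy.1
        simp only [Pi.zero_apply]
        positivity)), ← lintegral_indicator measurableSet_Ioi,
    ← lintegral_indicator measurableSet_Ioo]
  refine lintegral_congr fun q => ?_
  by_cases hq : 0 < q
  · by_cases hqx : q < x
    · rw [Set.indicator_of_mem (show q ∈ Set.Ioi 0 from hq), Set.indicator_of_mem
        (show q ∈ Set.Iio x from hqx), Set.indicator_of_mem (show q ∈ Set.Ioo 0 x from ⟨hq, hqx⟩),
        gammaPDF_of_nonneg hq.le, Pi.one_apply, mul_one]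
      push_cast
      rw [Real.Gamma_nat_eq_factorial, Real.one_rpow, add_sub_cancel_right, Real.rpow_natCast,
        one_mul]
      congr 1
      ring
    · rw [Set.indicator_of_mem (show q ∈ Set.Ioi 0 from hq), Set.indicator_of_notMem
        (show q ∉ Set.Iio x from hqx), Set.indicator_of_notMem (fun h => hqx h.2), mul_zero]
  · rw [Set.indicator_of_notMem (show q ∉ Set.Ioi 0 from hq),
      Set.indicator_of_notMem (fun h => hq h.1)]

section Stable

variable {δ c : ℝ}

/-- Moments of the exponentially tilted positive stable distribution. -/
lemma integral_pow_mul_exp_of_stable {ν : Measure ℝ} [IsProbabilityMeasure ν]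
    (hν : ∀ᵐ x ∂ν, 0 ≤ x)
    (hmgf : ∀ u, 0 < u → mgf id ν (-u) = Real.exp (-(c * u ^ δ))) (k : ℕ) {u : ℝ} (hu : 0 < u) :
    u ^ k * ∫ x, x ^ k * Real.exp (-u * x) ∂ν =
      (stablePoly δ k).eval (c * u ^ δ) * Real.exp (-(c * u ^ δ)) := by
  -- Nonnegativity makes the moment generating function smooth on the negative half-line, with
  -- tilted moments as derivatives.
  have hset : Set.Iio 0 ⊆ interior (integrableExpSet id ν) := by
    rw [isOpen_Iio.subset_interior_iff]
    intro t ht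
    refine Integrable.of_bound (C := 1) (by fun_prop) ?_
    filter_upwards [hν] with x hx
    rw [Real.norm_eq_abs, abs_of_pos (Real.exp_pos _), Real.exp_le_one_iff]
    exact mul_nonpos_of_nonpos_of_nonneg (Set.mem_Iio.1 ht).le hx
  induction k generalizing u with
  | zero =>
    have := hmgf u hu
    simp only [mgf, id] at this
    rw [stablePoly, ← this]
    simp
  | succ k ih =>
    have hmem : -u ∈ interior (integrableExpSet id ν) := hset (by simpa using hu)
    have h1 := hasDerivAt_iteratedDeriv_mgf hmem k
    have h2 := h1.comp u (hasDerivAt_neg u)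
    have h3 : (iteratedDeriv k (mgf id ν) ∘ fun x => -x) =ᶠ[𝓝 u] fun u =>
        (stablePoly δ k).eval (c * u ^ δ) * Real.exp (-(c * u ^ δ)) / u ^ k := by
      filter_upwards [lt_mem_nhds hu] with w hw
      have hwm : -w ∈ interior (integrableExpSet id ν) := hset (by simpa using hw)
      rw [Function.comp_apply, iteratedDeriv_mgf hwm, eq_div_iff (by positivity), ← ih hw, mul_comm]
      simp
    have h4 := h2.congr_of_eventuallyEq h3.symm
    have h5 : HasDerivAt (fun u : ℝ => c * u ^ δ) (c * (δ * u ^ (δ - 1))) u :=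
      (Real.hasDerivAt_rpow_const (.inl hu.ne')).const_mul c
    have h6 := ((((stablePoly δ k).hasDerivAt (c * u ^ δ)).comp u h5).mul h5.neg.exp).div
      (hasDerivAt_pow k u) (by positivity)
    have h7 := h4.unique h6
    simp only [id] at h7
    have h8 : u ^ (δ - 1) = u ^ δ / u := by rw [Real.rpow_sub hu, Real.rpow_one]
    have h9 : ∫ x, x ^ (k + 1) * Real.exp (-u * x) ∂ν = -((∫ x, x ^ (k + 1) *
      Real.exp (-u * x) ∂ν) * -1) := by ring
    rw [h9, h7, stablePoly, h8]
    simp only [Polynomial.eval_add, Polynomial.eval_smul, Polynomial.eval_mul, Polynomial.eval_X,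
      Polynomial.eval_sub, smul_eq_mul, Function.comp_apply, Pi.mul_apply, Pi.neg_apply]
    -- The derivative of `u ^ k` contains the truncated exponent `k - 1`, so `k = 0` is treated
    -- separately.
    rcases k with _ | k
    · field_simp
      simp
      ring
    · rw [Nat.add_sub_cancel]
      field_simp
      ring

lemma measurable_gammaMeasure_setOf (a r t : ℝ) : Measurable fun v : ℝ≥0∞ =>
    gammaMeasure a r {q | ENNReal.ofReal q < ENNReal.ofReal t * v} := by
  have : SFinite (gammaMeasure a r) := by unfold gammaMeasure; infer_instance
  have hs : MeasurableSet {p : ℝ≥0∞ × ℝ | ENNReal.ofReal p.2 < ENNReal.ofReal t * p.1} :=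
    measurableSet_lt (by fun_prop) (by fun_prop)
  exact measurable_measure_prodMk_left hs

/-- The outage probability of a link with chi-squared signal fading when the interference has a
stable Laplace transform. -/
lemma lintegral_gammaMeasure_of_laplace {μ : Measure ℝ≥0∞} [IsProbabilityMeasure μ]
    (h0 : 0 < δ) (hlap : ∀ u, 0 < u →
      ∫⁻ v, expNeg (ENNReal.ofReal u * v) ∂μ = ENNReal.ofReal (Real.exp (-(c * u ^ δ))))
    {t : ℝ} (ht : 0 < t) (n : ℕ) :
    ∫⁻ v, gammaMeasure (n + 1 : ℕ) 1 {q | ENNReal.ofReal q < ENNReal.ofReal t * v} ∂μ =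
      ENNReal.ofReal (outageFn δ (n + 1) (c * t ^ δ)) := by
  -- As `u` decreases to `0`, `exp (-u v)` tends to the indicator of `v < ∞`, while the prescribed
  -- transform tends to `1`. Hence there is no mass at `∞`, and the problem moves to the real line.
  have hfin : ∀ᵐ v ∂μ, v ≠ ∞ := by
    have hb : Tendsto (fun n : ℕ => 1 / ((n : ℝ) + 1)) atTop (𝓝 0) :=
      tendsto_one_div_add_atTop_nhds_zero_nat
    have h1 : Tendsto (fun n : ℕ => ∫⁻ v, expNeg (ENNReal.ofReal (1 / ((n : ℝ) + 1)) * v) ∂μ) atTop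
        (𝓝 (∫⁻ v, ({∞}ᶜ : Set ℝ≥0∞).indicator 1 v ∂μ)) := by
      refine tendsto_lintegral_of_dominated_convergence 1 (fun n => by fun_prop)
        (fun n => Eventually.of_forall fun v => expNeg_le_one _) (by simp)
        (Eventually.of_forall fun v => ?_)
      rcases eq_or_ne v ∞ with rfl | hv
      · have (n : ℕ) : ENNReal.ofReal (1 / ((n : ℝ) + 1)) * ∞ = ∞ :=
          ENNReal.mul_top (ENNReal.ofReal_pos.2 (by positivity)).ne'
        simp_rw [this]
        simp
      · have h2 := ENNReal.Tendsto.mul_const (ENNReal.tendsto_ofReal hb) (.inr hv)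
        have h3 := (continuous_expNeg.tendsto _).comp h2
        rw [ENNReal.ofReal_zero, zero_mul, expNeg_zero] at h3
        rwa [Set.indicator_of_mem (by simpa using hv)]
    have h2 : Tendsto (fun n : ℕ => ∫⁻ v, expNeg (ENNReal.ofReal (1 / ((n : ℝ) + 1)) * v) ∂μ) atTop
        (𝓝 1) := by
      simp_rw [fun n : ℕ => hlap (1 / ((n : ℝ) + 1)) (by positivity)]
      have h3 : Tendsto (fun n : ℕ => Real.exp (-(c * (1 / ((n : ℝ) + 1)) ^ δ))) atTop (𝓝 1) := by
        have h4 := hb.rpow_const (p := δ) (.inr h0.le)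
        rw [Real.zero_rpow h0.ne'] at h4
        have h5 := (Real.continuous_exp.tendsto _).comp (h4.const_mul c).neg
        rwa [mul_zero, neg_zero, Real.exp_zero] at h5
      simpa using ENNReal.tendsto_ofReal h3
    have h3 := tendsto_nhds_unique h1 h2
    rw [lintegral_indicator_one (measurableSet_singleton _).compl] at h3
    have := (prob_compl_eq_zero_iff (measurableSet_singleton (∞ : ℝ≥0∞)).compl).2 h3
    rw [compl_compl] at this
    exact measure_eq_zero_iff_ae_notMem.1 this
  set ν : Measure ℝ := μ.map ENNReal.toReal with hν
  have : IsProbabilityMeasure ν := Measure.isProbabilityMeasure_map (by fun_prop)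
  have hν0 : ∀ᵐ x ∂ν, 0 ≤ x := by
    rw [hν, ae_map_iff (by fun_prop) measurableSet_Ici]
    exact Eventually.of_forall fun v => ENNReal.toReal_nonneg
  have hint (k : ℕ) {u : ℝ} (hu : 0 < u) :
      Integrable (fun x : ℝ => x ^ k * Real.exp (-u * x)) ν := by
    have hset : -u ∈ interior (integrableExpSet id ν) := by
      refine (isOpen_Iio.subset_interior_iff.2 fun t ht => ?_) (show -u ∈ Set.Iio 0 by simpa)
      refine Integrable.of_bound (C := 1) (by fun_prop) ?_
      filter_upwards [hν0] with x hx
      rw [Real.norm_eq_abs, abs_of_pos (Real.exp_pos _), Real.exp_le_one_iff]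
      exact mul_nonpos_of_nonpos_of_nonneg (Set.mem_Iio.1 ht).le hx
    exact integrable_pow_mul_exp_of_mem_interior_integrableExpSet hset k
  have hmgf (u : ℝ) (hu : 0 < u) : mgf id ν (-u) = Real.exp (-(c * u ^ δ)) := by
    rw [mgf, integral_eq_lintegral_of_nonneg_ae
      (Eventually.of_forall fun x => (Real.exp_pos _).le) (by fun_prop), hν,
      lintegral_map (by fun_prop) (by fun_prop),
      ← ENNReal.toReal_ofReal (Real.exp_pos (-(c * u ^ δ))).le, ← hlap u hu]
    congr 1
    refine lintegral_congr_ae ?_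
    filter_upwards [hfin] with v hv
    lift v to ℝ≥0 using hv
    rw [← ENNReal.ofReal_coe_nnreal, ← ENNReal.ofReal_mul hu.le, expNeg_ofReal (by positivity)]
    simp
  have key (v : ℝ≥0∞) (hv : v ≠ ∞) :
      gammaMeasure (n + 1 : ℕ) 1 {q | ENNReal.ofReal q < ENNReal.ofReal t * v} =
      ENNReal.ofReal (1 - ∑ k ∈ Finset.range (n + 1), (k.factorial : ℝ)⁻¹ * (t ^ k *
        (v.toReal ^ k * Real.exp (-t * v.toReal)))) := by
    lift v to ℝ≥0 using hv
    -- At `v = 0` truncation by `ENNReal.ofReal` makes the set empty rather than the negative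
    -- half-line.
    have h1 : {q | ENNReal.ofReal q < ENNReal.ofReal t * v} = Set.Iio (t * (v : ℝ)) ∨
        {q | ENNReal.ofReal q < ENNReal.ofReal t * v} = ∅ ∧ v = 0 := by
      rcases eq_or_ne v 0 with rfl | hv0
      · right; simp
      · left
        ext q
        rw [Set.mem_ofPred_eq, ← ENNReal.ofReal_coe_nnreal, ← ENNReal.ofReal_mul ht.le,
          ENNReal.ofReal_lt_ofReal_iff (by positivity), Set.mem_Iio]
    rcases h1 with h1 | ⟨h1, rfl⟩
    · rw [h1, gammaMeasure_Iio n (by positivity), Finset.mul_sum]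
      congr 2
      refine Finset.sum_congr rfl fun k _ => ?_
      rw [ENNReal.coe_toReal, mul_pow, neg_mul]
      ring
    · rw [h1]
      simp [Finset.sum_range_succ']
  have hI : Integrable (fun x : ℝ => 1 - ∑ k ∈ Finset.range (n + 1), (k.factorial : ℝ)⁻¹ *
      (t ^ k * (x ^ k * Real.exp (-t * x)))) ν :=
    (integrable_const _).sub (integrable_finsetSum _ fun k _ =>
      ((hint k ht).const_mul _).const_mul _)
  have hnn : ∀ᵐ x ∂ν, 0 ≤ 1 - ∑ k ∈ Finset.range (n + 1), (k.factorial : ℝ)⁻¹ *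
      (t ^ k * (x ^ k * Real.exp (-t * x))) := by
    filter_upwards [hν0] with x hx
    have h1 := Real.sum_le_exp_of_nonneg (mul_nonneg ht.le hx) (n + 1)
    have h2 : ∑ k ∈ Finset.range (n + 1), (k.factorial : ℝ)⁻¹ *
      (t ^ k * (x ^ k * Real.exp (-t * x))) =
      (∑ k ∈ Finset.range (n + 1), (t * x) ^ k / k.factorial) * Real.exp (-(t * x)) := by
      rw [Finset.sum_mul]
      refine Finset.sum_congr rfl fun k _ => ?_
      rw [mul_pow, neg_mul]
      field_simp
    rw [h2, sub_nonneg]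
    refine (mul_le_mul_of_nonneg_right h1 (Real.exp_pos _).le).trans ?_
    rw [← Real.exp_add, add_neg_cancel, Real.exp_zero]
  rw [lintegral_congr_ae (hfin.mono key), ← lintegral_map (f := fun x : ℝ => ENNReal.ofReal
    (1 - ∑ k ∈ Finset.range (n + 1), (k.factorial : ℝ)⁻¹ * (t ^ k * (x ^ k * Real.exp (-t * x)))))
    (by fun_prop) ENNReal.measurable_toReal, ← hν, ← ofReal_integral_eq_lintegral_ofReal hI hnn,
    integral_sub (integrable_const _) (integrable_finsetSum _ fun k _ =>
      ((hint k ht).const_mul _).const_mul _), integral_finsetSum _ fun k _ =>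
      ((hint k ht).const_mul _).const_mul _]
  simp_rw [integral_const_mul, integral_pow_mul_exp_of_stable hν0 hmgf _ ht]
  rw [outageFn, successPoly, Polynomial.eval_finsetSum, Finset.mul_sum]
  congr 2
  · simp
  · refine Finset.sum_congr rfl fun k _ => ?_
    rw [Polynomial.eval_smul, smul_eq_mul]
    ring

/-- The Palm probability of an outage when the Palm distribution of the interference has a stable
Laplace transform. -/
lemma typicalProb_eq_outageFn {Ω : Type*} [MeasurableSpace Ω] {P : Measure Ω}
    {X : ℕ → Ω → Plane} {C D : ℕ → Set Ω} {I : ℕ → Ω → ℝ≥0∞} (hI : ∀ i, Measurable (I i))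
    {m : ℝ≥0∞} (hm0 : m ≠ 0) (hm : m ≠ ∞)
    (hmass : ∑' i, P ({ω | X i ω ∈ unitSquare} ∩ C i) = m) {t : ℝ} (ht : 0 < t) (n : ℕ)
    (hD : ∀ i, P ({ω | X i ω ∈ unitSquare} ∩ C i ∩ D i) =
      ∫⁻ ω in {ω | X i ω ∈ unitSquare} ∩ C i,
        gammaMeasure (n + 1 : ℕ) 1 {q | ENNReal.ofReal q < ENNReal.ofReal t * I i ω} ∂P)
    (h0 : 0 < δ) (hlap : ∀ u, 0 < u →
      ∑' i, ∫⁻ ω in {ω | X i ω ∈ unitSquare} ∩ C i, expNeg (ENNReal.ofReal u * I i ω) ∂P =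
        m * ENNReal.ofReal (Real.exp (-(c * u ^ δ)))) :
    typicalProb P X C D = ENNReal.ofReal (outageFn δ (n + 1) (c * t ^ δ)) := by
  -- This is the Palm distribution of the interference, normalized by the expected number `m` of
  -- reference points.
  set μ : Measure ℝ≥0∞ := m⁻¹ • Measure.sum fun i =>
    (P.restrict ({ω | X i ω ∈ unitSquare} ∩ C i)).map (I i) with hμ
  have hint {f : ℝ≥0∞ → ℝ≥0∞} (hf : Measurable f) : ∫⁻ v, f v ∂μ =
      (∑' i, ∫⁻ ω in {ω | X i ω ∈ unitSquare} ∩ C i, f (I i ω) ∂P) / m := by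
    rw [hμ, lintegral_smul_measure, lintegral_sum_measure, smul_eq_mul, mul_comm, div_eq_mul_inv]
    congr 1
    exact tsum_congr fun i => lintegral_map hf (hI i)
  have : IsProbabilityMeasure μ := by
    constructor
    rw [← lintegral_one, hint measurable_const]
    simp_rw [lintegral_const, Measure.restrict_apply_univ, one_mul]
    rw [hmass, ENNReal.div_self hm0 hm]
  rw [← lintegral_gammaMeasure_of_laplace (μ := μ) h0 (fun u hu => ?_) ht n,
    hint (measurable_gammaMeasure_setOf _ _ _), typicalProb, hmass]
  · rw [tsum_congr hD]
  · rw [hint (by fun_prop), hlap u hu, mul_comm, mul_div_assoc, ENNReal.div_self hm0 hm, mul_one]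

end Stable

/-! ### Conditioning on everything but the signal gain -/

/-- Resampling one coordinate of a product measure preserves it. -/
lemma measurePreserving_update_infinitePi {ι : Type*} [DecidableEq ι] {X : ι → Type*}
    [∀ i, MeasurableSpace (X i)] (μ : ∀ i, Measure (X i)) [∀ i, IsProbabilityMeasure (μ i)]
    (s : ι) : MeasurePreserving (fun p : (∀ i, X i) × X s => Function.update p.1 s p.2)
      ((Measure.infinitePi μ).prod (μ s)) (Measure.infinitePi μ) := by
  have hm : Measurable fun p : (∀ i, X i) × X s => Function.update p.1 s p.2 := by
    refine measurable_pi_iff.2 fun i => ?_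
    by_cases h : i = s
    · subst h
      simpa using measurable_snd
    · simp only [Function.update_of_ne h]
      fun_prop
  refine ⟨hm, Measure.eq_infinitePi μ fun S t ht => ?_⟩
  rw [Measure.map_apply hm (.pi S.countable_toSet fun i _ => ht i)]
  by_cases hs : s ∈ S
  · have : (fun p : (∀ i, X i) × X s => Function.update p.1 s p.2) ⁻¹' (Set.pi S t) =
        (Set.pi (S.erase s) t) ×ˢ (t s) := by
      ext p
      simp only [Set.mem_preimage, Set.mem_pi, Set.mem_prod, Finset.coe_erase]
      constructor
      · refine fun h => ⟨fun i hi => ?_, by simpa using h s hs⟩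
        have := h i hi.1
        rwa [Function.update_of_ne (by simpa using hi.2)] at this
      · rintro ⟨h1, h2⟩ i hi
        by_cases his : i = s
        · subst his; simpa using h2
        · rw [Function.update_of_ne his]
          exact h1 i ⟨hi, by simpa using his⟩
    rw [this, Measure.prod_prod, Measure.infinitePi_pi μ fun i _ => ht i,
      Finset.prod_erase_mul _ _ hs]
  · have : (fun p : (∀ i, X i) × X s => Function.update p.1 s p.2) ⁻¹' (Set.pi S t) =
        (Set.pi S t) ×ˢ Set.univ := by
      ext p
      simp only [Set.mem_preimage, Set.mem_pi, Set.mem_prod, Set.mem_univ, and_true]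
      refine forall₂_congr fun i hi => ?_
      rw [Function.update_of_ne (fun h => hs (by rwa [← h]))]
    rw [this, Measure.prod_prod, Measure.infinitePi_pi μ fun i _ => ht i]
    simp

/-- Used repeatedly, this carries resampling of the last factor of a nested product out to the whole
product. -/
lemma MeasureTheory.MeasurePreserving.prodMk_resample {α β γ : Type*} [MeasurableSpace α]
    [MeasurableSpace β] [MeasurableSpace γ] {μa : Measure α} {μb : Measure β} {μc : Measure γ}
    [SFinite μa] [SFinite μb] [SFinite μc] {f : β × γ → β}
    (hf : MeasurePreserving f (μb.prod μc) μb) :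
    MeasurePreserving (fun p : (α × β) × γ => (p.1.1, f (p.1.2, p.2)))
      ((μa.prod μb).prod μc) (μa.prod μb) :=
  ((MeasurePreserving.id μa).prod hf).comp (measurePreserving_prodAssoc μa μb μc)

/-- The probability that a link is in outage, by conditioning on everything but the fading gain of
the signal. -/
lemma measure_inter_outage {Ω : Type*} [MeasurableSpace Ω] {P : Measure Ω} [SFinite P] {n : ℕ}
    {U : Ω × ℝ → Ω} (hU : MeasurePreserving U (P.prod (gammaMeasure (n + 1 : ℕ) 1)) P)
    {S : Set Ω} (hS : MeasurableSet S) (hUS : ∀ ω q, U (ω, q) ∈ S ↔ ω ∈ S)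
    {sig : Ω → ℝ} (hsig : Measurable sig) (hUsig : ∀ ω q, sig (U (ω, q)) = q)
    {I : Ω → ℝ≥0∞} (hI : Measurable I) (hUI : ∀ ω q, I (U (ω, q)) = I ω)
    {c θ : ℝ} (hc : 0 < c) :
    P (S ∩ {ω | ENNReal.ofReal (c * sig ω) / I ω < ENNReal.ofReal θ}) =
      ∫⁻ ω in S, gammaMeasure (n + 1 : ℕ) 1
        {q | ENNReal.ofReal q < ENNReal.ofReal (θ / c) * I ω} ∂P := by
  -- With zero signal and zero interference the convention `0 / 0 = 0` would count as an outage on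
  -- the left but not on the right; positivity excludes this.
  have hpos : ∀ᵐ q ∂(gammaMeasure (n + 1 : ℕ) 1), 0 < q := by
    have h : gammaMeasure (n + 1 : ℕ) 1 (Set.Iic 0) = 0 := by
      rw [← lintegral_indicator_one measurableSet_Iic,
        lintegral_gammaMeasure _ _ (measurable_one.indicator measurableSet_Iic),
        setLIntegral_congr_fun (g := fun _ => 0) measurableSet_Ioi]
      · simp
      · intro q hq
        simp only
        rw [Set.indicator_of_notMem (by simpa using hq), mul_zero]
    have := measure_eq_zero_iff_ae_notMem.1 h
    filter_upwards [this] with q hq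
    simpa using hq
  have : SFinite (gammaMeasure (n + 1 : ℕ) 1) := by unfold gammaMeasure; infer_instance
  have hD : MeasurableSet (S ∩ {ω | ENNReal.ofReal (c * sig ω) / I ω < ENNReal.ofReal θ}) :=
    hS.inter (measurableSet_lt (by fun_prop) measurable_const)
  rw [← hU.measure_preimage hD.nullMeasurableSet, Measure.prod_apply (hU.measurable hD),
    ← lintegral_indicator hS]
  refine lintegral_congr fun ω => ?_
  by_cases hω : ω ∈ S
  · rw [Set.indicator_of_mem hω]
    refine measure_congr ?_
    filter_upwards [hpos] with q hq
    refine propext ?_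
    change U (ω, q) ∈ S ∩ {ω | ENNReal.ofReal (c * sig ω) / I ω < ENNReal.ofReal θ} ↔
      ENNReal.ofReal q < ENNReal.ofReal (θ / c) * I ω
    rw [Set.mem_inter_iff, hUS, Set.mem_ofPred_eq, hUsig, hUI]
    have hcq : ENNReal.ofReal (c * q) ≠ 0 := (ENNReal.ofReal_pos.2 (by positivity)).ne'
    rw [ENNReal.div_lt_iff (.inr hcq) (.inr ENNReal.ofReal_ne_top), ENNReal.ofReal_mul hc.le,
      ENNReal.ofReal_div_of_pos hc, mul_comm (ENNReal.ofReal c), ← ENNReal.mul_div_right_comm,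
      ENNReal.lt_div_iff_mul_lt (.inl (ENNReal.ofReal_pos.2 hc).ne')
        (.inl ENNReal.ofReal_ne_top)]
    simp [hω]
  · rw [Set.indicator_of_notMem hω, ← measure_empty (μ := gammaMeasure (n + 1 : ℕ) 1)]
    congr 1
    ext q
    simp [hUS, hω]

/-! ### Iterated integrals over the six independent ingredients -/

section IteratedIntegral

variable {A B C D E F : Type*} [MeasurableSpace A] [MeasurableSpace B] [MeasurableSpace C]
  [MeasurableSpace D] [MeasurableSpace E] [MeasurableSpace F] {a : Measure A} {b : Measure B}
  {c : Measure C} {d : Measure D} {e : Measure E} {f : Measure F} [SFinite b]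
  [SFinite c] [SFinite d] [SFinite e] [SFinite f]

lemma lintegral_prod_six {g : A × B × C × D × E × F → ℝ≥0∞} (hg : Measurable g) :
    ∫⁻ ω, g ω ∂(a.prod (b.prod (c.prod (d.prod (e.prod f))))) =
      ∫⁻ x, ∫⁻ y, ∫⁻ z, ∫⁻ w, ∫⁻ t, ∫⁻ s, g (x, y, z, w, t, s) ∂f ∂e ∂d ∂c ∂b ∂a := by
  rw [lintegral_prod _ hg.aemeasurable]
  refine lintegral_congr fun x => ?_
  rw [lintegral_prod _ (by fun_prop)]
  refine lintegral_congr fun y => ?_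
  rw [lintegral_prod _ (by fun_prop)]
  refine lintegral_congr fun z => ?_
  rw [lintegral_prod _ (by fun_prop)]
  refine lintegral_congr fun w => ?_
  rw [lintegral_prod _ (by fun_prop)]

/-- For ad hoc links the displacements `w` must come outermost, so that Mecke's formula for the
transmitters `y` applies at a fixed displacement. Base stations `x` and users `z` come inside, where
the receiver is already fixed. -/
lemma lintegral_prod_six_reorder [SFinite a] {g : A × B × C × D × E × F → ℝ≥0∞} (hg : Measurable g) :
    ∫⁻ ω, g ω ∂(a.prod (b.prod (c.prod (d.prod (e.prod f))))) =
      ∫⁻ w, ∫⁻ y, ∫⁻ x, ∫⁻ z, ∫⁻ t, ∫⁻ s, g (x, y, z, w, t, s) ∂f ∂e ∂c ∂a ∂b ∂d := by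
  rw [lintegral_prod_six hg]
  set G : A → B → C → D → ℝ≥0∞ := fun x y z w => ∫⁻ t, ∫⁻ s, g (x, y, z, w, t, s) ∂f ∂e with hG
  have hGm : Measurable fun p : A × B × C × D => G p.1 p.2.1 p.2.2.1 p.2.2.2 := by
    refine Measurable.lintegral_prod_right' (f := fun q : (A × B × C × D) × E =>
      ∫⁻ s, g (q.1.1, q.1.2.1, q.1.2.2.1, q.1.2.2.2, q.2, s) ∂f) ?_
    exact Measurable.lintegral_prod_right' (f := fun q : ((A × B × C × D) × E) × F =>
      g (q.1.1.1, q.1.1.2.1, q.1.1.2.2.1, q.1.1.2.2.2, q.1.2, q.2)) (by fun_prop)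
  have hGz : Measurable fun p : A × B × D => ∫⁻ z, G p.1 p.2.1 z p.2.2 ∂c :=
    Measurable.lintegral_prod_right' (f := fun q : (A × B × D) × C =>
      G q.1.1 q.1.2.1 q.2 q.1.2.2)
      (hGm.comp (g := fun p : A × B × C × D => G p.1 p.2.1 p.2.2.1 p.2.2.2)
        (f := fun q : (A × B × D) × C => (q.1.1, q.1.2.1, q.2, q.1.2.2)) (by fun_prop))
  have hGyz : Measurable fun p : A × D => ∫⁻ y, ∫⁻ z, G p.1 y z p.2 ∂c ∂b :=
    Measurable.lintegral_prod_right' (f := fun q : (A × D) × B => ∫⁻ z, G q.1.1 q.2 z q.1.2 ∂c)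
      (hGz.comp (g := fun p : A × B × D => ∫⁻ z, G p.1 p.2.1 z p.2.2 ∂c)
        (f := fun q : (A × D) × B => (q.1.1, q.2, q.1.2)) (by fun_prop))
  calc ∫⁻ x, ∫⁻ y, ∫⁻ z, ∫⁻ w, G x y z w ∂d ∂c ∂b ∂a
      = ∫⁻ x, ∫⁻ y, ∫⁻ w, ∫⁻ z, G x y z w ∂c ∂d ∂b ∂a := by
        refine lintegral_congr fun x => lintegral_congr fun y => ?_
        refine lintegral_lintegral_swap (Measurable.aemeasurable ?_)
        exact hGm.comp (f := fun q : C × D => (x, y, q.1, q.2)) (by fun_prop)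
    _ = ∫⁻ x, ∫⁻ w, ∫⁻ y, ∫⁻ z, G x y z w ∂c ∂b ∂d ∂a := by
        refine lintegral_congr fun x => ?_
        refine lintegral_lintegral_swap (Measurable.aemeasurable ?_)
        exact hGz.comp (f := fun q : B × D => (x, q.1, q.2)) (by fun_prop)
    _ = ∫⁻ w, ∫⁻ x, ∫⁻ y, ∫⁻ z, G x y z w ∂c ∂b ∂a ∂d :=
        lintegral_lintegral_swap hGyz.aemeasurable
    _ = ∫⁻ w, ∫⁻ y, ∫⁻ x, ∫⁻ z, G x y z w ∂c ∂a ∂b ∂d := by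
        refine lintegral_congr fun w => ?_
        refine lintegral_lintegral_swap (Measurable.aemeasurable ?_)
        exact hGz.comp (f := fun q : A × B => (q.1, q.2, w)) (by fun_prop)

end IteratedIntegral

/-! ### The reduced Mecke formula and random channel selection -/

/-- The reduced Slivnyak-Mecke formula for a homogeneous Poisson point process. -/
lemma IsHomogeneousPPP.tsum_lintegral_mul_tprod_ite {l : ℝ} {Φ : Measure (ℕ → Plane)}
    (h : IsHomogeneousPPP l Φ) {g : Plane → ℝ≥0∞} (hg : Continuous g) (hg1 : ∀ v, g v ≤ 1)
    (hg0 : g 0 ≠ 0) {H : Plane → ℝ≥0∞} (hH : Measurable H) (hHfin : ∫⁻ v, H v ≠ ∞)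
    (hgH : ∀ v w, ‖w‖ ≤ 4 → 1 - g (v - w) ≤ H v) :
    ∑' i, ∫⁻ x, unitSquare.indicator 1 (x i) *
        ∏' j, (if j = i then 1 else g (x j - x i)) ∂Φ =
      ENNReal.ofReal l * expNeg (ENNReal.ofReal l * ∫⁻ v, 1 - g v) := by
  have h1 := h.tsum_lintegral_mul_tprod hg hg1 hH hHfin hgH
  have hgt : g 0 ≠ ∞ := ((hg1 0).trans_lt ENNReal.one_lt_top).ne
  have h2 (i : ℕ) : ∫⁻ x, unitSquare.indicator 1 (x i) * ∏' j, g (x j - x i) ∂Φ =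
      g 0 * ∫⁻ x, unitSquare.indicator 1 (x i) *
        ∏' j, (if j = i then 1 else g (x j - x i)) ∂Φ := by
    rw [← lintegral_const_mul' _ _ hgt]
    refine lintegral_congr fun x => ?_
    -- The reference point contributes exactly `g 0`, which is nonzero and finite and cancels at the
    -- end.
    rw [ENNReal.tprod_eq_mul_tprod_ite (fun j => hg1 _) i, sub_self, mul_left_comm]
  simp_rw [h2, ENNReal.tsum_mul_left] at h1
  rw [mul_right_comm, mul_comm _ (g 0)] at h1
  exact (ENNReal.mul_right_inj hg0 hgt).1 h1

/-- The average over the channel of a factor that is present with probability `p`. -/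
def thinned (p a : ℝ≥0∞) : ℝ≥0∞ := 1 - p + p * a

section Thinned

variable {p a : ℝ≥0∞}

lemma thinned_le_one (hp : p ≤ 1) (ha : a ≤ 1) : thinned p a ≤ 1 := by
  calc thinned p a ≤ 1 - p + p * 1 := by unfold thinned; gcongr
    _ = 1 := by rw [mul_one, tsub_add_cancel_of_le hp]

lemma one_sub_thinned (hp : p ≤ 1) (ha : a ≤ 1) : 1 - thinned p a = p * (1 - a) := by
  have hpt : p ≠ ∞ := (hp.trans_lt ENNReal.one_lt_top).ne
  have hat : a ≠ ∞ := (ha.trans_lt ENNReal.one_lt_top).ne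
  have h : 1 = p * (1 - a) + thinned p a := by
    rw [thinned, ENNReal.mul_sub (fun _ _ => hpt), mul_one, add_left_comm,
      tsub_add_cancel_of_le (mul_le_of_le_one_right' ha), tsub_add_cancel_of_le hp]
  refine ENNReal.sub_eq_of_eq_add ?_ h
  exact ((thinned_le_one hp ha).trans_lt ENNReal.one_lt_top).ne

lemma thinned_ne_zero (ha : a ≠ 0) : thinned p a ≠ 0 := by
  intro h
  rw [thinned, add_eq_zero, tsub_eq_zero_iff_le, mul_eq_zero] at h
  rcases h.2 with h2 | h2
  · rw [h2] at h
    simp at h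
  · exact ha h2

lemma continuous_thinned (hp : p ≤ 1) : Continuous (thinned p) :=
  continuous_const.add
    (ENNReal.continuous_const_mul (hp.trans_lt ENNReal.one_lt_top).ne)

variable {K : ℕ} (κ : Measure (Fin K)) [IsProbabilityMeasure κ] (k : Fin K)

lemma lintegral_ite_eq (a : ℝ≥0∞) :
    ∫⁻ c, (if c = k then a else 1) ∂κ = thinned (κ {k}) a := by
  have h : ∀ c, (if c = k then a else 1) =
      ({k}ᶜ : Set (Fin K)).indicator 1 c + ({k} : Set (Fin K)).indicator 1 c * a := by
    intro c
    by_cases hc : c = k <;> simp [hc]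
  simp_rw [h]
  rw [lintegral_add_left .of_discrete, lintegral_mul_const _ .of_discrete,
    lintegral_indicator_one .of_discrete, lintegral_indicator_one .of_discrete,
    prob_compl_eq_one_sub .of_discrete, thinned]

lemma lintegral_tprod_ite_channel {a : ℕ → ℝ≥0∞} (ha : ∀ j, a j ≤ 1) :
    ∫⁻ t, ∏' j, (if t j = k then a j else 1) ∂(Measure.infinitePi fun _ : ℕ => κ) =
      ∏' j, thinned (κ {k}) (a j) := by
  refine (lintegral_tprod_infinitePi (fun _ : ℕ => κ) (l := id) Function.injective_id
    (f := fun j c => if c = k then a j else 1) (fun j => .of_discrete)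
    (fun j c => by split_ifs; exacts [ha j, le_rfl])).trans ?_
  simp_rw [lintegral_ite_eq]

lemma lintegral_mul_tprod_ite_channel {a : ℕ → ℝ≥0∞} (ha : ∀ j, a j ≤ 1) (i : ℕ) :
    ∫⁻ t, (if t i = k then 1 else 0) * ∏' j, (if j ≠ i ∧ t j = k then a j else 1)
        ∂(Measure.infinitePi fun _ : ℕ => κ) =
      κ {k} * ∏' j, (if j = i then 1 else thinned (κ {k}) (a j)) := by
  -- The event that `i` selects `k` is absorbed as the `i`-th factor, so the integrand is again a
  -- product over independent coordinates.
  set f : ℕ → Fin K → ℝ≥0∞ := fun j c =>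
    if j = i then (if c = k then 1 else 0) else (if c = k then a j else 1) with hf
  have hf1 (j c) : f j c ≤ 1 := by
    simp only [hf]
    split_ifs
    exacts [le_rfl, zero_le_one, ha j, le_rfl]
  have hfi1 (j) : ∫⁻ c, f j c ∂κ ≤ 1 := by
    simpa using lintegral_mono (μ := κ) (hf1 j)
  have h1 (t : ℕ → Fin K) : (if t i = k then 1 else 0) *
      ∏' j, (if j ≠ i ∧ t j = k then a j else 1) = ∏' j, f j (t j) := by
    rw [ENNReal.tprod_eq_mul_tprod_ite (fun j => hf1 j (t j)) i]
    congr 1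
    · simp [hf]
    · refine tprod_congr fun j => ?_
      by_cases hj : j = i <;> simp [hf, hj]
  simp_rw [h1]
  refine (lintegral_tprod_infinitePi (fun _ : ℕ => κ) (l := id) Function.injective_id
    (f := f) (fun j => .of_discrete) hf1).trans ?_
  rw [ENNReal.tprod_eq_mul_tprod_ite hfi1 i]
  congr 1
  · simp only [hf, if_true]
    rw [← lintegral_indicator_one (measurableSet_singleton k)]
    refine lintegral_congr fun c => ?_
    by_cases hc : c = k <;> simp [hc]
  · refine tprod_congr fun j => ?_
    by_cases hj : j = i
    · simp [hj]
    · simp only [hf, hj, if_false]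
      exact lintegral_ite_eq κ k (a j)

end Thinned

/-! ### Standing assumptions, fading averages and measurability -/

namespace OverlaidNetworks

variable {K : ℕ}

/-- The standing assumptions on the networks. -/
structure Standing (N : OverlaidNetworks K) : Prop where
  two_lt_pathLossExp : 2 < N.pathLossExp
  θ_pos : 0 < N.θ
  d_pos : 0 < N.d
  r_eq_d : N.r = N.d
  one_le_L₁ : 1 ≤ N.L₁
  one_le_L₂ : 1 ≤ N.L₂
  user : ∀ k, IsProbabilityMeasure (N.userShiftLaw k) ∧ ∀ᵐ z ∂(N.userShiftLaw k), ‖z‖ = N.r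
  receiver : IsProbabilityMeasure N.receiverShiftLaw ∧ ∀ᵐ y ∂N.receiverShiftLaw, ‖y‖ = N.d
  base : ∀ l, 0 < l → IsHomogeneousPPP l (N.basePPP l)
  node : ∀ l, 0 < l → IsHomogeneousPPP l (N.nodePPP l)

variable {N : OverlaidNetworks K}

lemma Standing.isProbabilityMeasure_fadingLaw (hN : N.Standing) (l : FadingLink K) :
    IsProbabilityMeasure (N.fadingLaw l) := by
  have h1 : (0 : ℝ) < N.L₁ := by exact_mod_cast hN.one_le_L₁
  have h2 : (0 : ℝ) < N.L₂ := by exact_mod_cast hN.one_le_L₂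
  cases l <;> simp only [fadingLaw]
  exacts [isProbabilityMeasure_gammaMeasure h2 one_pos,
    isProbabilityMeasure_gammaMeasure h1 one_pos, isProbabilityMeasure_expMeasure one_pos,
    isProbabilityMeasure_expMeasure one_pos, isProbabilityMeasure_expMeasure one_pos,
    isProbabilityMeasure_expMeasure one_pos]

/-- The probability that an ad hoc transmitter selects the sub-channel `k`. -/
def channelProb (N : OverlaidNetworks K) (o : OverlayMethod) (k : Fin K) : ℝ≥0∞ :=
  uniformOn (N.accessible o : Set (Fin K)) {k}

/-- Averaging the Laplace functional of the interference over Rayleigh fading. -/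
lemma Standing.lintegral_fading (hN : N.Standing) {l₁ l₂ : ℕ → FadingLink K}
    (hl : Function.Injective (Sum.elim l₁ l₂)) (h₁ : ∀ j, N.fadingLaw (l₁ j) = expMeasure 1)
    (h₂ : ∀ j, N.fadingLaw (l₂ j) = expMeasure 1) (u : ℝ) (c₁ c₂ : ℕ → ℝ≥0∞) :
    ∫⁻ F, expNeg (ENNReal.ofReal u * (∑' j, c₁ j * ENNReal.ofReal (F (l₁ j)) +
        ∑' j, c₂ j * ENNReal.ofReal (F (l₂ j)))) ∂(Measure.infinitePi N.fadingLaw) =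
      (∏' j, (1 + ENNReal.ofReal u * c₁ j)⁻¹) * ∏' j, (1 + ENNReal.ofReal u * c₂ j)⁻¹ := by
  have := hN.isProbabilityMeasure_fadingLaw
  set c := Sum.elim c₁ c₂ with hc
  have hle (b) : (1 + ENNReal.ofReal u * c b)⁻¹ ≤ 1 := by
    rw [ENNReal.inv_le_one]; exact le_self_add
  have h := lintegral_tprod_infinitePi N.fadingLaw hl
    (f := fun b q => expNeg (ENNReal.ofReal u * c b * ENNReal.ofReal q)) (fun b => by fun_prop)
    (fun b q => expNeg_le_one _)
  have h3 (b : ℕ ⊕ ℕ) : ∫⁻ q, expNeg (ENNReal.ofReal u * c b * ENNReal.ofReal q)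
      ∂(N.fadingLaw (Sum.elim l₁ l₂ b)) = (1 + ENNReal.ofReal u * c b)⁻¹ := by
    have : N.fadingLaw (Sum.elim l₁ l₂ b) = expMeasure 1 := by cases b <;> simp [h₁, h₂]
    rw [this, lintegral_expNeg_expMeasure]
  simp_rw [h3] at h
  rw [ENNReal.tprod_sum_of_le_one hle] at h
  refine Eq.trans (lintegral_congr fun F => ?_) h
  rw [← expNeg_tsum, ENNReal.summable.tsum_sum ENNReal.summable]
  simp only [hc, Sum.elim_inl, Sum.elim_inr, mul_assoc]
  rw [ENNReal.tsum_mul_left, ENNReal.tsum_mul_left, ← mul_add]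

lemma inv_one_add_mul_edist_rpow (η u : ℝ) (x y : Plane) :
    (1 + ENNReal.ofReal u * edist x y ^ (-η))⁻¹ = rayleighFactor η u (x - y) := by
  rw [rayleighFactor, edist_eq_enorm_sub]

/-- The interference at the receiver of ad hoc transmitter `i` from mobile users and ad hoc
transmitters on sub-channel `k`. -/
def nodeInterferenceOn (N : OverlaidNetworks K) (ω : NetworkSample K) (i : ℕ) (k : Fin K) :
    ℝ≥0∞ :=
  (if k ∈ N.occupied
    then ∑' j, N.interferencePower (ω.user j k) (ω.receiver i) (ω.fading (.userToNode j i k))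
    else 0) +
  ∑' j, if j ≠ i ∧ ω.channel j = k
    then N.interferencePower (ω.node j) (ω.receiver i) (ω.fading (.nodeToNode j i)) else 0

lemma measurable_interferencePower {Ω : Type*} [MeasurableSpace Ω] {x y : Ω → Plane} {g : Ω → ℝ}
    (hx : Measurable x) (hy : Measurable y) (hg : Measurable g) :
    Measurable fun ω => N.interferencePower (x ω) (y ω) (g ω) := by
  unfold interferencePower
  fun_prop

lemma measurable_base (i : ℕ) : Measurable fun ω : NetworkSample K => ω.base i := by
  unfold NetworkSample.base
  fun_prop

lemma measurable_node (i : ℕ) : Measurable fun ω : NetworkSample K => ω.node i := by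
  unfold NetworkSample.node
  fun_prop

lemma measurable_user (i : ℕ) (k : Fin K) :
    Measurable fun ω : NetworkSample K => ω.user i k := by
  unfold NetworkSample.user NetworkSample.base
  fun_prop

lemma measurable_receiver (i : ℕ) : Measurable fun ω : NetworkSample K => ω.receiver i := by
  unfold NetworkSample.receiver NetworkSample.node
  fun_prop

lemma measurable_channel (i : ℕ) : Measurable fun ω : NetworkSample K => ω.channel i := by
  unfold NetworkSample.channel
  fun_prop

lemma measurable_fading (l : FadingLink K) :
    Measurable fun ω : NetworkSample K => ω.fading l := by
  unfold NetworkSample.fading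
  fun_prop

lemma measurable_baseInterference (i : ℕ) (k : Fin K) :
    Measurable fun ω => N.baseInterference ω i k := by
  unfold baseInterference
  refine Measurable.add (Measurable.tsum fun j => ?_) (Measurable.tsum fun j => ?_)
  · split_ifs
    · exact measurable_const
    · exact measurable_interferencePower (measurable_user j k) (measurable_base i)
        (measurable_fading _)
  · exact Measurable.ite (measurable_channel j (measurableSet_singleton k))
      (measurable_interferencePower (measurable_node j) (measurable_base i) (measurable_fading _))
      measurable_const

lemma measurable_nodeInterferenceOn (i : ℕ) (k : Fin K) :
    Measurable fun ω => N.nodeInterferenceOn ω i k := by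
  unfold nodeInterferenceOn
  refine Measurable.add ?_ (Measurable.tsum fun j => ?_)
  · split_ifs
    · exact Measurable.tsum fun j => measurable_interferencePower (measurable_user j k)
        (measurable_receiver i) (measurable_fading _)
    · exact measurable_const
  · refine Measurable.ite ?_ (measurable_interferencePower (measurable_node j)
      (measurable_receiver i) (measurable_fading _)) measurable_const
    exact (MeasurableSet.const _).inter (measurable_channel j (measurableSet_singleton k))

/-- Resampling one fading gain. -/
def resample (s : FadingLink K) (p : NetworkSample K × ℝ) : NetworkSample K :=
  (p.1.1, p.1.2.1, p.1.2.2.1, p.1.2.2.2.1, p.1.2.2.2.2.1,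
    haveI := Classical.decEq (FadingLink K); Function.update p.1.2.2.2.2.2 s p.2)

lemma fading_resample_self (s : FadingLink K) (ω : NetworkSample K) (q : ℝ) :
    (resample s (ω, q)).fading s = q := by
  simp [resample, NetworkSample.fading]

lemma fading_resample_of_ne {s l : FadingLink K} (h : l ≠ s) (ω : NetworkSample K) (q : ℝ) :
    (resample s (ω, q)).fading l = ω.fading l := by
  simp [resample, NetworkSample.fading, h]

end OverlaidNetworks

/-- This is the thinning of a Poisson process: selection with probability `p` acts like multiplying
the density by `p`. -/
lemma lintegral_one_sub_thinned {p : ℝ≥0∞} (hp : p ≤ 1) {g : Plane → ℝ≥0∞} (hg1 : ∀ v, g v ≤ 1) :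
    ∫⁻ v, 1 - thinned p (g v) = p * ∫⁻ v, 1 - g v := by
  simp_rw [fun v => one_sub_thinned hp (hg1 v)]
  rw [lintegral_const_mul' _ _ (hp.trans_lt ENNReal.one_lt_top).ne]

lemma indicator_unitSquare_ne_top (v : Plane) : unitSquare.indicator (1 : Plane → ℝ≥0∞) v ≠ ∞ :=
  ((Set.indicator_le_self' (by simp) v).trans_lt ENNReal.one_lt_top).ne

/-! ### Laplace transforms of the interference under the network law -/

namespace OverlaidNetworks

variable {K : ℕ} {N : OverlaidNetworks K}

lemma isProbabilityMeasure_channel {o : OverlayMethod} (hacc : (N.accessible o).Nonempty) :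
    IsProbabilityMeasure (uniformOn (N.accessible o : Set (Fin K))) :=
  isProbabilityMeasure_uniformOn (N.accessible o).finite_toSet hacc

lemma channelProb_le_one {o : OverlayMethod} (hacc : (N.accessible o).Nonempty) (k : Fin K) :
    N.channelProb o k ≤ 1 := by
  have := isProbabilityMeasure_channel hacc
  exact prob_le_one

/-- The exponent of the Laplace transform of the interference of a unit-density Poisson field. -/
def laplaceExponent (N : OverlaidNetworks K) (u : ℝ) : ℝ :=
  interferenceConst (2 / N.pathLossExp) * u ^ (2 / N.pathLossExp)

/-- Integration proceeds from the inside: fading gives Rayleigh factors, channel selection thins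
those of the ad hoc nodes, and user displacements mix those of the users. The ad hoc field is
independent of the base stations and integrates out wherever the reference base station lies; what
remains is left for Mecke's formula. -/
lemma Standing.lintegral_base (hN : N.Standing) {o : OverlayMethod}
    (hacc : (N.accessible o).Nonempty) {lu la : ℝ} (hb : 0 < lu / N.numOccupied) (ha : 0 < la)
    (i : ℕ) (k : Fin K) {u : ℝ} (hu : 0 < u) :
    ∫⁻ ω, unitSquare.indicator 1 (ω.base i) *
        expNeg (ENNReal.ofReal u * N.baseInterference ω i k) ∂(N.law o lu la) =
      (∫⁻ x, unitSquare.indicator 1 (x i) * ∏' j, (if j = i then 1 else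
          rayleighMixture (N.userShiftLaw k) N.pathLossExp u (x j - x i))
        ∂(N.basePPP (lu / N.numOccupied))) *
      expNeg (ENNReal.ofReal la * (N.channelProb o k * ENNReal.ofReal (N.laplaceExponent u))) := by
  have hpb := (hN.base _ hb).isProbabilityMeasure
  have hpn := (hN.node _ ha).isProbabilityMeasure
  have hpu (nk : ℕ × Fin K) := (hN.user nk.2).1
  have hpu' := fun k => (hN.user k).1
  have hpr := hN.receiver.1
  have hpc := isProbabilityMeasure_channel hacc
  have hpf := hN.isProbabilityMeasure_fadingLaw
  set η := N.pathLossExp with hη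
  have hray := (continuous_rayleighFactor η u).measurable
  have hind := indicator_unitSquare_ne_top
  have htop {a : ℝ≥0∞} (h : a ≤ 1) : a ≠ ∞ := (h.trans_lt ENNReal.one_lt_top).ne
  have hm : Measurable fun ω : NetworkSample K => unitSquare.indicator (1 : Plane → ℝ≥0∞)
      (ω.base i) * expNeg (ENNReal.ofReal u * N.baseInterference ω i k) :=
    ((measurable_one.indicator measurableSet_unitSquare).comp (measurable_base i)).mul
      (measurable_expNeg.comp ((measurable_baseInterference i k).const_mul _))
  have hF (x y : ℕ → Plane) (z : ℕ × Fin K → Plane) (w : ℕ → Plane) (t : ℕ → Fin K) :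
      ∫⁻ F, unitSquare.indicator 1 (NetworkSample.base (x, y, z, w, t, F) i) *
        expNeg (ENNReal.ofReal u * N.baseInterference (x, y, z, w, t, F) i k)
        ∂(Measure.infinitePi N.fadingLaw) =
      unitSquare.indicator 1 (x i) *
        ((∏' j, if j = i then 1 else rayleighFactor η u (x j - x i + z (j, k))) *
          ∏' j, if t j = k then rayleighFactor η u (y j - x i) else 1) := by
    -- Absent interferers receive coefficient `0`, hence factor `1`, so the products run over all
    -- indices.
    have h1 := hN.lintegral_fading (l₁ := fun j => .userToBase j i k)
      (l₂ := fun j => .nodeToBase j i) (by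
        rintro (a | a) (b | b) hab <;> simp_all) (fun _ => rfl) (fun _ => rfl) u
      (fun j => if j = i then 0 else edist (x j + z (j, k)) (x i) ^ (-η))
      (fun j => if t j = k then edist (y j) (x i) ^ (-η) else 0)
    have h2 (F : FadingLink K → ℝ) : N.baseInterference (x, y, z, w, t, F) i k =
        ∑' j, (if j = i then 0 else edist (x j + z (j, k)) (x i) ^ (-η)) *
          ENNReal.ofReal (F (.userToBase j i k)) +
        ∑' j, (if t j = k then edist (y j) (x i) ^ (-η) else 0) *
          ENNReal.ofReal (F (.nodeToBase j i)) := by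
      simp only [baseInterference, interferencePower, NetworkSample.user, NetworkSample.base,
        NetworkSample.node, NetworkSample.channel, NetworkSample.fading, ite_mul, zero_mul, hη]
      rfl
    simp only [NetworkSample.base]
    rw [lintegral_const_mul' _ _ (hind _)]
    simp_rw [h2]
    rw [h1]
    congr 2
    · refine tprod_congr fun j => ?_
      split_ifs
      · simp
      · rw [inv_one_add_mul_edist_rpow, add_sub_right_comm]
    · refine tprod_congr fun j => ?_
      split_ifs
      · rw [inv_one_add_mul_edist_rpow]
      · simp
  have hz (x : ℕ → Plane) : ∫⁻ z : ℕ × Fin K → Plane, (∏' j, if j = i then 1 else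
      rayleighFactor η u (x j - x i + z (j, k)))
        ∂(Measure.infinitePi fun nk : ℕ × Fin K => N.userShiftLaw nk.2) =
      ∏' j, if j = i then 1 else rayleighMixture (N.userShiftLaw k) η u (x j - x i) := by
    refine (lintegral_tprod_infinitePi (fun nk : ℕ × Fin K => N.userShiftLaw nk.2)
      (l := fun j : ℕ => (j, k)) (fun a b h => (Prod.mk.inj h).1)
      (f := fun j z => if j = i then 1 else rayleighFactor η u (x j - x i + z))
      (fun j => ?_) (fun j z => ?_)).trans (tprod_congr fun j => ?_)
    · split_ifs
      · exact measurable_const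
      · fun_prop
    · split_ifs
      · exact le_rfl
      · exact rayleighFactor_le_one _ _ _
    · split_ifs
      · simp
      · rfl
  rw [law, lintegral_prod_six hm, ← lintegral_mul_const' _ _ (expNeg_ne_top _)]
  refine lintegral_congr fun x => ?_
  have hAle (z : ℕ × Fin K → Plane) :
      (∏' j, if j = i then 1 else rayleighFactor η u (x j - x i + z (j, k))) ≤ 1 :=
    ENNReal.tprod_le_one' fun j => by
      split_ifs
      exacts [le_rfl, rayleighFactor_le_one _ _ _]
  have hBle (y : ℕ → Plane) :
      (∏' j, thinned (N.channelProb o k) (rayleighFactor η u (y j - x i))) ≤ 1 :=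
    ENNReal.tprod_le_one' fun j =>
      thinned_le_one (channelProb_le_one hacc k) (rayleighFactor_le_one _ _ _)
  have hxy (y : ℕ → Plane) : ∫⁻ z, ∫⁻ w, ∫⁻ t, ∫⁻ F,
      unitSquare.indicator 1 (NetworkSample.base (x, y, z, w, t, F) i) *
        expNeg (ENNReal.ofReal u * N.baseInterference (x, y, z, w, t, F) i k)
        ∂(Measure.infinitePi N.fadingLaw)
        ∂(Measure.infinitePi fun _ : ℕ => uniformOn (N.accessible o : Set (Fin K)))
        ∂(Measure.infinitePi fun _ : ℕ => N.receiverShiftLaw)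
        ∂(Measure.infinitePi fun nk : ℕ × Fin K => N.userShiftLaw nk.2) =
      unitSquare.indicator 1 (x i) *
        ((∏' j, if j = i then 1 else rayleighMixture (N.userShiftLaw k) η u (x j - x i)) *
          ∏' j, thinned (N.channelProb o k) (rayleighFactor η u (y j - x i))) := by
    simp_rw [hF, fun z : ℕ × Fin K → Plane => lintegral_const_mul' (μ := Measure.infinitePi fun _ : ℕ =>
      uniformOn (N.accessible o : Set (Fin K))) _ (fun t : ℕ → Fin K => (∏' j, if j = i then 1 else
        rayleighFactor η u (x j - x i + z (j, k))) *
          ∏' j, if t j = k then rayleighFactor η u (y j - x i) else 1) (hind (x i)),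
      fun z : ℕ × Fin K → Plane => lintegral_const_mul' (μ := Measure.infinitePi fun _ : ℕ =>
      uniformOn (N.accessible o : Set (Fin K))) _ (fun t : ℕ → Fin K =>
          ∏' j, if t j = k then rayleighFactor η u (y j - x i) else 1) (htop (hAle z)),
      lintegral_tprod_ite_channel _ k (fun j => rayleighFactor_le_one η u (y j - x i)),
      lintegral_const, measure_univ, mul_one]
    rw [lintegral_const_mul' _ _ (hind _)]
    have := htop (hBle y)
    rw [channelProb] at this
    rw [lintegral_mul_const' _ _ this, hz, channelProb]
  simp_rw [hxy]
  rw [lintegral_const_mul' _ _ (hind _), lintegral_const_mul' _ _ (htop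
    (ENNReal.tprod_le_one' fun j => by
      split_ifs
      exacts [le_rfl, rayleighMixture_le_one _ _ _ _])), ← mul_assoc]
  congr 1
  rw [(hN.node _ ha).lintegral_tprod (g := fun v => thinned (N.channelProb o k)
      (rayleighFactor η u v))
    ((continuous_thinned (channelProb_le_one hacc k)).measurable.comp hray)
    (fun v => thinned_le_one (channelProb_le_one hacc k) (rayleighFactor_le_one _ _ _)),
    lintegral_one_sub_thinned (channelProb_le_one hacc k) (rayleighFactor_le_one _ _),
    lintegral_one_sub_rayleighFactor hN.two_lt_pathLossExp hu, laplaceExponent]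

lemma measurable_lintegral_node {p : ℝ≥0∞} (hp : p ≤ 1) (Φ : Measure (ℕ → Plane))
    [SFinite Φ] (u : ℝ) (i : ℕ) : Measurable fun v : Plane => ∫⁻ y, unitSquare.indicator 1 (y i) *
      ∏' j, (if j = i then 1 else
        thinned p (rayleighFactor N.pathLossExp u (y j - y i - v))) ∂Φ := by
  have hray := (continuous_rayleighFactor N.pathLossExp u).measurable
  refine Measurable.lintegral_prod_right' (f := fun q : Plane × (ℕ → Plane) =>
    unitSquare.indicator 1 (q.2 i) * ∏' j, (if j = i then 1 else
      thinned p (rayleighFactor N.pathLossExp u (q.2 j - q.2 i - q.1)))) ?_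
  refine Measurable.mul
    ((measurable_one.indicator measurableSet_unitSquare).comp (by fun_prop)) ?_
  refine Measurable.ennreal_tprod (fun j => ?_) (fun j q => ?_)
  · split_ifs
    · exact measurable_const
    · exact (continuous_thinned hp).measurable.comp (hray.comp (by fun_prop))
  · split_ifs
    exacts [le_rfl, thinned_le_one hp (rayleighFactor_le_one _ _ _)]

/-- Here the user field is the independent one: its average does not depend on the location of the
receiver and factors out. The transmitter process remains, centred at a transmitter and shifted by
the displacement of its receiver. -/
lemma Standing.lintegral_node (hN : N.Standing) {o : OverlayMethod}
    (hacc : (N.accessible o).Nonempty) {lu la : ℝ} (hb : 0 < lu / N.numOccupied) (ha : 0 < la)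
    (i : ℕ) (k : Fin K) {u : ℝ} (hu : 0 < u) :
    ∫⁻ ω, unitSquare.indicator 1 (ω.node i) * (if ω.channel i = k then 1 else 0) *
        expNeg (ENNReal.ofReal u * N.nodeInterferenceOn ω i k) ∂(N.law o lu la) =
      (N.channelProb o k * if k ∈ N.occupied then
        expNeg (ENNReal.ofReal (lu / N.numOccupied) * ENNReal.ofReal (N.laplaceExponent u))
        else 1) *
      ∫⁻ w, ∫⁻ y, unitSquare.indicator 1 (y i) * ∏' j, (if j = i then 1 else
          thinned (N.channelProb o k) (rayleighFactor N.pathLossExp u (y j - y i - w)))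
        ∂(N.nodePPP la) ∂N.receiverShiftLaw := by
  have hpb := (hN.base _ hb).isProbabilityMeasure
  have hpn := (hN.node _ ha).isProbabilityMeasure
  have hpu (nk : ℕ × Fin K) := (hN.user nk.2).1
  have hpu' := fun k => (hN.user k).1
  have hpr := hN.receiver.1
  have hpc := isProbabilityMeasure_channel hacc
  have hpf := hN.isProbabilityMeasure_fadingLaw
  set η := N.pathLossExp with hη
  have hray := (continuous_rayleighFactor η u).measurable
  have hind := indicator_unitSquare_ne_top
  have htop {a : ℝ≥0∞} (h : a ≤ 1) : a ≠ ∞ := (h.trans_lt ENNReal.one_lt_top).ne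
  have hp := channelProb_le_one hacc k
  have hmind : Measurable (unitSquare.indicator (1 : Plane → ℝ≥0∞)) :=
    measurable_one.indicator measurableSet_unitSquare
  have hm : Measurable fun ω : NetworkSample K => unitSquare.indicator (1 : Plane → ℝ≥0∞)
      (ω.node i) * (if ω.channel i = k then 1 else 0) *
      expNeg (ENNReal.ofReal u * N.nodeInterferenceOn ω i k) :=
    ((hmind.comp (measurable_node i)).mul
      (Measurable.ite (measurable_channel i (measurableSet_singleton k)) measurable_const
        measurable_const)).mul
      (measurable_expNeg.comp ((measurable_nodeInterferenceOn i k).const_mul _))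
  have hF (x y : ℕ → Plane) (z : ℕ × Fin K → Plane) (w : ℕ → Plane) (t : ℕ → Fin K) :
      ∫⁻ F, unitSquare.indicator 1 (NetworkSample.node (x, y, z, w, t, F) i) *
        (if NetworkSample.channel (x, y, z, w, t, F) i = k then 1 else 0) *
        expNeg (ENNReal.ofReal u * N.nodeInterferenceOn (x, y, z, w, t, F) i k)
        ∂(Measure.infinitePi N.fadingLaw) =
      unitSquare.indicator 1 (y i) *
        ((if k ∈ N.occupied then ∏' j, rayleighFactor η u (x j - (y i + w i) + z (j, k)) else 1) *
          ((if t i = k then 1 else 0) *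
            ∏' j, if j ≠ i ∧ t j = k then rayleighFactor η u (y j - y i - w i) else 1)) := by
    have h1 := hN.lintegral_fading (l₁ := fun j => .userToNode j i k)
      (l₂ := fun j => .nodeToNode j i) (by
        rintro (a | a) (b | b) hab <;> simp_all) (fun _ => rfl) (fun _ => rfl) u
      (fun j => if k ∈ N.occupied then edist (x j + z (j, k)) (y i + w i) ^ (-η) else 0)
      (fun j => if j ≠ i ∧ t j = k then edist (y j) (y i + w i) ^ (-η) else 0)
    have h2 (F : FadingLink K → ℝ) : N.nodeInterferenceOn (x, y, z, w, t, F) i k =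
        ∑' j, (if k ∈ N.occupied then edist (x j + z (j, k)) (y i + w i) ^ (-η) else 0) *
          ENNReal.ofReal (F (.userToNode j i k)) +
        ∑' j, (if j ≠ i ∧ t j = k then edist (y j) (y i + w i) ^ (-η) else 0) *
          ENNReal.ofReal (F (.nodeToNode j i)) := by
      by_cases hk : k ∈ N.occupied <;>
      · simp only [nodeInterferenceOn, interferencePower, NetworkSample.user, NetworkSample.base,
          NetworkSample.node, NetworkSample.channel, NetworkSample.fading, ite_mul, zero_mul, hη,
          NetworkSample.receiver, hk, if_true, if_false, tsum_zero]
        rfl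
    change ∫⁻ F, unitSquare.indicator 1 (y i) * (if t i = k then 1 else 0) *
        expNeg (ENNReal.ofReal u * N.nodeInterferenceOn (x, y, z, w, t, F) i k)
        ∂(Measure.infinitePi N.fadingLaw) = _
    have hne : unitSquare.indicator (1 : Plane → ℝ≥0∞) (y i) * (if t i = k then 1 else 0) ≠ ∞ :=
      ENNReal.mul_ne_top (hind _) (by split_ifs <;> simp)
    rw [lintegral_const_mul' _ _ hne]
    simp_rw [h2]
    rw [h1, mul_assoc]
    congr 1
    rw [mul_left_comm]
    congr 2
    · split_ifs
      · refine tprod_congr fun j => ?_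
        rw [inv_one_add_mul_edist_rpow, add_sub_right_comm]
      · simp
    · refine tprod_congr fun j => ?_
      split_ifs
      · rw [inv_one_add_mul_edist_rpow, sub_sub]
      · simp
  have hz (x : ℕ → Plane) (v : Plane) : ∫⁻ z : ℕ × Fin K → Plane, (∏' j,
      rayleighFactor η u (x j - v + z (j, k)))
        ∂(Measure.infinitePi fun nk : ℕ × Fin K => N.userShiftLaw nk.2) =
      ∏' j, rayleighMixture (N.userShiftLaw k) η u (x j - v) := by
    refine (lintegral_tprod_infinitePi (fun nk : ℕ × Fin K => N.userShiftLaw nk.2)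
      (l := fun j : ℕ => (j, k)) (fun a b h => (Prod.mk.inj h).1)
      (f := fun j z => rayleighFactor η u (x j - v + z))
      (fun j => by fun_prop) (fun j z => rayleighFactor_le_one _ _ _)).trans ?_
    rfl
  have hx (v : Plane) : ∫⁻ x : ℕ → Plane, ∫⁻ z : ℕ × Fin K → Plane,
      (if k ∈ N.occupied then ∏' j, rayleighFactor η u (x j - v + z (j, k)) else 1)
        ∂(Measure.infinitePi fun nk : ℕ × Fin K => N.userShiftLaw nk.2)
        ∂(N.basePPP (lu / N.numOccupied)) =
      if k ∈ N.occupied then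
        expNeg (ENNReal.ofReal (lu / N.numOccupied) * ENNReal.ofReal (N.laplaceExponent u))
        else 1 := by
    split_ifs
    · simp_rw [hz]
      rw [(hN.base _ hb).lintegral_tprod (continuous_rayleighMixture _ _ _).measurable
        (rayleighMixture_le_one _ _ _), lintegral_one_sub_rayleighMixture _ hN.two_lt_pathLossExp hu,
        laplaceExponent]
    · simp
  have hBle (y : ℕ → Plane) (v : Plane) : (∏' j, if j = i then 1 else
      thinned (N.channelProb o k) (rayleighFactor η u (y j - y i - v))) ≤ 1 :=
    ENNReal.tprod_le_one' fun j => by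
      split_ifs
      exacts [le_rfl, thinned_le_one hp (rayleighFactor_le_one _ _ _)]
  have hAle (x : ℕ → Plane) (z : ℕ × Fin K → Plane) (v : Plane) : (if k ∈ N.occupied then
      ∏' j, rayleighFactor η u (x j - v + z (j, k)) else 1) ≤ 1 := by
    split_ifs
    exacts [ENNReal.tprod_le_one' fun j => rayleighFactor_le_one _ _ _, le_rfl]
  have ht (x y : ℕ → Plane) (z : ℕ × Fin K → Plane) (w : ℕ → Plane) : ∫⁻ t : ℕ → Fin K,
      unitSquare.indicator 1 (y i) *
        ((if k ∈ N.occupied then ∏' j, rayleighFactor η u (x j - (y i + w i) + z (j, k)) else 1) *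
          ((if t i = k then 1 else 0) *
            ∏' j, if j ≠ i ∧ t j = k then rayleighFactor η u (y j - y i - w i) else 1))
        ∂(Measure.infinitePi fun _ : ℕ => uniformOn (N.accessible o : Set (Fin K))) =
      (N.channelProb o k * (unitSquare.indicator 1 (y i) * ∏' j, if j = i then 1 else
          thinned (N.channelProb o k) (rayleighFactor η u (y j - y i - w i)))) *
        (if k ∈ N.occupied then
          ∏' j, rayleighFactor η u (x j - (y i + w i) + z (j, k)) else 1) := by
    rw [lintegral_const_mul' _ _ (hind _), lintegral_const_mul' _ _ (htop (hAle x z _)),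
      lintegral_mul_tprod_ite_channel _ k (fun j => rayleighFactor_le_one η u (y j - y i - w i)) i]
    rw [channelProb]
    ring
  have hne (y : ℕ → Plane) (v : Plane) : N.channelProb o k * (unitSquare.indicator 1 (y i) *
      ∏' j, if j = i then 1 else
        thinned (N.channelProb o k) (rayleighFactor η u (y j - y i - v))) ≠ ∞ :=
    ENNReal.mul_ne_top (htop hp) (ENNReal.mul_ne_top (hind _) (htop (hBle y v)))
  have hxz (y w : ℕ → Plane) : ∫⁻ x : ℕ → Plane, ∫⁻ z : ℕ × Fin K → Plane,
      (N.channelProb o k * (unitSquare.indicator 1 (y i) * ∏' j, if j = i then 1 else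
          thinned (N.channelProb o k) (rayleighFactor η u (y j - y i - w i)))) *
        (if k ∈ N.occupied then
          ∏' j, rayleighFactor η u (x j - (y i + w i) + z (j, k)) else 1)
        ∂(Measure.infinitePi fun nk : ℕ × Fin K => N.userShiftLaw nk.2)
        ∂(N.basePPP (lu / N.numOccupied)) =
      (N.channelProb o k * if k ∈ N.occupied then
        expNeg (ENNReal.ofReal (lu / N.numOccupied) * ENNReal.ofReal (N.laplaceExponent u))
        else 1) * (unitSquare.indicator 1 (y i) * ∏' j, if j = i then 1 else
          thinned (N.channelProb o k) (rayleighFactor η u (y j - y i - w i))) := by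
    simp_rw [fun x : ℕ → Plane => lintegral_const_mul' (μ := Measure.infinitePi
      fun nk : ℕ × Fin K => N.userShiftLaw nk.2) _ (fun z : ℕ × Fin K → Plane =>
        if k ∈ N.occupied then ∏' j, rayleighFactor η u (x j - (y i + w i) + z (j, k)) else 1)
      (hne y (w i))]
    rw [lintegral_const_mul' _ _ (hne y (w i)), hx]
    ring
  have hne' : (N.channelProb o k * if k ∈ N.occupied then
        expNeg (ENNReal.ofReal (lu / N.numOccupied) * ENNReal.ofReal (N.laplaceExponent u))
        else 1) ≠ ∞ :=
    ENNReal.mul_ne_top (htop hp) (by split_ifs; exacts [expNeg_ne_top _, ENNReal.one_ne_top])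
  rw [law, lintegral_prod_six_reorder hm]
  simp_rw [hF, ht, hxz]
  simp_rw [fun w : ℕ → Plane => lintegral_const_mul' (μ := N.nodePPP la) _ (fun y : ℕ → Plane =>
    unitSquare.indicator 1 (y i) * ∏' j, if j = i then 1 else
          thinned (N.channelProb o k) (rayleighFactor η u (y j - y i - w i))) hne']
  rw [lintegral_const_mul' _ _ hne']
  congr 1
  have hmeas := measurable_lintegral_node (K := K) (N := N) hp (N.nodePPP la) u i
  exact (measurePreserving_eval_infinitePi (fun _ : ℕ => N.receiverShiftLaw) i).lintegral_comp hmeas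

lemma channelProb_eq {o : OverlayMethod} (k : Fin K) :
    N.channelProb o k =
      ENNReal.ofReal (if k ∈ N.accessible o then 1 / ((N.accessible o).card : ℝ) else 0) := by
  rw [channelProb, uniformOn, cond_apply (N.accessible o).measurableSet, Measure.count_apply_finset]
  by_cases hk : k ∈ N.accessible o
  · have hpos : (0 : ℝ) < (N.accessible o).card := by
      exact_mod_cast Finset.card_pos.2 ⟨k, hk⟩
    rw [Set.inter_eq_right.2 (by simpa using hk), Measure.count_singleton, mul_one, if_pos hk,
      one_div, ENNReal.ofReal_inv_of_pos hpos, ENNReal.ofReal_natCast]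
  · have : (N.accessible o : Set (Fin K)) ∩ {k} = ∅ := by simpa using hk
    rw [this, if_neg hk]
    simp

/-- The probability that an ad hoc transmitter selects the sub-channel `k`, as a real number. -/
def channelRate (N : OverlaidNetworks K) (o : OverlayMethod) (k : Fin K) : ℝ :=
  if k ∈ N.accessible o then 1 / ((N.accessible o).card : ℝ) else 0

lemma channelRate_nonneg (o : OverlayMethod) (k : Fin K) : 0 ≤ N.channelRate o k := by
  unfold channelRate
  split_ifs <;> positivity

lemma Standing.laplaceExponent_nonneg (hN : N.Standing) {u : ℝ} (hu : 0 < u) :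
    0 ≤ N.laplaceExponent u := by
  have h := hN.two_lt_pathLossExp
  have h1 : 2 / N.pathLossExp < 1 := by rw [div_lt_one (by linarith)]; exact h
  have := interferenceConst_pos (show 0 < 2 / N.pathLossExp by positivity) h1
  unfold laplaceExponent
  positivity

/-- Mecke's formula removes the reference base station and its own user, leaving users of density
`lu / M`; together with the thinned ad hoc field the exponents add. -/
lemma Standing.tsum_lintegral_base (hN : N.Standing) {o : OverlayMethod}
    (hacc : (N.accessible o).Nonempty) {lu la : ℝ} (hb : 0 < lu / N.numOccupied) (ha : 0 < la)
    (k : Fin K) {u : ℝ} (hu : 0 < u) :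
    ∑' i, ∫⁻ ω, unitSquare.indicator 1 (ω.base i) *
        expNeg (ENNReal.ofReal u * N.baseInterference ω i k) ∂(N.law o lu la) =
      ENNReal.ofReal (lu / N.numOccupied) * ENNReal.ofReal (Real.exp
        (-((lu / N.numOccupied + N.channelRate o k * la) * N.laplaceExponent u))) := by
  have hη := hN.two_lt_pathLossExp
  have := (hN.user k).1
  have hl := hN.laplaceExponent_nonneg hu
  have hr := channelRate_nonneg (N := N) o k
  simp_rw [hN.lintegral_base hacc hb ha _ k hu]
  rw [ENNReal.tsum_mul_right]
  obtain ⟨C, hC, h⟩ := exists_one_sub_rayleighMixture_sub_le (N.userShiftLaw k)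
    (show 1 ≤ N.pathLossExp by linarith) hu (show (0 : ℝ) ≤ 4 by norm_num)
  have hI := lintegral_one_sub_rayleighMixture (N.userShiftLaw k) hη hu
  have hm := (continuous_rayleighMixture (N.userShiftLaw k) N.pathLossExp u).measurable
  rw [(hN.base _ hb).tsum_lintegral_mul_tprod_ite (continuous_rayleighMixture _ _ _)
    (rayleighMixture_le_one _ _ _)
    (rayleighMixture_zero_ne_zero _ _ _ (hN.r_eq_d ▸ hN.d_pos) (hN.user k).2)
    (H := fun v => C * (1 - rayleighMixture (N.userShiftLaw k) N.pathLossExp u v))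
    (by fun_prop) ?_ h, hI, mul_assoc, channelProb_eq, ← channelRate, ← laplaceExponent,
    ← ENNReal.ofReal_mul hb.le, ← ENNReal.ofReal_mul hr, ← ENNReal.ofReal_mul ha.le, ← expNeg_add,
    ← ENNReal.ofReal_add (by positivity) (by positivity), expNeg_ofReal (by positivity)]
  · ring_nf
  · rw [lintegral_const_mul' _ _ hC, hI]
    exact ENNReal.mul_ne_top hC ENNReal.ofReal_ne_top

lemma Standing.tsum_lintegral_node (hN : N.Standing) {o : OverlayMethod}
    (hacc : (N.accessible o).Nonempty) {lu la : ℝ} (hb : 0 < lu / N.numOccupied) (ha : 0 < la)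
    (k : Fin K) {u : ℝ} (hu : 0 < u) :
    ∑' i, ∫⁻ ω, unitSquare.indicator 1 (ω.node i) * (if ω.channel i = k then 1 else 0) *
        expNeg (ENNReal.ofReal u * N.nodeInterferenceOn ω i k) ∂(N.law o lu la) =
      ENNReal.ofReal la * N.channelProb o k * ENNReal.ofReal (Real.exp
        (-(((if k ∈ N.occupied then lu / N.numOccupied else 0) + N.channelRate o k * la) *
          N.laplaceExponent u))) := by
  have hη := hN.two_lt_pathLossExp
  have := hN.receiver.1
  have hpn := (hN.node _ ha).isProbabilityMeasure
  have hl := hN.laplaceExponent_nonneg hu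
  have hr := channelRate_nonneg (N := N) o k
  have hd := hN.d_pos
  have hp := channelProb_le_one hacc k
  have hray := (continuous_rayleighFactor N.pathLossExp u).measurable
  simp_rw [hN.lintegral_node hacc hb ha _ k hu]
  rw [ENNReal.tsum_mul_left, ← lintegral_tsum fun i =>
    (measurable_lintegral_node hp (N.nodePPP la) u i).aemeasurable]
  -- The total shift is at most `4` from the Mecke approximation plus `d` from the receiver
  -- displacement.
  obtain ⟨C, hC, h⟩ := exists_one_sub_rayleighFactor_sub_le
    (show 1 ≤ N.pathLossExp by linarith) hu (show (0 : ℝ) ≤ 4 + N.d by positivity)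
  have hI := lintegral_one_sub_rayleighFactor hη hu
  have key : ∀ᵐ w ∂N.receiverShiftLaw, ∑' i, ∫⁻ y, unitSquare.indicator 1 (y i) *
      ∏' j, (if j = i then 1 else
        thinned (N.channelProb o k) (rayleighFactor N.pathLossExp u (y j - y i - w)))
        ∂(N.nodePPP la) = ENNReal.ofReal la * ENNReal.ofReal (Real.exp
          (-(N.channelRate o k * la * N.laplaceExponent u))) := by
    filter_upwards [hN.receiver.2] with w hw
    rw [(hN.node _ ha).tsum_lintegral_mul_tprod_ite
      (g := fun v => thinned (N.channelProb o k) (rayleighFactor N.pathLossExp u (v - w)))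
      ((continuous_thinned hp).comp ((continuous_rayleighFactor _ _).comp (by fun_prop)))
      (fun v => thinned_le_one hp (rayleighFactor_le_one _ _ _))
      (thinned_ne_zero (rayleighFactor_ne_zero _ _ ?_))
      (H := fun v => C * (1 - rayleighFactor N.pathLossExp u v)) (by fun_prop) ?_ ?_,
      lintegral_one_sub_thinned hp fun v => rayleighFactor_le_one _ _ _,
      lintegral_sub_right_eq_self (μ := (volume : Measure Plane))
        (fun v => 1 - rayleighFactor N.pathLossExp u v), hI, channelProb_eq, ← channelRate,
      ← laplaceExponent, ← ENNReal.ofReal_mul hr, ← ENNReal.ofReal_mul ha.le,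
      expNeg_ofReal (by positivity)]
    · ring_nf
    · intro h0
      rw [zero_sub, neg_eq_zero] at h0
      rw [h0, norm_zero] at hw
      exact hd.ne hw
    · rw [lintegral_const_mul' _ _ hC, hI]
      exact ENNReal.mul_ne_top hC ENNReal.ofReal_ne_top
    · intro v w' hw'
      rw [one_sub_thinned hp (rayleighFactor_le_one _ _ _), sub_sub]
      refine (mul_le_of_le_one_left' hp).trans (h v (w' + w) ?_)
      exact (norm_add_le _ _).trans (by linarith)
  have hsplit : (if k ∈ N.occupied then
      expNeg (ENNReal.ofReal (lu / N.numOccupied) * ENNReal.ofReal (N.laplaceExponent u)) else 1) *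
      ENNReal.ofReal (Real.exp (-(N.channelRate o k * la * N.laplaceExponent u))) =
      ENNReal.ofReal (Real.exp (-(((if k ∈ N.occupied then lu / N.numOccupied else 0) +
        N.channelRate o k * la) * N.laplaceExponent u))) := by
    split_ifs
    · rw [← ENNReal.ofReal_mul hb.le, expNeg_ofReal (by positivity),
        ← ENNReal.ofReal_mul (Real.exp_nonneg _), ← Real.exp_add]
      ring_nf
    · simp
  rw [lintegral_congr_ae key, lintegral_const, measure_univ, mul_one, ← hsplit]
  ring

/-- The fading family is the innermost of six factors, so coordinate resampling is lifted through
the five others. -/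
lemma Standing.measurePreserving_resample (hN : N.Standing) {o : OverlayMethod}
    (hacc : (N.accessible o).Nonempty) {lu la : ℝ} (hb : 0 < lu / N.numOccupied) (ha : 0 < la)
    (s : FadingLink K) :
    MeasurePreserving (resample s) ((N.law o lu la).prod (N.fadingLaw s)) (N.law o lu la) := by
  let _ := Classical.decEq (FadingLink K)
  have hpb := (hN.base _ hb).isProbabilityMeasure
  have hpn := (hN.node _ ha).isProbabilityMeasure
  have hpu (nk : ℕ × Fin K) := (hN.user nk.2).1
  have hpr := hN.receiver.1
  have hpc := isProbabilityMeasure_channel hacc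
  have hpf := hN.isProbabilityMeasure_fadingLaw
  have h := (measurePreserving_update_infinitePi N.fadingLaw s).prodMk_resample
    (μa := Measure.infinitePi fun _ : ℕ => uniformOn (N.accessible o : Set (Fin K)))
    |>.prodMk_resample (μa := Measure.infinitePi fun _ : ℕ => N.receiverShiftLaw)
    |>.prodMk_resample (μa := Measure.infinitePi fun nk : ℕ × Fin K => N.userShiftLaw nk.2)
    |>.prodMk_resample (μa := N.nodePPP la)
    |>.prodMk_resample (μa := N.basePPP (lu / N.numOccupied))
  exact h

lemma Standing.tsum_law_base (hN : N.Standing) {o : OverlayMethod}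
    (hacc : (N.accessible o).Nonempty) {lu la : ℝ} (hb : 0 < lu / N.numOccupied) (ha : 0 < la) :
    ∑' i, N.law o lu la ({ω | ω.base i ∈ unitSquare} ∩ Set.univ) =
      ENNReal.ofReal (lu / N.numOccupied) := by
  have hpb := (hN.base _ hb).isProbabilityMeasure
  have hpn := (hN.node _ ha).isProbabilityMeasure
  have hpu (nk : ℕ × Fin K) := (hN.user nk.2).1
  have hpr := hN.receiver.1
  have hpc := isProbabilityMeasure_channel hacc
  have hpf := hN.isProbabilityMeasure_fadingLaw
  rw [← (hN.base _ hb).tsum_measure_unitSquare]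
  refine tsum_congr fun i => ?_
  have : ({ω : NetworkSample K | ω.base i ∈ unitSquare} ∩ Set.univ) =
      {x | x i ∈ unitSquare} ×ˢ Set.univ := by
    ext ω
    simp [NetworkSample.base]
  rw [this, law, Measure.prod_prod, measure_univ, mul_one]

lemma Standing.tsum_law_node (hN : N.Standing) {o : OverlayMethod}
    (hacc : (N.accessible o).Nonempty) {lu la : ℝ} (hb : 0 < lu / N.numOccupied) (ha : 0 < la)
    (k : Fin K) :
    ∑' i, N.law o lu la ({ω | ω.node i ∈ unitSquare} ∩ {ω | ω.channel i = k}) =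
      ENNReal.ofReal la * N.channelProb o k := by
  have hpb := (hN.base _ hb).isProbabilityMeasure
  have hpn := (hN.node _ ha).isProbabilityMeasure
  have hpu (nk : ℕ × Fin K) := (hN.user nk.2).1
  have hpr := hN.receiver.1
  have hpc := isProbabilityMeasure_channel hacc
  have hpf := hN.isProbabilityMeasure_fadingLaw
  rw [← (hN.node _ ha).tsum_measure_unitSquare, ← ENNReal.tsum_mul_right]
  refine tsum_congr fun i => ?_
  have : ({ω : NetworkSample K | ω.node i ∈ unitSquare} ∩ {ω | ω.channel i = k}) =
      Set.univ ×ˢ {y | y i ∈ unitSquare} ×ˢ Set.univ ×ˢ Set.univ ×ˢ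
        {t : ℕ → Fin K | t i = k} ×ˢ Set.univ := by
    ext ω
    simp [NetworkSample.node, NetworkSample.channel]
  rw [this, law]
  simp only [Measure.prod_prod, measure_univ, mul_one, one_mul]
  congr 1
  exact (measurePreserving_eval_infinitePi (fun _ : ℕ =>
    uniformOn (N.accessible o : Set (Fin K))) i).measure_preimage
      (measurableSet_singleton k).nullMeasurableSet

/-! ### Exact outage probabilities -/

/-- The factor by which the outage exponent exceeds the density of the interferers. -/
def outageConst (N : OverlaidNetworks K) : ℝ :=
  interferenceConst (2 / N.pathLossExp) * (N.θ ^ (2 / N.pathLossExp) * N.d ^ 2)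

lemma Standing.θ_div_rpow (hN : N.Standing) :
    (N.θ / N.d ^ (-N.pathLossExp)) ^ (2 / N.pathLossExp) =
      N.θ ^ (2 / N.pathLossExp) * N.d ^ 2 := by
  have hη := hN.two_lt_pathLossExp
  have hd := hN.d_pos
  have hθ := hN.θ_pos
  rw [Real.rpow_neg hd.le, div_inv_eq_mul, Real.mul_rpow hθ.le (by positivity),
    ← Real.rpow_mul hd.le, mul_div_cancel₀ _ (by linarith), Real.rpow_two]

/-- The Palm interference is stable, and the signal gain is compared with `t` times it for `t = θ d
^ η`, so that `t ^ δ = θ ^ δ d ^ 2`. Conditioning is legitimate because the interference does not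
involve the gain of the data link. -/
lemma Standing.baseOutageProb_eq (hN : N.Standing) {o : OverlayMethod}
    (hacc : (N.accessible o).Nonempty) {lu la : ℝ} (hb : 0 < lu / N.numOccupied) (ha : 0 < la)
    (k : Fin K) :
    N.baseOutageProb o lu la k = ENNReal.ofReal (outageFn (2 / N.pathLossExp) N.L₂
      (N.outageConst * (lu / N.numOccupied + N.channelRate o k * la))) := by
  have hη := hN.two_lt_pathLossExp
  have hd := hN.d_pos
  have hθ := hN.θ_pos
  obtain ⟨n, hn⟩ : ∃ n, N.L₂ = n + 1 := ⟨N.L₂ - 1, by have := hN.one_le_L₂; omega⟩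
  have hpb := (hN.base _ hb).isProbabilityMeasure
  have hpn := (hN.node _ ha).isProbabilityMeasure
  have hpu (nk : ℕ × Fin K) := (hN.user nk.2).1
  have hpr := hN.receiver.1
  have hpc := isProbabilityMeasure_channel hacc
  have hpf := hN.isProbabilityMeasure_fadingLaw
  have : IsProbabilityMeasure (N.law o lu la) := by unfold law; infer_instance
  have hS (i : ℕ) : MeasurableSet ({ω : NetworkSample K | ω.base i ∈ unitSquare} ∩ Set.univ) :=
    (measurable_base i measurableSet_unitSquare).inter .univ
  rw [baseOutageProb, hn, typicalProb_eq_outageFn (δ := 2 / N.pathLossExp)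
    (c := (lu / N.numOccupied + N.channelRate o k * la) * interferenceConst (2 / N.pathLossExp))
    (I := fun i ω => N.baseInterference ω i k) (t := N.θ / N.d ^ (-N.pathLossExp)) (n := n)
    (fun i => measurable_baseInterference i k) (ENNReal.ofReal_pos.2 hb).ne'
    ENNReal.ofReal_ne_top (hN.tsum_law_base hacc hb ha) (by positivity) ?_ (by positivity) ?_,
    hN.θ_div_rpow, outageConst]
  · ring_nf
  · intro i
    have hU := hN.measurePreserving_resample hacc hb ha (.cellularData i k)
    rw [fadingLaw, hn] at hU
    unfold baseSIR
    rw [hN.r_eq_d]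
    refine measure_inter_outage hU (hS i) (fun ω q => Iff.rfl) (measurable_fading _)
      (fun ω q => fading_resample_self _ ω q) (measurable_baseInterference i k) (fun ω q => ?_)
      (by positivity)
    simp only [baseInterference]
    congr 1
    · refine tsum_congr fun j => ?_
      rw [fading_resample_of_ne (by simp)]
      rfl
    · refine tsum_congr fun j => ?_
      rw [fading_resample_of_ne (by simp)]
      rfl
  · intro u hu
    rw [mul_assoc, ← laplaceExponent, ← hN.tsum_lintegral_base hacc hb ha k hu]
    refine tsum_congr fun i => ?_
    rw [← lintegral_indicator (hS i)]
    refine lintegral_congr fun ω => ?_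
    by_cases hω : ω.base i ∈ unitSquare <;> simp [hω]

lemma Standing.nodeOutageProb_eq (hN : N.Standing) {o : OverlayMethod} {lu la : ℝ}
    (hb : 0 < lu / N.numOccupied) (ha : 0 < la) {k : Fin K} (hk : k ∈ N.accessible o) :
    N.nodeOutageProb o lu la k = ENNReal.ofReal (outageFn (2 / N.pathLossExp) N.L₁
      (N.outageConst * ((if k ∈ N.occupied then lu / N.numOccupied else 0) +
        N.channelRate o k * la))) := by
  have hη := hN.two_lt_pathLossExp
  have hd := hN.d_pos
  have hθ := hN.θ_pos
  have hacc : (N.accessible o).Nonempty := ⟨k, hk⟩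
  obtain ⟨n, hn⟩ : ∃ n, N.L₁ = n + 1 := ⟨N.L₁ - 1, by have := hN.one_le_L₁; omega⟩
  have hpb := (hN.base _ hb).isProbabilityMeasure
  have hpn := (hN.node _ ha).isProbabilityMeasure
  have hpu (nk : ℕ × Fin K) := (hN.user nk.2).1
  have hpr := hN.receiver.1
  have hpc := isProbabilityMeasure_channel hacc
  have hpf := hN.isProbabilityMeasure_fadingLaw
  have : IsProbabilityMeasure (N.law o lu la) := by unfold law; infer_instance
  have hS (i : ℕ) : MeasurableSet
      ({ω : NetworkSample K | ω.node i ∈ unitSquare} ∩ {ω | ω.channel i = k}) :=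
    (measurable_node i measurableSet_unitSquare).inter
      (measurable_channel i (measurableSet_singleton k))
  have hp0 : N.channelProb o k ≠ 0 := by
    have : (0 : ℝ) < (N.accessible o).card := by exact_mod_cast Finset.card_pos.2 hacc
    rw [channelProb_eq, if_pos hk]
    exact (ENNReal.ofReal_pos.2 (by positivity)).ne'
  have hpt : N.channelProb o k ≠ ∞ := ((channelProb_le_one hacc k).trans_lt ENNReal.one_lt_top).ne
  rw [nodeOutageProb, hn, typicalProb_eq_outageFn (δ := 2 / N.pathLossExp)
    (c := ((if k ∈ N.occupied then lu / N.numOccupied else 0) + N.channelRate o k * la) *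
      interferenceConst (2 / N.pathLossExp))
    (I := fun i ω => N.nodeInterferenceOn ω i k) (t := N.θ / N.d ^ (-N.pathLossExp)) (n := n)
    (fun i => measurable_nodeInterferenceOn i k)
    (mul_ne_zero (ENNReal.ofReal_pos.2 ha).ne' hp0) (ENNReal.mul_ne_top ENNReal.ofReal_ne_top hpt)
    (hN.tsum_law_node hacc hb ha k) (by positivity) ?_ (by positivity) ?_,
    hN.θ_div_rpow, outageConst]
  · ring_nf
  · intro i
    have hU := hN.measurePreserving_resample hacc hb ha (.adHocData i)
    rw [fadingLaw, hn] at hU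
    -- On the conditioning event the random channel of `i` may be replaced by the fixed `k`.
    have hset : {ω : NetworkSample K | ω.node i ∈ unitSquare} ∩ {ω | ω.channel i = k} ∩
        {ω | N.nodeSIR ω i < ENNReal.ofReal N.θ} =
        {ω : NetworkSample K | ω.node i ∈ unitSquare} ∩ {ω | ω.channel i = k} ∩
        {ω | ENNReal.ofReal (N.d ^ (-N.pathLossExp) * ω.fading (.adHocData i)) /
          N.nodeInterferenceOn ω i k < ENNReal.ofReal N.θ} := by
      ext ω
      refine and_congr_right fun hω => ?_
      have hc : ω.channel i = k := hω.2
      simp only [Set.mem_ofPred_eq, nodeSIR, nodeInterference, hc, nodeInterferenceOn]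
    rw [hset]
    refine measure_inter_outage hU (hS i) (fun ω q => Iff.rfl) (measurable_fading _)
      (fun ω q => fading_resample_self _ ω q) (measurable_nodeInterferenceOn i k) (fun ω q => ?_)
      (by positivity)
    simp only [nodeInterferenceOn]
    congr 1
    · split_ifs
      · refine tsum_congr fun j => ?_
        rw [fading_resample_of_ne (by simp)]
        rfl
      · rfl
    · refine tsum_congr fun j => ?_
      rw [fading_resample_of_ne (by simp)]
      rfl
  · intro u hu
    refine Eq.trans (tsum_congr fun i => ?_) ((hN.tsum_lintegral_node hacc hb ha k hu).trans ?_)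
    swap
    · rw [laplaceExponent, ← mul_assoc (_ + _)]
    rw [← lintegral_indicator (hS i)]
    refine lintegral_congr fun ω => ?_
    by_cases hω : ω.node i ∈ unitSquare <;> by_cases hc : ω.channel i = k <;> simp [hω, hc]

end OverlaidNetworks

/-! ### Maximal points and the shape of the capacity regions -/

lemma maximal_add_div_le_iff {a b T : ℝ} (ha : 0 < a) (hb : 0 < b) (p : ℝ × ℝ) :
    Maximal (fun q : ℝ × ℝ => 0 < q.1 ∧ 0 < q.2 ∧ q.1 / a + q.2 / b ≤ T) p ↔
      0 < p.1 ∧ 0 < p.2 ∧ p.1 / a + p.2 / b = T := by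
  constructor
  · rintro ⟨⟨h1, h2, h⟩, hmax⟩
    refine ⟨h1, h2, h.antisymm (not_lt.1 fun hlt => ?_)⟩
    -- Spending the whole slack on the second coordinate would give a larger admissible pair.
    have hpos : 0 < b * (T - (p.1 / a + p.2 / b)) := mul_pos hb (sub_pos.2 hlt)
    have hle := @hmax (p.1, p.2 + b * (T - (p.1 / a + p.2 / b)))
      ⟨h1, by dsimp only; linarith, by
        dsimp only
        rw [add_div, mul_div_cancel_left₀ _ hb.ne']
        linarith⟩ ⟨le_rfl, by dsimp only; linarith⟩
    have := hle.2
    dsimp only at this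
    linarith
  · rintro ⟨h1, h2, h⟩
    refine ⟨⟨h1, h2, h.le⟩, fun q hq hpq => ?_⟩
    have e1 := (div_le_div_iff_of_pos_right ha).2 hpq.1
    have e2 := (div_le_div_iff_of_pos_right hb).2 hpq.2
    have e3 := hq.2.2
    exact ⟨(div_le_div_iff_of_pos_right ha).1 (by linarith),
      (div_le_div_iff_of_pos_right hb).1 (by linarith)⟩

lemma maximal_le_and_le_iff {A B : ℝ} (hA : 0 < A) (hB : 0 < B) (p : ℝ × ℝ) :
    Maximal (fun q : ℝ × ℝ => 0 < q.1 ∧ 0 < q.2 ∧ q.1 ≤ A ∧ q.2 ≤ B) p ↔ p = (A, B) := by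
  constructor
  · rintro ⟨⟨-, -, h3, h4⟩, hmax⟩
    have hle := @hmax (A, B) ⟨hA, hB, le_rfl, le_rfl⟩ ⟨h3, h4⟩
    exact Prod.ext (h3.antisymm hle.1) (h4.antisymm hle.2)
  · rintro rfl
    exact ⟨⟨hA, hB, le_rfl, le_rfl⟩, fun q hq _ => ⟨hq.2.2.1, hq.2.2.2⟩⟩

namespace OverlaidNetworks

variable {K : ℕ} {N : OverlaidNetworks K}

lemma Standing.outageConst_pos (hN : N.Standing) : 0 < N.outageConst := by
  have h := hN.two_lt_pathLossExp
  have hd := hN.d_pos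
  have hθ := hN.θ_pos
  have h1 : 2 / N.pathLossExp < 1 := by rw [div_lt_one (by linarith)]; exact h
  have := interferenceConst_pos (show 0 < 2 / N.pathLossExp by positivity) h1
  unfold outageConst
  positivity

/-- All geometric constants cancel; the surviving `Γ(1-δ)` is the one in the asymptotics of the
thresholds `S ε`. -/
lemma Standing.outageConst_mul_capacityConst (hN : N.Standing) (ε : ℝ) :
    N.outageConst * N.capacityConst ε = K * ε * Real.Gamma (1 - 2 / N.pathLossExp) := by
  have h := hN.two_lt_pathLossExp
  have hd := hN.d_pos
  have hθ := hN.θ_pos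
  have := Real.Gamma_pos_of_pos (show 0 < 1 + 2 / N.pathLossExp by positivity)
  have := Real.rpow_pos_of_pos hθ (2 / N.pathLossExp)
  have := Real.pi_pos
  rw [outageConst, capacityConst, interferenceConst, Real.rpow_neg hθ.le]
  field_simp

/-- A threshold `S` with `S ε ~ c ε` yields a tradeoff constant asymptotic to `capacityConst`. -/
lemma Standing.tendsto_div_capacityConst (hN : N.Standing) (hK : 0 < K) {S : ℝ → ℝ} {x : ℝ}
    (hx : x ≠ 0) (hS : Tendsto (fun ε => S ε / ε) (𝓝[>] 0)
      (𝓝 (Real.Gamma (1 - 2 / N.pathLossExp) * x))) :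
    Tendsto (fun ε => K * (S ε / N.outageConst) / (N.capacityConst ε * x)) (𝓝[>] 0) (𝓝 1) := by
  have h := hN.two_lt_pathLossExp
  have h1 : 2 / N.pathLossExp < 1 := by rw [div_lt_one (by linarith)]; exact h
  have hG := Real.Gamma_pos_of_pos (sub_pos.2 h1)
  have hκ := hN.outageConst_pos
  have hK' : (0 : ℝ) < K := by exact_mod_cast hK
  have h2 := hS.div_const (Real.Gamma (1 - 2 / N.pathLossExp) * x)
  rw [div_self (mul_ne_zero hG.ne' hx)] at h2
  refine h2.congr' ?_
  filter_upwards [self_mem_nhdsWithin] with ε hε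
  have hε' : (0 : ℝ) < ε := hε
  have hc := hN.outageConst_mul_capacityConst ε
  have hcc : N.capacityConst ε = K * ε * Real.Gamma (1 - 2 / N.pathLossExp) / N.outageConst := by
    rw [eq_div_iff hκ.ne', mul_comm, hc]
  rw [hcc]
  field_simp

/-- Occupied sub-channels are the worst for ad hoc links, and there both kinds of links see the same
exponent. As outage decreases with the diversity order, only the link of smaller order constrains.
-/
lemma Standing.mem_capacityRegion_blind_iff (hN : N.Standing) (hocc : N.occupied.Nonempty)
    {S ε : ℝ} (hε : 0 < ε) (hS : ∀ s, 0 ≤ s →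
      (outageFn (2 / N.pathLossExp) (min N.L₁ N.L₂) s ≤ ε ↔ s ≤ S)) (p : ℝ × ℝ) :
    p ∈ N.capacityRegion .blindTransmission ε ↔
      0 < p.1 ∧ 0 < p.2 ∧ p.1 / N.numOccupied + p.2 / K ≤ S / N.outageConst := by
  have h := hN.two_lt_pathLossExp
  have h0 : 0 < 2 / N.pathLossExp := by positivity
  have h1 : 2 / N.pathLossExp < 1 := by rw [div_lt_one (by linarith)]; exact h
  obtain ⟨k₀, hk₀⟩ := hocc
  have hM : (0 : ℝ) < N.numOccupied := by
    exact_mod_cast Finset.card_pos.2 ⟨k₀, hk₀⟩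
  have hκ := hN.outageConst_pos
  have hrate (k : Fin K) : N.channelRate .blindTransmission k = 1 / K := by
    simp [channelRate, accessible]
  have hacc : (N.accessible .blindTransmission).Nonempty := ⟨k₀, Finset.mem_univ _⟩
  rw [capacityRegion, Set.mem_ofPred_eq]
  refine and_congr_right fun hp1 => and_congr_right fun hp2 => ?_
  have hb : 0 < p.1 / N.numOccupied := by positivity
  have hs : 0 ≤ N.outageConst * (p.1 / N.numOccupied + p.2 / K) := by positivity
  have key : p.1 / N.numOccupied + p.2 / K ≤ S / N.outageConst ↔
      outageFn (2 / N.pathLossExp) (min N.L₁ N.L₂)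
        (N.outageConst * (p.1 / N.numOccupied + p.2 / K)) ≤ ε := by
    rw [hS _ hs, le_div_iff₀' hκ]
  have hanti := outageFn_antitone h0 h1 hs
  have hbase (k : Fin K) : N.baseOutageProb .blindTransmission p.1 p.2 k ≤ ENNReal.ofReal ε ↔
      outageFn (2 / N.pathLossExp) N.L₂
        (N.outageConst * (p.1 / N.numOccupied + p.2 / K)) ≤ ε := by
    rw [hN.baseOutageProb_eq hacc hb hp2, hrate, ENNReal.ofReal_le_ofReal_iff hε.le,
      one_div_mul_eq_div]
  have hnode (k : Fin K) : N.nodeOutageProb .blindTransmission p.1 p.2 k ≤ ENNReal.ofReal ε ↔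
      outageFn (2 / N.pathLossExp) N.L₁ (N.outageConst *
        ((if k ∈ N.occupied then p.1 / N.numOccupied else 0) + p.2 / K)) ≤ ε := by
    rw [hN.nodeOutageProb_eq hb hp2 (Finset.mem_univ k), hrate, ENNReal.ofReal_le_ofReal_iff hε.le,
      one_div_mul_eq_div]
  rw [key]
  constructor
  · rintro ⟨hB, hA⟩
    have hA' := (hnode k₀).1 (hA k₀ (Finset.mem_univ _))
    rw [if_pos hk₀] at hA'
    rcases min_choice N.L₁ N.L₂ with hm | hm <;> rw [hm]
    exacts [hA', (hbase k₀).1 (hB k₀ hk₀)]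
  · intro hmin
    refine ⟨fun k _ => (hbase k).2 ((hanti (min_le_right _ _)).trans hmin), fun k _ =>
      (hnode k).2 ?_⟩
    obtain ⟨n, hn⟩ : ∃ n, N.L₁ = n + 1 := ⟨N.L₁ - 1, by have := hN.one_le_L₁; omega⟩
    have hle : outageFn (2 / N.pathLossExp) N.L₁ (N.outageConst *
        ((if k ∈ N.occupied then p.1 / N.numOccupied else 0) + p.2 / K)) ≤
        outageFn (2 / N.pathLossExp) N.L₁
          (N.outageConst * (p.1 / N.numOccupied + p.2 / K)) := by
      have h3 : 0 ≤ (if k ∈ N.occupied then p.1 / (N.numOccupied : ℝ) else 0) := by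
        split_ifs <;> positivity
      have h4 : (if k ∈ N.occupied then p.1 / (N.numOccupied : ℝ) else 0) ≤
          p.1 / N.numOccupied := by
        split_ifs
        exacts [le_rfl, hb.le]
      rw [hn]
      refine (strictMonoOn_outageFn h0 h1 n).monotoneOn ?_ hs (by gcongr)
      rw [Set.mem_Ici]
      positivity
    exact hle.trans ((hanti (min_le_left _ _)).trans hmin)

/-- No sub-channel carries both kinds of transmissions, so each constraint involves a single
density: per-channel `lu / M` for the users and `la / (K - M)` for the ad hoc nodes. -/
lemma Standing.mem_capacityRegion_exclusion_iff (hN : N.Standing) (hocc : N.occupied.Nonempty)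
    (huniv : N.occupied ≠ Finset.univ) {S₁ S₂ ε : ℝ} (hε : 0 < ε)
    (hS₁ : ∀ s, 0 ≤ s → (outageFn (2 / N.pathLossExp) N.L₁ s ≤ ε ↔ s ≤ S₁))
    (hS₂ : ∀ s, 0 ≤ s → (outageFn (2 / N.pathLossExp) N.L₂ s ≤ ε ↔ s ≤ S₂)) (p : ℝ × ℝ) :
    p ∈ N.capacityRegion .frequencyMutualExclusion ε ↔
      0 < p.1 ∧ 0 < p.2 ∧ p.1 ≤ N.numOccupied * (S₂ / N.outageConst) ∧
        p.2 ≤ (K - N.numOccupied) * (S₁ / N.outageConst) := by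
  have hne := hocc
  obtain ⟨k₀, hk₀⟩ := hocc
  obtain ⟨k₁, hk₁⟩ : ∃ k, k ∉ N.occupied := by simpa [Finset.eq_univ_iff_forall] using huniv
  have hM : (0 : ℝ) < N.numOccupied := by
    exact_mod_cast Finset.card_pos.2 hne
  have hκ := hN.outageConst_pos
  have hcard : ((N.accessible .frequencyMutualExclusion).card : ℝ) = K - N.numOccupied := by
    rw [accessible, Finset.card_compl, Fintype.card_fin, Nat.cast_sub
      (by simpa using N.occupied.card_le_univ), numOccupied]
  have hacc : (N.accessible .frequencyMutualExclusion).Nonempty :=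
    ⟨k₁, Finset.mem_compl.2 hk₁⟩
  have hKM : (0 : ℝ) < K - N.numOccupied := by
    rw [← hcard]
    exact_mod_cast Finset.card_pos.2 hacc
  rw [capacityRegion, Set.mem_ofPred_eq]
  refine and_congr_right fun hp1 => and_congr_right fun hp2 => ?_
  have hb : 0 < p.1 / N.numOccupied := by positivity
  refine and_congr ?_ ?_
  · have hiff (k) (hk : k ∈ N.occupied) :
        N.baseOutageProb .frequencyMutualExclusion p.1 p.2 k ≤ ENNReal.ofReal ε ↔
          p.1 ≤ N.numOccupied * (S₂ / N.outageConst) := by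
      have hr : N.channelRate .frequencyMutualExclusion k = 0 :=
        if_neg (by simpa [accessible] using hk)
      rw [hN.baseOutageProb_eq hacc hb hp2, hr, ENNReal.ofReal_le_ofReal_iff hε.le, zero_mul,
        add_zero, hS₂ _ (by positivity), ← div_le_iff₀' hM, le_div_iff₀' hκ]
    exact ⟨fun h => (hiff k₀ hk₀).1 (h k₀ hk₀), fun h k hk => (hiff k hk).2 h⟩
  · have hiff (k) (hk : k ∈ N.accessible .frequencyMutualExclusion) :
        N.nodeOutageProb .frequencyMutualExclusion p.1 p.2 k ≤ ENNReal.ofReal ε ↔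
          p.2 ≤ (K - N.numOccupied) * (S₁ / N.outageConst) := by
      have hr : N.channelRate .frequencyMutualExclusion k = 1 / (K - N.numOccupied) := by
        rw [channelRate, if_pos hk, hcard]
      rw [hN.nodeOutageProb_eq hb hp2 hk, hr, ENNReal.ofReal_le_ofReal_iff hε.le,
        if_neg (by simpa [accessible] using hk), zero_add, one_div_mul_eq_div,
        hS₁ _ (by positivity), ← div_le_iff₀' hKM, le_div_iff₀' hκ]
    exact ⟨fun h => (hiff k₁ (Finset.mem_compl.2 hk₁)).1 (h k₁ (Finset.mem_compl.2 hk₁)),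
      fun h k hk => (hiff k hk).2 h⟩

end OverlaidNetworks

end

/-! ### The tradeoff curves -/

theorem lemma2 {K : ℕ} (N : OverlaidNetworks K)
    (hpath : 2 < N.pathLossExp) (hθ : 0 < N.θ) (hd : 0 < N.d) (hrd : N.r = N.d)
    (hL₁ : 1 ≤ N.L₁) (hL₂ : 1 ≤ N.L₂)
    (hocc : N.occupied.Nonempty)
    (huser : ∀ k, IsProbabilityMeasure (N.userShiftLaw k) ∧ ∀ᵐ z ∂(N.userShiftLaw k), ‖z‖ = N.r)
    (hrec : IsProbabilityMeasure N.receiverShiftLaw ∧ ∀ᵐ y ∂N.receiverShiftLaw, ‖y‖ = N.d)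
    (hbase : ∀ l, 0 < l → IsHomogeneousPPP l (N.basePPP l))
    (hnode : ∀ l, 0 < l → IsHomogeneousPPP l (N.nodePPP l))
    (δ : ℝ) (hδ : δ = 2 / N.pathLossExp) :
    (∃ c : ℝ → ℝ,
      (∀ ε : ℝ, 0 < ε → ε < 1 → ∀ p : ℝ × ℝ,
        N.IsCapacityPair .blindTransmission ε p ↔
          0 < p.1 ∧ 0 < p.2 ∧ p.1 / N.fraction + p.2 = c ε) ∧
      Tendsto (fun ε => c ε / (N.capacityConst ε *
          (Real.Gamma (min N.L₁ N.L₂ : ℕ) / Real.Gamma ((min N.L₁ N.L₂ : ℕ) - δ))))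
        (𝓝[>] 0) (𝓝 1)) ∧
    (N.occupied ≠ Finset.univ →
      ∃ c : ℝ → ℝ,
        (∀ ε : ℝ, 0 < ε → ε < 1 →
          (∃ p : ℝ × ℝ, N.IsCapacityPair .frequencyMutualExclusion ε p) ∧
          ∀ p : ℝ × ℝ, N.IsCapacityPair .frequencyMutualExclusion ε p →
            p.1 / N.fraction + p.2 / (1 - N.fraction) = c ε) ∧
        Tendsto (fun ε => c ε / (N.capacityConst ε *
            (Real.Gamma N.L₁ / Real.Gamma (N.L₁ - δ) + Real.Gamma N.L₂ / Real.Gamma (N.L₂ - δ))))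
          (𝓝[>] 0) (𝓝 1)) := by
  have hN : N.Standing := ⟨hpath, hθ, hd, hrd, hL₁, hL₂, huser, hrec, hbase, hnode⟩
  subst hδ
  have h0 : 0 < 2 / N.pathLossExp := by positivity
  have h1 : 2 / N.pathLossExp < 1 := by rw [div_lt_one (by linarith)]; exact hpath
  have hM : (0 : ℝ) < N.numOccupied := by exact_mod_cast Finset.card_pos.2 hocc
  have hK : 0 < K := hocc.choose.pos
  have hK' : (0 : ℝ) < K := by exact_mod_cast hK
  have hκ := hN.outageConst_pos
  have hquot {L : ℕ} (hL : 1 ≤ L) :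
      0 < Real.Gamma L / Real.Gamma (L - 2 / N.pathLossExp) := by
    have hL' : (1 : ℝ) ≤ L := by exact_mod_cast hL
    exact div_pos (Real.Gamma_pos_of_pos (by linarith)) (Real.Gamma_pos_of_pos (by linarith))
  refine ⟨?_, fun huniv => ?_⟩
  · have hmin : 1 ≤ min N.L₁ N.L₂ := le_min hL₁ hL₂
    obtain ⟨S, hS, hlim⟩ := exists_outageFn_le_iff h0 h1 hmin
    rw [mul_div_assoc] at hlim
    refine ⟨fun ε => K * (S ε / N.outageConst), fun ε hε hε1 p => ?_,
      hN.tendsto_div_capacityConst hK (hquot hmin).ne' hlim⟩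
    rw [OverlaidNetworks.IsCapacityPair]
    simp_rw [hN.mem_capacityRegion_blind_iff hocc hε (hS ε hε hε1).2]
    rw [maximal_add_div_le_iff hM hK']
    refine and_congr_right fun _ => and_congr_right fun _ => ?_
    have : p.1 / N.fraction + p.2 = K * (p.1 / N.numOccupied + p.2 / K) := by
      rw [OverlaidNetworks.fraction]
      field_simp
    rw [this, mul_right_inj' hK'.ne']
  · obtain ⟨S₁, hS₁, hlim₁⟩ := exists_outageFn_le_iff h0 h1 hL₁
    obtain ⟨S₂, hS₂, hlim₂⟩ := exists_outageFn_le_iff h0 h1 hL₂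
    rw [mul_div_assoc] at hlim₁ hlim₂
    -- At the corner of the box the weighted sum is `K` times the sum of both thresholds over
    -- `outageConst`, so the asymptotic constants add.
    have hlim := hlim₁.add hlim₂
    simp_rw [← add_div, ← mul_add] at hlim
    have hlt : N.numOccupied < K := by
      obtain ⟨k, hk⟩ : ∃ k, k ∉ N.occupied := by simpa [Finset.eq_univ_iff_forall] using huniv
      simpa [OverlaidNetworks.numOccupied] using Finset.card_lt_univ_of_notMem hk
    have hKM : (0 : ℝ) < K - N.numOccupied := sub_pos.2 (by exact_mod_cast hlt)
    have hiff (ε : ℝ) (hε : 0 < ε) (hε1 : ε < 1) (p : ℝ × ℝ) :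
        N.IsCapacityPair .frequencyMutualExclusion ε p ↔
          p = (N.numOccupied * (S₂ ε / N.outageConst),
            (K - N.numOccupied) * (S₁ ε / N.outageConst)) := by
      have hp₁ := (hS₁ ε hε hε1).1
      have hp₂ := (hS₂ ε hε hε1).1
      rw [OverlaidNetworks.IsCapacityPair]
      simp_rw [hN.mem_capacityRegion_exclusion_iff hocc huniv hε (hS₁ ε hε hε1).2
        (hS₂ ε hε hε1).2]
      exact maximal_le_and_le_iff (by positivity) (by positivity) p
    refine ⟨fun ε => K * ((S₁ ε + S₂ ε) / N.outageConst), fun ε hε hε1 =>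
      ⟨⟨_, (hiff ε hε hε1 _).2 rfl⟩, fun p hp => ?_⟩,
      hN.tendsto_div_capacityConst hK (add_pos (hquot hL₁) (hquot hL₂)).ne' hlim⟩
    have h2 : 1 - N.fraction = (K - N.numOccupied) / K := by
      rw [OverlaidNetworks.fraction, sub_div, div_self hK'.ne']
    rw [(hiff ε hε hε1 p).1 hp, h2, OverlaidNetworks.fraction]
    field_simp
    ring
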